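/- Let $D\subset\mathbb R^d$ ($d\ge 1$) be a bounded open set, $H=L^2(D)$, and let $A$ be the realization in $H$ of the Laplacian with Dirichlet boundary conditions. Let $\{e_k\}_{k\ge1}$ be an orthonormal basis of $H$ with $Ae_k=-\alpha_ke_k$, $0<\alpha_1\le\alpha_k\le\alpha_{k+1}$, and assume $c^{-1}k^{2/d}\le\alpha_k\le c\,k^{2/d}$ for all $k\geq 1$ and some $c>0$. For $\delta\in\mathbb R$ let $H^\delta$ be the Hilbert space of (formal) series $x=\sum_k x_ke_k$, $x_k\in\mathbb R$, with $|x|_{H^\delta}^2=\sum_k\alpha_k^\delta x_k^2<\infty$; thus $H^0=H$. Put $\mathcal H=H\times H^{-1}$. Let $Q:H\to H$ be a bounded linear operator with $Qe_k=\lambda_ke_k$ and $c^{-1}\alpha_k^{-\beta}\le\lambda_k\le c\,\alpha_k^{-\beta}$ for all $k\geq 1$, for some $c>0$ and some $\beta>(d-2)/4$. Let $B:H\to H$ satisfy $B(0)=0$ and assume that, for every $\delta\in[0,1+2\beta]$, $B$ maps $H^\delta$ into $H^\delta$ and is Lipschitz continuous there with some constant $\gamma_\delta<\alpha_1$. For $\mu>0$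 let $S_\mu(t)$ be the semigroup on $\mathcal H$ generated by $A_\mu(u,v)=\left(v,\tfrac1\mu(Au-v)\right)$, and let $B_\mu(u,v)=\tfrac1\mu(0,B(u))$ and $Q_\mu h=\tfrac1\mu(0,Qh)$. For $t_1<t_2$ and $z\in C([t_1,t_2];\mathcal H)$ let $$I^\mu_{t_1,t_2}(z)=\tfrac12\inf\left\{|\psi|^2_{L^2((t_1,t_2);H)}\right\}\in[0,+\infty],$$ where the infimum ($+\infty$ if there is no such $\psi$) is over all $\psi\in L^2((t_1,t_2);H)$ such that, for all $t\in[t_1,t_2]$, $$z(t)=S_\mu(t-t_1)z(t_1)+\int_{t_1}^tS_\mu(t-s)B_\mu(z(s))\,ds+\int_{t_1}^tS_\mu(t-s)Q_\mu\psi(s)\,ds .$$ Define, for $(x,y)\in\mathcal H$, $$V^\mu(x,y)=\inf\left\{I^\mu_{0,T}(z): T>0,\ z\in C([0,T];\mathcal H),\ z(0)=0,\ z(T)=(x,y)\right\},\qquad V_\mu(x)=\inf_{y\in H^{-1}}V^\mu(x,y).$$ Then there exists $\mu_0>0$ such that, for every $\mu\in(0,\mu_0]$ and every $r\ge0$, the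 level set $\{(x,y)\in\mathcal H: V^\mu(x,y)\le r\}$ is compact in $\mathcal H$ and the level set $\{x\in H: V_\mu(x)\le r\}$ is compact in $H$. In particular, for every $\mu\in(0,\mu_0]$, the functions $V^\mu:\mathcal H\to[0,+\infty]$ and $V_\mu:H\to[0,+\infty]$ are lower semicontinuous. -/

import Mathlib

open MeasureTheory Set Filter Topology
open scoped ENNReal NNReal ContDiff Gradient

noncomputable section

namespace DampedWave

/-! ### The space `H = L²(D)` and the Dirichlet Laplacian -/

/-- The Hilbert space `H = L²(D)` of real square integrable functions on `D ⊆ ℝᵈ`. -/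
abbrev L2 {d : ℕ} (D : Set (EuclideanSpace ℝ (Fin d))) : Type :=
  Lp ℝ 2 (volume.restrict D)

variable {d : ℕ} {D : Set (EuclideanSpace ℝ (Fin d))}

/-- Test functions `φ ∈ C₀^∞(D)`. -/
def IsTest (D : Set (EuclideanSpace ℝ (Fin d))) (φ : EuclideanSpace ℝ (Fin d) → ℝ) : Prop :=
  ContDiff ℝ ∞ φ ∧ HasCompactSupport φ ∧ tsupport φ ⊆ D

/-- `u ∈ H₀¹(D)`: test functions converge to `u` in `L²(D)` while their gradients converge
in `L²(D)`. -/
def MemH01 (D : Set (EuclideanSpace ℝ (Fin d))) (u : L2 D) : Prop :=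
  ∃ (φ : ℕ → EuclideanSpace ℝ (Fin d) → ℝ)
    (g : EuclideanSpace ℝ (Fin d) → EuclideanSpace ℝ (Fin d)),
    (∀ n, IsTest D (φ n)) ∧ MemLp g 2 (volume.restrict D) ∧
    Tendsto (fun n => eLpNorm (fun ξ => φ n ξ - u ξ) 2 (volume.restrict D)) atTop (𝓝 0) ∧
    Tendsto (fun n => eLpNorm (fun ξ => gradient (φ n) ξ - g ξ) 2 (volume.restrict D))
      atTop (𝓝 0)

/-- The graph of the realization `A` in `L²(D)` of the Laplace operator with Dirichlet boundary
conditions: `u ∈ D(A)` and `A u = f`, that is, `u ∈ H₀¹(D)` and `Δ u = f` in the sense of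
distributions on `D`. -/
def DirichletLaplacian (D : Set (EuclideanSpace ℝ (Fin d))) (u f : L2 D) : Prop :=
  MemH01 D u ∧ ∀ φ : EuclideanSpace ℝ (Fin d) → ℝ, IsTest D φ →
    ∫ ξ in D, u ξ * Laplacian.laplacian φ ξ = ∫ ξ in D, f ξ * φ ξ

/-- An orthonormal basis `e_k` of `L²(D)` of Dirichlet eigenfunctions, `A e_k = -α_k e_k`, with
the eigenvalues ordered so that `0 < α_1 ≤ α_k ≤ α_{k+1}` (the index starts at `0` here). -/
structure DirichletEigenbasis (D : Set (EuclideanSpace ℝ (Fin d))) where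
  e : HilbertBasis ℕ ℝ (L2 D)
  α : ℕ → ℝ
  α_pos : 0 < α 0
  α_mono : Monotone α
  eigen : ∀ k, DirichletLaplacian D (e k) ((-α k) • e k)

namespace DirichletEigenbasis

variable (E : DirichletEigenbasis D)

lemma pos (k : ℕ) : 0 < E.α k := E.α_pos.trans_le (E.α_mono (Nat.zero_le k))

/-- The Fourier coefficients `x_k = ⟨x, e_k⟩_H` of `x ∈ L²(D)`. -/
def coeff (x : L2 D) (k : ℕ) : ℝ := E.e.repr x k

lemma summable_coeff_sq (x : L2 D) : Summable fun k => E.coeff x k ^ 2 := by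
  have h := (memℓp_gen_iff (p := 2) (by simp)).1 (lp.memℓp (E.e.repr x))
  simpa [coeff] using h

/-! ### The spaces `H^δ` -/

/-- The sequence `(x_k)` of Fourier coefficients satisfies `∑ α_k^δ x_k² < ∞`. -/
def MemSobolev (δ : ℝ) (x : ℕ → ℝ) : Prop := Summable fun k => E.α k ^ δ * x k ^ 2

/-- `|x|_{H^δ} = (∑ α_k^δ x_k²)^{1/2}`. -/
def sobolevNorm (δ : ℝ) (x : ℕ → ℝ) : ℝ := √(∑' k, E.α k ^ δ * x k ^ 2)

/-- The vector space underlying `H^δ`. -/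
def sobolevSubmodule (δ : ℝ) : Submodule ℝ (ℕ → ℝ) where
  carrier := {x | E.MemSobolev δ x}
  zero_mem' := by simp [MemSobolev]
  add_mem' := by
    intro x y hx hy
    refine Summable.of_nonneg_of_le
      (fun k => mul_nonneg (Real.rpow_nonneg (E.pos k).le _) (sq_nonneg _)) (fun k => ?_)
      ((hx.add hy).mul_left 2)
    have h := Real.rpow_nonneg (E.pos k).le δ
    have h2 : (x k + y k) ^ 2 ≤ 2 * (x k ^ 2 + y k ^ 2) := by nlinarith [sq_nonneg (x k - y k)]
    calc E.α k ^ δ * (x k + y k) ^ 2 ≤ E.α k ^ δ * (2 * (x k ^ 2 + y k ^ 2)) := by gcongr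
      _ = _ := by ring
  smul_mem' := by
    intro c x hx
    have h : Summable fun k => c ^ 2 * (E.α k ^ δ * x k ^ 2) := Summable.mul_left (c ^ 2) hx
    refine h.congr fun k => ?_
    simp only [Pi.smul_apply, smul_eq_mul]
    ring

/-- The Hilbert space `H^δ`, each element being given by its sequence `(x_k)` of Fourier
coefficients: `x = ∑ x_k e_k` with `|x|²_{H^δ} = ∑ α_k^δ x_k² < ∞`. It carries the norm
`|·|_{H^δ}`. -/
def Hs (δ : ℝ) : Type := ↥(E.sobolevSubmodule δ)

instance (δ : ℝ) : AddCommGroup (E.Hs δ) := inferInstanceAs (AddCommGroup (E.sobolevSubmodule δ))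

instance (δ : ℝ) : Module ℝ (E.Hs δ) := inferInstanceAs (Module ℝ (E.sobolevSubmodule δ))

lemma rpow_half_mul_sq (δ : ℝ) (k : ℕ) (c : ℝ) :
    (E.α k ^ (δ / 2) * c) ^ 2 = E.α k ^ δ * c ^ 2 := by
  rw [mul_pow, ← Real.rpow_natCast (E.α k ^ (δ / 2)) 2, ← Real.rpow_mul (E.pos k).le]
  norm_num

/-- The isomorphism `(x_k) ↦ (α_k^{δ/2} x_k)` of `H^δ` onto `ℓ²`, which induces the norm. -/
def toEll2 (δ : ℝ) : E.Hs δ ≃ₗ[ℝ] lp (fun _ : ℕ => ℝ) 2 where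
  toFun x := ⟨fun k => E.α k ^ (δ / 2) * x.1 k, by
    refine memℓp_gen ?_
    have hx : Summable fun k => E.α k ^ δ * x.1 k ^ 2 := x.2
    refine hx.congr fun k => ?_
    rw [← rpow_half_mul_sq]
    simp [mul_pow]⟩
  invFun y := ⟨fun k => E.α k ^ (-(δ / 2)) * y k, by
    have h := (memℓp_gen_iff (p := 2) (by simp)).1 (lp.memℓp y)
    change Summable fun k => E.α k ^ δ * (E.α k ^ (-(δ / 2)) * y k) ^ 2
    have h' : Summable fun k => (y k) ^ 2 := by simpa using h
    refine h'.congr fun k => ?_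
    rw [← rpow_half_mul_sq, ← mul_assoc, ← Real.rpow_add (E.pos k)]
    simp⟩
  map_add' x y := by
    ext k
    exact mul_add _ _ _
  map_smul' c x := by
    ext k
    exact mul_left_comm _ _ _
  left_inv x := by
    apply Subtype.ext
    funext k
    change E.α k ^ (-(δ / 2)) * (E.α k ^ (δ / 2) * x.1 k) = x.1 k
    rw [← mul_assoc, ← Real.rpow_add (E.pos k)]
    simp
  right_inv y := by
    ext k
    change E.α k ^ (δ / 2) * (E.α k ^ (-(δ / 2)) * y k) = y k
    rw [← mul_assoc, ← Real.rpow_add (E.pos k)]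
    simp

instance (δ : ℝ) : NormedAddCommGroup (E.Hs δ) :=
  NormedAddCommGroup.induced (E.Hs δ) (lp (fun _ : ℕ => ℝ) 2) (E.toEll2 δ).toLinearMap
    (E.toEll2 δ).injective

instance (δ : ℝ) : NormedSpace ℝ (E.Hs δ) :=
  NormedSpace.induced ℝ (E.Hs δ) (lp (fun _ : ℕ => ℝ) 2) (E.toEll2 δ).toLinearMap

lemma norm_toEll2 (δ : ℝ) (x : E.Hs δ) : ‖E.toEll2 δ x‖ = ‖x‖ := rfl

instance (δ : ℝ) : CompleteSpace (E.Hs δ) := by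
  have h : Isometry (E.toEll2 δ) :=
    AddMonoidHomClass.isometry_of_norm (E.toEll2 δ) (E.norm_toEll2 δ)
  exact (h.isUniformInducing.completeSpace_congr (E.toEll2 δ).surjective).2 inferInstance

lemma norm_eq_sobolevNorm (δ : ℝ) (x : E.Hs δ) : ‖x‖ = E.sobolevNorm δ x.1 := by
  have h := lp.norm_rpow_eq_tsum (p := 2) (by simp) (E.toEll2 δ x)
  rw [norm_toEll2] at h
  have h2 : ‖x‖ ^ 2 = ∑' k, E.α k ^ δ * x.1 k ^ 2 := by
    have h3 : ∀ k, ‖(E.toEll2 δ x) k‖ ^ 2 = E.α k ^ δ * x.1 k ^ 2 := fun k => by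
      rw [Real.norm_eq_abs, sq_abs]
      exact E.rpow_half_mul_sq δ k _
    have h4 : ‖x‖ ^ 2 = ∑' k, ‖(E.toEll2 δ x) k‖ ^ 2 := by
      simpa only [ENNReal.toReal_ofNat, Real.rpow_ofNat] using h
    rw [h4]
    exact tsum_congr h3
  rw [sobolevNorm, ← h2, Real.sqrt_sq (norm_nonneg x)]

/-- The phase space `ℋ = H × H^{-1}` (with the product topology). -/
abbrev Phase : Type := L2 D × E.Hs (-1)

/-- The embedding of `H = L²(D)` into `H^{-1}`. -/
def incl (x : L2 D) : E.Hs (-1) := ⟨E.coeff x, by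
  change Summable fun k => E.α k ^ (-1 : ℝ) * E.coeff x k ^ 2
  refine Summable.of_nonneg_of_le
    (fun k => mul_nonneg (Real.rpow_nonneg (E.pos k).le _) (sq_nonneg _)) (fun k => ?_)
    ((E.summable_coeff_sq x).mul_left (E.α 0 ^ (-1 : ℝ)))
  have := Real.rpow_le_rpow_of_nonpos E.α_pos (E.α_mono (Nat.zero_le k)) (by norm_num : (-1 : ℝ) ≤ 0)
  gcongr⟩

end DirichletEigenbasis

/-! ### The semigroup of the linear damped wave equation -/

/-- The restriction to the `k`-th Fourier mode, where `-A` is multiplication by `a = α_k`, of the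
operator `A_μ (u, v) = (v, (A u - v) / μ)`. -/
def modeGen (μ a : ℝ) : (ℝ × ℝ) →L[ℝ] (ℝ × ℝ) :=
  (ContinuousLinearMap.snd ℝ ℝ ℝ).prod
    (μ⁻¹ • (-(a • ContinuousLinearMap.fst ℝ ℝ ℝ) - ContinuousLinearMap.snd ℝ ℝ ℝ))

/-- The exponential `exp (t A_μ)` on a single Fourier mode. -/
def modeFlow (μ a t : ℝ) : (ℝ × ℝ) →L[ℝ] (ℝ × ℝ) := NormedSpace.exp (t • modeGen μ a)

lemma hasDerivAt_modeFlow (μ a t : ℝ) (p : ℝ × ℝ) :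
    HasDerivAt (fun s => modeFlow μ a s p) (modeGen μ a (modeFlow μ a t p)) t := by
  have h := hasDerivAt_exp_smul_const' (𝕂 := ℝ) (modeGen μ a) t
  exact h.clm_apply (hasDerivAt_const t p) |>.congr_deriv (by simp [modeFlow])

/-- Energy bound on a single mode, uniform in the frequency. -/
lemma modeFlow_energy {μ a : ℝ} (hμ : 0 < μ) (ha : 0 < a) (t : ℝ) (p : ℝ × ℝ) :
    (modeFlow μ a t p).1 ^ 2 + μ / a * (modeFlow μ a t p).2 ^ 2 ≤
      Real.exp (2 / μ * |t|) * (p.1 ^ 2 + μ / a * p.2 ^ 2) := by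
  set F : ℝ → ℝ := fun s => (modeFlow μ a s p).1 ^ 2 + μ / a * (modeFlow μ a s p).2 ^ 2 with hF
  have h0 : F 0 = p.1 ^ 2 + μ / a * p.2 ^ 2 := by simp [hF, modeFlow]
  have hFnn : ∀ s, 0 ≤ F s := fun s => by positivity
  have hd : ∀ s, HasDerivAt F (-(2 / a) * (modeFlow μ a s p).2 ^ 2) s := fun s => by
    have h := hasDerivAt_modeFlow μ a s p
    have h1 : HasDerivAt (fun s => (modeFlow μ a s p).1) (modeGen μ a (modeFlow μ a s p)).1 s :=
      (ContinuousLinearMap.fst ℝ ℝ ℝ).hasFDerivAt.comp_hasDerivAt s h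
    have h2 : HasDerivAt (fun s => (modeFlow μ a s p).2) (modeGen μ a (modeFlow μ a s p)).2 s :=
      (ContinuousLinearMap.snd ℝ ℝ ℝ).hasFDerivAt.comp_hasDerivAt s h
    refine ((h1.pow 2).add ((h2.pow 2).const_mul (μ / a))).congr_deriv ?_
    simp [modeGen]
    field_simp
    ring
  rcases le_total 0 t with ht | ht
  · have hanti : Antitone F := antitone_of_hasDerivAt_nonpos hd (fun s => by
      have : 0 ≤ 2 / a * (modeFlow μ a s p).2 ^ 2 := by positivity
      simp only [Pi.zero_apply]
      linarith)
    rw [← h0]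
    calc F t ≤ 1 * F 0 := by rw [one_mul]; exact hanti ht
      _ ≤ _ := mul_le_mul_of_nonneg_right (Real.one_le_exp (by positivity)) (hFnn 0)
  · have hd2 : ∀ s, HasDerivAt (fun s => Real.exp (2 / μ * s) * F s)
        (Real.exp (2 / μ * s) * (2 / μ) * F s +
          Real.exp (2 / μ * s) * (-(2 / a) * (modeFlow μ a s p).2 ^ 2)) s := fun s =>
      (((hasDerivAt_id s).const_mul (2 / μ)).exp.mul (hd s)).congr_deriv (by simp)
    have hmono : Monotone (fun s => Real.exp (2 / μ * s) * F s) :=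
      monotone_of_hasDerivAt_nonneg hd2 (fun s => by
        have : Real.exp (2 / μ * s) * (2 / μ) * F s +
          Real.exp (2 / μ * s) * (-(2 / a) * (modeFlow μ a s p).2 ^ 2) =
          Real.exp (2 / μ * s) * (2 / μ * (modeFlow μ a s p).1 ^ 2) := by
            simp only [hF]
            field_simp
            ring
        simp only [Pi.zero_apply]
        rw [this]
        positivity)
    have h := hmono ht
    simp only [mul_zero, Real.exp_zero, one_mul] at h
    rw [← h0, abs_of_nonpos ht]
    calc F t = Real.exp (2 / μ * -t) * (Real.exp (2 / μ * t) * F t) := by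
          rw [← mul_assoc, ← Real.exp_add]
          simp
      _ ≤ _ := mul_le_mul_of_nonneg_left h (Real.exp_nonneg _)

namespace DirichletEigenbasis

variable (E : DirichletEigenbasis D)

/-- The Fourier coefficients `(u_k, v_k)` of `S_μ(t) (u, v)`. -/
def waveMode (μ t : ℝ) (z : E.Phase) (k : ℕ) : ℝ × ℝ :=
  modeFlow μ (E.α k) t (E.coeff z.1 k, z.2.1 k)

lemma summable_energy {μ : ℝ} (hμ : 0 < μ) (t : ℝ) (z : E.Phase) :
    Summable fun k => (E.waveMode μ t z k).1 ^ 2 + μ / E.α k * (E.waveMode μ t z k).2 ^ 2 := by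
  have hv : Summable fun k => E.α k ^ (-1 : ℝ) * z.2.1 k ^ 2 := z.2.2
  have h := ((E.summable_coeff_sq z.1).add (hv.mul_left μ)).mul_left (Real.exp (2 / μ * |t|))
  refine Summable.of_nonneg_of_le (fun k => ?_) (fun k => ?_) h
  · have := E.pos k
    positivity
  · refine (modeFlow_energy hμ (E.pos k) t _).trans (le_of_eq ?_)
    rw [Real.rpow_neg_one]
    ring

/-- The semigroup `S_μ(t)` on `ℋ = H × H^{-1}` generated by `A_μ (u, v) = (v, (A u - v) / μ)`,
given by its Fourier series: `S_μ(t) (u, v) = ∑ (f_k(t) e_k, g_k(t) e_k)` with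
`f_k' = g_k`, `μ g_k' = -α_k f_k - g_k`, `f_k(0) = u_k`, `g_k(0) = v_k`. -/
def waveSemigroup (μ : ℝ) (hμ : 0 < μ) (t : ℝ) (z : E.Phase) : E.Phase :=
  (E.e.repr.symm ⟨fun k => (E.waveMode μ t z k).1, by
      refine memℓp_gen ?_
      have h : Summable fun k => (E.waveMode μ t z k).1 ^ 2 :=
        Summable.of_nonneg_of_le (fun k => sq_nonneg _) (fun k => by
          have := E.pos k
          have : 0 ≤ μ / E.α k * (E.waveMode μ t z k).2 ^ 2 := by positivity
          linarith) (E.summable_energy hμ t z)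
      simpa using h⟩,
    ⟨fun k => (E.waveMode μ t z k).2, by
      change Summable fun k => E.α k ^ (-1 : ℝ) * (E.waveMode μ t z k).2 ^ 2
      refine Summable.of_nonneg_of_le
        (fun k => mul_nonneg (Real.rpow_nonneg (E.pos k).le _) (sq_nonneg _)) (fun k => ?_)
        ((E.summable_energy hμ t z).mul_left μ⁻¹)
      have : μ⁻¹ * ((E.waveMode μ t z k).1 ^ 2 + μ / E.α k * (E.waveMode μ t z k).2 ^ 2) =
          μ⁻¹ * (E.waveMode μ t z k).1 ^ 2 + (E.α k)⁻¹ * (E.waveMode μ t z k).2 ^ 2 := by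
        field_simp
      rw [this, Real.rpow_neg_one]
      have : 0 ≤ μ⁻¹ * (E.waveMode μ t z k).1 ^ 2 := by positivity
      linarith⟩)

/-! ### The skeleton equation, the action functional and the quasi-potentials -/

/-- `h ↦ μ⁻¹ (0, h)`, so that `B_μ(u, v) = force μ (B u)` and `Q_μ ψ = force μ (Q ψ)`. -/
def force (μ : ℝ) (h : L2 D) : E.Phase := (0, μ⁻¹ • E.incl h)

/-- `z ∈ C([t₁, t₂]; ℋ)` is the mild solution, with initial condition `z t₁`, of the skeleton
equation `dz/dt = A_μ z + B_μ(z) + Q_μ ψ` on `[t₁, t₂]`. -/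
def IsMildSolution (Q : L2 D →L[ℝ] L2 D) (B : L2 D → L2 D) (μ : ℝ) (hμ : 0 < μ) (t₁ t₂ : ℝ)
    (ψ : ℝ → L2 D) (z : ℝ → E.Phase) : Prop :=
  ContinuousOn z (Icc t₁ t₂) ∧ ∀ t ∈ Icc t₁ t₂,
    z t = E.waveSemigroup μ hμ (t - t₁) (z t₁)
      + (∫ s in t₁..t, E.waveSemigroup μ hμ (t - s) (E.force μ (B (z s).1)))
      + ∫ s in t₁..t, E.waveSemigroup μ hμ (t - s) (E.force μ (Q (ψ s)))

/-- The action functional `I^μ_{t₁,t₂}(z) = ½ inf |ψ|²_{L²((t₁,t₂);H)}`, the infimum being over all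
controls `ψ ∈ L²((t₁,t₂);H)` for which `z` is a mild solution of the skeleton equation. -/
def action (Q : L2 D →L[ℝ] L2 D) (B : L2 D → L2 D) (μ : ℝ) (hμ : 0 < μ) (t₁ t₂ : ℝ)
    (z : ℝ → E.Phase) : ℝ≥0∞ :=
  (1 / 2) * ⨅ (ψ : ℝ → L2 D) (_ : MemLp ψ 2 (volume.restrict (Ioo t₁ t₂)))
    (_ : E.IsMildSolution Q B μ hμ t₁ t₂ ψ z), ∫⁻ s in Ioo t₁ t₂, ‖ψ s‖ₑ ^ 2

/-- The quasi-potential `V^μ(x, y) = inf {I^μ_{0,T}(z) : z(0) = 0, z(T) = (x, y), T > 0}`, the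
infimum being over `z ∈ C([0, T]; ℋ)`. -/
def quasiPotential (Q : L2 D →L[ℝ] L2 D) (B : L2 D → L2 D) (μ : ℝ) (hμ : 0 < μ)
    (p : E.Phase) : ℝ≥0∞ :=
  ⨅ (T : ℝ) (_ : 0 < T) (z : ℝ → E.Phase) (_ : ContinuousOn z (Icc 0 T)) (_ : z 0 = 0)
    (_ : z T = p), E.action Q B μ hμ 0 T z

/-- `V_μ(x) = inf_{y ∈ H^{-1}} V^μ(x, y)`. -/
def quasiPotentialFst (Q : L2 D →L[ℝ] L2 D) (B : L2 D → L2 D) (μ : ℝ) (hμ : 0 < μ)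
    (x : L2 D) : ℝ≥0∞ :=
  ⨅ y : E.Hs (-1), E.quasiPotential Q B μ hμ (x, y)

end DirichletEigenbasis

end DampedWave

end

noncomputable section

namespace DampedWave

/-! ### A single Fourier mode -/

/-! In the basis `e_k` the linear damped wave equation splits into damped oscillators `μ u'' + u' +
α_k u = f_k`. With `c = α_1` and `4 μ c ≤ 1`, the Lyapunov functional `μ v² + a u² + 2 c μ u v`
yields the estimate `modeSol_energy`, whose constants depend neither on the mode nor on the length
of the time interval. Weighted by `α_k^δ` and summed, it shows that a forcing in `L²(0,T;H^δ)`
controls the path in `L²(0,T;H^{δ+1} × H^δ)`, and that the solution operator from forcing to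
position has norm at most `1/α_1` on `L²(0,T;H^δ)`. Since the Lipschitz constants of `B` lie below
`α_1`, the nonlinearity is absorbed in every estimate, uniformly in `T`.

Compactness at a fixed time (`isCompact_reach`). A bounded sequence of controls has a weakly
convergent subsequence. Each mode of the convolution `∫ S_μ(t-s) Q_μ ψ(s) ds` is a continuous
functional of `ψ`, and the `k`-th mode is bounded by a multiple of `α_k^{-(1+2β)}`, which is
summable exactly because `β > (d-2)/4`. Weak convergence of controls thus becomes strong convergence
of convolutions, and the contraction property carries it over to solutions of the skeleton equation.

Removing the free time `T` (`exists_reach_subset`). The infimum defining `V^μ` runs over all `T`, so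
a minimising sequence may have `T → ∞`. For a control of norm `ρ`, the forcing lies in
`L²(0,T;H^{2β})` with norm `O(ρ)` uniformly in `T` (`exists_lintegral_sob_forcing_le`), hence so
does the path in `H^{1+2β} × H^{2β}`. On a window of length `N/2` some time `t'` has energy
`O(ρ²/N)` in that norm. Subtracting a correction `w` that starts at `z(t')` and is steered to `0` in
unit time gives a path that starts from `0` at `t'` and has the same endpoint. The norm in `H^{1+2β}
× H^{2β}` is the right one because the new forcing must be inverted through `Q`, which costs `2β`
derivatives. The extra control has norm `O(ρ/√N)`, and resting at `0` is free since `B(0) = 0`.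
Everything reachable with norm `ρ` at any time is therefore reachable at time `N` with norm `ρ +
Cρ/√N`.

Consequently the level set of `V^μ` is a countable intersection of reachable sets at fixed times
with norms decreasing to `√(2r)`, hence compact. The level set of `V_μ` is an intersection of
projections of such sets, and lower semicontinuity is closedness of level sets. -/

lemma modeFlow_zero (μ a : ℝ) : modeFlow μ a 0 = ContinuousLinearMap.id ℝ (ℝ × ℝ) := by
  simp only [modeFlow, zero_smul, NormedSpace.exp_zero]
  rfl

lemma modeFlow_add_apply (μ a s t : ℝ) (p : ℝ × ℝ) :
    modeFlow μ a (s + t) p = modeFlow μ a s (modeFlow μ a t p) := by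
  have h : modeFlow μ a (s + t) = modeFlow μ a s * modeFlow μ a t := by
    rw [modeFlow, add_smul, modeFlow, modeFlow]
    let _ : NormedAlgebra ℚ (ℝ × ℝ →L[ℝ] ℝ × ℝ) := NormedAlgebra.restrictScalars ℚ ℝ _
    exact NormedSpace.exp_add_of_commute
      (((Commute.refl (modeGen μ a)).smul_left s).smul_right t)
  rw [h]
  rfl

lemma hasDerivAt_modeFlow_clm (μ a t : ℝ) :
    HasDerivAt (modeFlow μ a) (modeGen μ a * modeFlow μ a t) t :=
  hasDerivAt_exp_smul_const' (𝕂 := ℝ) (modeGen μ a) t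

lemma continuous_modeFlow (μ a : ℝ) : Continuous (modeFlow μ a) :=
  continuous_iff_continuousAt.2 fun t => (hasDerivAt_modeFlow_clm μ a t).continuousAt

/-- The forcing term of the mode equation. -/
def modeForce (μ : ℝ) : ℝ →L[ℝ] ℝ × ℝ :=
  ContinuousLinearMap.inr ℝ ℝ ℝ ∘L (μ⁻¹ • ContinuousLinearMap.id ℝ ℝ)

lemma modeForce_apply (μ x : ℝ) : modeForce μ x = (0, μ⁻¹ * x) := by
  simp [modeForce]

/-- `y` is a mild solution on `[t₀, t₁]` of `y' = M y + (0, f / μ)`, with `M` the generator of the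
mode flow. -/
def IsDuhamel (μ a t₀ t₁ : ℝ) (f : ℝ → ℝ) (y : ℝ → ℝ × ℝ) : Prop :=
  ∀ t ∈ Icc t₀ t₁, y t = modeFlow μ a (t - t₀) (y t₀) +
    ∫ s in t₀..t, modeFlow μ a (t - s) (modeForce μ (f s))

lemma intervalIntegrable_modeFlow {μ a t₀ t₁ : ℝ} {f : ℝ → ℝ}
    (hf : IntervalIntegrable f volume t₀ t₁) (t : ℝ) :
    IntervalIntegrable (fun s => modeFlow μ a (t - s) (modeForce μ (f s))) volume t₀ t₁ := by
  have h1 : IntervalIntegrable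
      (fun s => f s • modeFlow μ a (t - s) (modeForce μ 1)) volume t₀ t₁ := by
    refine IntervalIntegrable.smul_continuousOn hf (Continuous.continuousOn ?_)
    exact ((continuous_modeFlow μ a).comp (by fun_prop)).clm_apply continuous_const
  refine h1.congr fun s _ => ?_
  simp only [← map_smul]
  simp

/-- The group property factors the variable `t` out of the integrand, leaving a fixed flow times an
ordinary indefinite integral. Differentiability and absolute continuity in `t` are read off from
this form. -/
lemma integral_modeFlow_eq {μ a t₀ t₁ : ℝ} {f : ℝ → ℝ}
    (hf : IntervalIntegrable f volume t₀ t₁) (t : ℝ) :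
    ∫ s in t₀..t₁, modeFlow μ a (t - s) (modeForce μ (f s)) =
      modeFlow μ a t (∫ s in t₀..t₁, modeFlow μ a (0 - s) (modeForce μ (f s))) := by
  rw [← ContinuousLinearMap.intervalIntegral_comp_comm _ (intervalIntegrable_modeFlow hf 0)]
  congr 1
  ext s : 1
  rw [← modeFlow_add_apply]
  congr 2
  ring

lemma IsDuhamel.restart {μ a t₀ t₁ t' : ℝ} {f : ℝ → ℝ} {y : ℝ → ℝ × ℝ}
    (h : IsDuhamel μ a t₀ t₁ f y) (hf : IntervalIntegrable f volume t₀ t₁) (ht : t' ∈ Icc t₀ t₁) :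
    IsDuhamel μ a t' t₁ f y := by
  intro t htt
  have ht1 : t ∈ Icc t₀ t₁ := ⟨ht.1.trans htt.1, htt.2⟩
  have hf1 : IntervalIntegrable f volume t₀ t' := hf.mono_set (by
    rw [uIcc_of_le ht.1, uIcc_of_le (ht.1.trans ht.2)]; exact Icc_subset_Icc_right ht.2)
  have hf2 : IntervalIntegrable f volume t' t := hf.mono_set (by
    rw [uIcc_of_le htt.1, uIcc_of_le (ht.1.trans ht.2)]; exact Icc_subset_Icc ht.1 htt.2)
  rw [h t ht1, h t' ht, ← intervalIntegral.integral_add_adjacent_intervals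
    (intervalIntegrable_modeFlow hf1 t) (intervalIntegrable_modeFlow hf2 t), map_add,
    ← modeFlow_add_apply, integral_modeFlow_eq hf1 t, integral_modeFlow_eq hf1 t',
    ← modeFlow_add_apply, sub_add_sub_cancel, sub_add_cancel, add_assoc]

lemma IsDuhamel.extend_zero {μ a t₀ t₁ t' : ℝ} {f : ℝ → ℝ} {y : ℝ → ℝ × ℝ}
    (h : IsDuhamel μ a t' t₁ f y) (hf : IntervalIntegrable f volume t' t₁) (ht : t₀ ≤ t')
    (hft : ∀ s < t', f s = 0) (hyt : ∀ s ≤ t', y s = 0) :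
    IsDuhamel μ a t₀ t₁ f y := by
  intro t htt
  rw [hyt t₀ ht, map_zero, zero_add]
  rcases le_total t t' with h1 | h1
  · rw [hyt t h1, eq_comm]
    refine intervalIntegral.integral_zero_ae ?_
    -- The forcing is assumed to vanish only strictly before `t'`; the single time `t'` is discarded
    -- as a null set.
    filter_upwards [Measure.ae_ne volume t'] with s hs hs2
    rw [uIoc_of_le htt.1] at hs2
    rw [hft s (lt_of_le_of_ne (hs2.2.trans h1) hs), map_zero, map_zero]
  · have hz : ∀ᵐ s, s ∈ uIoc t₀ t' → modeFlow μ a (t - s) (modeForce μ (f s)) = 0 := by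
      filter_upwards [Measure.ae_ne volume t'] with s hs hs2
      rw [uIoc_of_le ht] at hs2
      rw [hft s (lt_of_le_of_ne hs2.2 hs), map_zero, map_zero]
    have hf2 : IntervalIntegrable f volume t' t := hf.mono_set (by
      rw [uIcc_of_le h1, uIcc_of_le (h1.trans htt.2)]; exact Icc_subset_Icc le_rfl htt.2)
    have hi : IntervalIntegrable (fun s => modeFlow μ a (t - s) (modeForce μ (f s)))
        volume t₀ t' := by
      refine (intervalIntegrable_const (c := (0 : ℝ × ℝ))).congr_ae ?_
      rw [EventuallyEq, ae_restrict_iff' measurableSet_uIoc]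
      filter_upwards [hz] with s hs hs2
      exact (hs hs2).symm
    rw [← intervalIntegral.integral_add_adjacent_intervals hi (intervalIntegrable_modeFlow hf2 t),
      intervalIntegral.integral_zero_ae hz, zero_add, h t ⟨h1, htt.2⟩, hyt t' le_rfl, map_zero,
      zero_add]

lemma IsDuhamel.comp_add {μ a t₀ t₁ : ℝ} {f : ℝ → ℝ} {y : ℝ → ℝ × ℝ}
    (h : IsDuhamel μ a t₀ t₁ f y) (τ : ℝ) :
    IsDuhamel μ a (t₀ - τ) (t₁ - τ) (fun t => f (t + τ)) (fun t => y (t + τ)) := by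
  intro t ht
  have h1 := h (t + τ) ⟨by linarith [ht.1], by linarith [ht.2]⟩
  simp only [sub_add_cancel]
  rw [h1]
  congr 1
  · congr 2; ring
  · rw [← sub_add_cancel t₀ τ, ← intervalIntegral.integral_comp_add_right, sub_add_cancel]
    congr 1
    ext s : 1
    congr 2; ring

lemma IsDuhamel.sub {μ a t₀ t₁ : ℝ} {f g : ℝ → ℝ} {y w : ℝ → ℝ × ℝ}
    (hy : IsDuhamel μ a t₀ t₁ f y) (hw : IsDuhamel μ a t₀ t₁ g w)
    (hf : IntervalIntegrable f volume t₀ t₁) (hg : IntervalIntegrable g volume t₀ t₁) :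
    IsDuhamel μ a t₀ t₁ (fun t => f t - g t) (fun t => y t - w t) := by
  intro t ht
  have hs : uIcc t₀ t ⊆ uIcc t₀ t₁ := by
    rw [uIcc_of_le ht.1, uIcc_of_le (ht.1.trans ht.2)]; exact Icc_subset_Icc_right ht.2
  simp only [map_sub]
  rw [hy t ht, hw t ht, intervalIntegral.integral_sub
    (intervalIntegrable_modeFlow (hf.mono_set hs) t)
    (intervalIntegrable_modeFlow (hg.mono_set hs) t)]
  abel

lemma isDuhamel_of_hasDerivAt {μ a t₀ t₁ : ℝ} {g : ℝ → ℝ} {y : ℝ → ℝ × ℝ} (hg : Continuous g)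
    (hy : ∀ t, HasDerivAt y (modeGen μ a (y t) + modeForce μ (g t)) t) :
    IsDuhamel μ a t₀ t₁ g y := by
  intro t _
  -- Variation of constants: in the derivative of `s ↦ modeFlow μ a (t - s) (y s)` the generator
  -- terms cancel and only the forcing is left.
  have hd : ∀ s, HasDerivAt (fun s => modeFlow μ a (t - s) (y s))
      (modeFlow μ a (t - s) (modeForce μ (g s))) s := by
    intro s
    have h1 : HasDerivAt (fun s => modeFlow μ a (t - s))
        (-(modeFlow μ a (t - s) * modeGen μ a)) s := by
      have := (hasDerivAt_exp_smul_const (𝕂 := ℝ) (modeGen μ a) (t - s)).scomp s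
        ((hasDerivAt_id s).const_sub t)
      simpa using! this
    refine (h1.clm_apply (hy s)).congr_deriv ?_
    simp
  have hc : Continuous fun s => modeFlow μ a (t - s) (modeForce μ (g s)) :=
    ((continuous_modeFlow μ a).comp (by fun_prop)).clm_apply
      ((modeForce μ).continuous.comp hg)
  have := intervalIntegral.integral_eq_sub_of_hasDerivAt (fun s _ => hd s)
    (hc.intervalIntegrable t₀ t)
  rw [this, sub_self, modeFlow_zero]
  simp

/-- The mild solution, with zero initial condition at time `0`, of a single mode. -/
def modeSol (μ a : ℝ) (f : ℝ → ℝ) (t : ℝ) : ℝ × ℝ :=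
  ∫ s in (0 : ℝ)..t, modeFlow μ a (t - s) (modeForce μ (f s))

lemma absolutelyContinuousOnInterval_modeFlow (μ a t₀ t₁ : ℝ) (ℓ : ℝ × ℝ →L[ℝ] ℝ) (p : ℝ × ℝ) :
    AbsolutelyContinuousOnInterval (fun t => ℓ (modeFlow μ a t p)) t₀ t₁ := by
  have hd : ∀ t, HasDerivAt (fun t => ℓ (modeFlow μ a t p))
      (ℓ (modeGen μ a (modeFlow μ a t p))) t := fun t =>
    ℓ.hasFDerivAt.comp_hasDerivAt t (hasDerivAt_modeFlow μ a t p)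
  refine ContDiffOn.absolutelyContinuousOnInterval (ContDiff.contDiffOn ?_)
  refine contDiff_one_iff_deriv.2 ⟨fun t => (hd t).differentiableAt, ?_⟩
  rw [funext fun t => (hd t).deriv]
  exact (ℓ.comp (modeGen μ a)).continuous.comp
    ((continuous_modeFlow μ a).clm_apply continuous_const)

lemma modeSol_eq {μ a T : ℝ} {f : ℝ → ℝ} (hf : IntervalIntegrable f volume 0 T) (t : ℝ)
    (ht : t ∈ uIcc 0 T) : modeSol μ a f t =
      modeFlow μ a t (∫ s in (0 : ℝ)..t, modeFlow μ a (0 - s) (modeForce μ (f s))) :=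
  integral_modeFlow_eq (hf.mono_set (uIcc_subset_uIcc_left ht)) t

/-- The forcing is merely integrable, so the energy is not `C¹`; absolute continuity is what allows
its almost everywhere derivative to be integrated back. It holds because the solution combines
products of an indefinite integral and a smooth flow. -/
lemma absolutelyContinuousOnInterval_modeSol {μ a T : ℝ} {f : ℝ → ℝ}
    (hf : IntervalIntegrable f volume 0 T) (ℓ : ℝ × ℝ →L[ℝ] ℝ) :
    AbsolutelyContinuousOnInterval (fun t => ℓ (modeSol μ a f t)) 0 T := by
  set F : ℝ → ℝ × ℝ := fun s => modeFlow μ a (0 - s) (modeForce μ (f s)) with hF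
  have hFi : IntervalIntegrable F volume 0 T := intervalIntegrable_modeFlow hf 0
  have hF1 : IntervalIntegrable (fun s => (F s).1) volume 0 T :=
    ⟨hFi.1.fst, hFi.2.fst⟩
  have hF2 : IntervalIntegrable (fun s => (F s).2) volume 0 T :=
    ⟨hFi.1.snd, hFi.2.snd⟩
  have h1 := (hF1.absolutelyContinuousOnInterval_intervalIntegral (c := 0) (by simp)).fun_mul
    (absolutelyContinuousOnInterval_modeFlow μ a 0 T ℓ (1, 0))
  have h2 := (hF2.absolutelyContinuousOnInterval_intervalIntegral (c := 0) (by simp)).fun_mul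
    (absolutelyContinuousOnInterval_modeFlow μ a 0 T ℓ (0, 1))
  have h3 := h1.fun_add h2
  have key : EqOn (fun t => ℓ (modeSol μ a f t)) (fun t => (∫ v in (0 : ℝ)..t, (F v).1) *
      ℓ (modeFlow μ a t (1, 0)) + (∫ v in (0 : ℝ)..t, (F v).2) * ℓ (modeFlow μ a t (0, 1)))
      (uIcc 0 T) := by
    intro t ht
    have hFt : IntervalIntegrable F volume 0 t := hFi.mono_set (uIcc_subset_uIcc_left ht)
    simp only
    rw [modeSol_eq hf t ht]
    have e1 := (ContinuousLinearMap.fst ℝ ℝ ℝ).intervalIntegral_comp_comm hFt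
    have e2 := (ContinuousLinearMap.snd ℝ ℝ ℝ).intervalIntegral_comp_comm hFt
    simp only [ContinuousLinearMap.coe_fst', ContinuousLinearMap.coe_snd'] at e1 e2
    rw [e1, e2]
    set q := ∫ s in (0 : ℝ)..t, F s
    have hq : q = q.1 • ((1 : ℝ), (0 : ℝ)) + q.2 • ((0 : ℝ), (1 : ℝ)) := by ext <;> simp
    conv_lhs => rw [hq]
    simp only [map_add, map_smul, smul_eq_mul]
  rw [absolutelyContinuousOnInterval_iff] at h3 ⊢
  intro ε hε
  obtain ⟨δ, hδ, h⟩ := h3 ε hε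
  refine ⟨δ, hδ, fun I hI hl => ?_⟩
  refine lt_of_eq_of_lt (Finset.sum_congr rfl fun i hi => ?_) (h I hI hl)
  have := hI.1 i (by simpa using hi)
  exact congrArg₂ dist (key this.1) (key this.2)

/-- Lebesgue differentiation of the indefinite integral, followed by the product rule. The endpoints
are excluded because the factorisation of `modeSol` is available only inside the interval. -/
lemma ae_hasDerivAt_modeSol {μ a T : ℝ} {f : ℝ → ℝ} (hf : IntervalIntegrable f volume 0 T) :
    ∀ᵐ t, t ∈ uIcc 0 T → t ≠ 0 → t ≠ T → HasDerivAt (modeSol μ a f)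
      (modeGen μ a (modeSol μ a f t) + modeForce μ (f t)) t := by
  have hFi := intervalIntegrable_modeFlow (μ := μ) (a := a) hf 0
  filter_upwards [hFi.ae_hasDerivAt_integral] with t ht htT h0 hT
  have h1 := (hasDerivAt_modeFlow_clm μ a t).clm_apply (ht htT 0 (by simp))
  refine (h1.congr_deriv ?_).congr_of_eventuallyEq ?_
  · rw [modeSol_eq hf t htT, ← modeFlow_add_apply]
    simp [modeFlow_zero]
  · have : uIcc 0 T ∈ 𝓝 t := by
      rw [uIcc, Icc_mem_nhds_iff]
      rw [uIcc, mem_Icc] at htT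
      constructor
      · refine lt_of_le_of_ne htT.1 ?_
        rcases min_choice 0 T with h | h <;> rw [h] <;> exact Ne.symm ‹_›
      · refine lt_of_le_of_ne htT.2 ?_
        rcases max_choice 0 T with h | h <;> rw [h] <;> assumption
    filter_upwards [this] with s hs
    exact modeSol_eq hf s hs

/-- The energy estimate for a single mode; the constants do not depend on the frequency `a ≥ c`
nor on the time `T`. -/
theorem modeSol_energy {μ a c T : ℝ} {f : ℝ → ℝ} (hμ : 0 < μ) (hc : 0 < c) (hca : c ≤ a)
    (hμc : 4 * μ * c ≤ 1) (hT : 0 ≤ T) (hf : IntervalIntegrable f volume 0 T)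
    (hf2 : IntervalIntegrable (fun t => f t ^ 2) volume 0 T) :
    c * a * (∫ s in (0 : ℝ)..T, (modeSol μ a f s).1 ^ 2) +
        1 / 2 * (∫ s in (0 : ℝ)..T, (modeSol μ a f s).2 ^ 2) +
        1 / 2 * (μ * (modeSol μ a f T).2 ^ 2 + a * (modeSol μ a f T).1 ^ 2) ≤
      ∫ s in (0 : ℝ)..T, f s ^ 2 := by
  have hu := absolutelyContinuousOnInterval_modeSol (μ := μ) (a := a) hf
    (ContinuousLinearMap.fst ℝ ℝ ℝ)
  have hv := absolutelyContinuousOnInterval_modeSol (μ := μ) (a := a) hf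
    (ContinuousLinearMap.snd ℝ ℝ ℝ)
  simp only [ContinuousLinearMap.coe_fst', ContinuousLinearMap.coe_snd'] at hu hv
  set y := modeSol μ a f with hy
  -- The physical energy `μ v² + a u²` dissipates only through `v`. The cross term `2 c μ u v` makes
  -- the dissipation control `u` as well.
  have hE : AbsolutelyContinuousOnInterval (fun t => μ * ((y t).2 * (y t).2) +
      a * ((y t).1 * (y t).1) + 2 * c * μ * ((y t).1 * (y t).2)) 0 T :=
    (((hv.fun_mul hv).const_mul μ).fun_add ((hu.fun_mul hu).const_mul a)).fun_add
      ((hu.fun_mul hv).const_mul (2 * c * μ))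
  have hi := hE.intervalIntegrable_deriv
  have hftc := hE.integral_deriv_eq_sub
  have hy0 : y 0 = 0 := by simp [hy, modeSol]
  have hu2 : IntervalIntegrable (fun t => (y t).1 ^ 2) volume 0 T :=
    (hu.continuousOn.pow 2).intervalIntegrable
  have hv2 : IntervalIntegrable (fun t => (y t).2 ^ 2) volume 0 T :=
    (hv.continuousOn.pow 2).intervalIntegrable
  have hmain : ∫ s in (0 : ℝ)..T, (c * a * (y s).1 ^ 2 + 1 / 2 * (y s).2 ^ 2 +
      deriv (fun t => μ * ((y t).2 * (y t).2) +
      a * ((y t).1 * (y t).1) + 2 * c * μ * ((y t).1 * (y t).2)) s) ≤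
      ∫ s in (0 : ℝ)..T, f s ^ 2 := by
    refine intervalIntegral.integral_mono_ae_restrict hT
      (((hu2.const_mul _).add (hv2.const_mul _)).add hi) hf2 ?_
    rw [EventuallyLE, ae_restrict_iff' measurableSet_Icc]
    filter_upwards [ae_hasDerivAt_modeSol (μ := μ) (a := a) hf, Measure.ae_ne volume 0,
      Measure.ae_ne volume T] with t h h0 hTt ht
    rw [← uIcc_of_le hT] at ht
    have hd := h ht h0 hTt
    rw [← hy] at hd
    have h1 : HasDerivAt (fun s => (y s).1) (y t).2 t :=
      ((ContinuousLinearMap.fst ℝ ℝ ℝ).hasFDerivAt.comp_hasDerivAt t hd).congr_deriv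
        (by simp [modeGen, modeForce])
    have h2 : HasDerivAt (fun s => (y s).2) (μ⁻¹ * (f t - a * (y t).1 - (y t).2)) t :=
      ((ContinuousLinearMap.snd ℝ ℝ ℝ).hasFDerivAt.comp_hasDerivAt t hd).congr_deriv
        (by simp [modeGen, modeForce]; ring)
    have h3 := ((((h2.fun_mul h2).const_mul μ).fun_add ((h1.fun_mul h1).const_mul a)).fun_add
      ((h1.fun_mul h2).const_mul (2 * c * μ))).deriv
    rw [h3]
    set w := μ⁻¹ * (f t - a * (y t).1 - (y t).2) with hw
    have hfw : f t = μ * w + a * (y t).1 + (y t).2 := by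
      rw [hw]; field_simp; ring
    rw [hfw]
    set u := (y t).1
    set v := (y t).2
    -- With `w = v'`, completing the square shows that `f²` exceeds the dissipation plus the
    -- derivative of the functional by three nonnegative terms. This uses `c ≤ a` for the second and
    -- `4 μ c ≤ 1` for the third.
    have e : (μ * w + a * u + v) ^ 2 - (c * a * u ^ 2 + 1 / 2 * v ^ 2 +
        (μ * (w * v + v * w) + a * (v * u + u * v) + 2 * c * μ * (v * v + u * w))) =
        (μ * w + (a - c) * u) ^ 2 + c * (a - c) * u ^ 2 + (1 / 2 - 2 * c * μ) * v ^ 2 := by ring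
    have p1 : 0 ≤ c * (a - c) * u ^ 2 :=
      mul_nonneg (mul_nonneg hc.le (by linarith)) (sq_nonneg _)
    have p2 : 0 ≤ (1 / 2 - 2 * c * μ) * v ^ 2 :=
      mul_nonneg (by linarith) (sq_nonneg _)
    nlinarith [sq_nonneg (μ * w + (a - c) * u)]
  rw [intervalIntegral.integral_add ((hu2.const_mul _).add (hv2.const_mul _)) hi,
    intervalIntegral.integral_add (hu2.const_mul _) (hv2.const_mul _), hftc, hy0,
    intervalIntegral.integral_const_mul, intervalIntegral.integral_const_mul] at hmain
  simp only [Prod.fst_zero, Prod.snd_zero, mul_zero, add_zero, sub_zero] at hmain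
  set u := (y T).1
  set v := (y T).2
  -- At the final time the cross term costs at most half of the energy, since `4 c² μ ≤ c ≤ a`.
  have hcross : 0 ≤ 1 / 2 * (μ * v ^ 2 + a * u ^ 2) + 2 * c * μ * (u * v) := by
    have h1 : 4 * c ^ 2 * μ ≤ a := by nlinarith
    have h2 : 0 ≤ (a - 4 * c ^ 2 * μ) * u ^ 2 := mul_nonneg (by linarith) (sq_nonneg _)
    have h3 : 0 ≤ μ * (v + 2 * c * u) ^ 2 := by positivity
    nlinarith
  nlinarith

/-! ### Square summable sequences -/

lemma summable_sq_lp (x : lp (fun _ : ℕ => ℝ) 2) : Summable fun k => x k ^ 2 := by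
  have h := (memℓp_gen_iff (p := 2) (by simp)).1 (lp.memℓp x)
  simpa using h

lemma norm_sq_lp (x : lp (fun _ : ℕ => ℝ) 2) : ‖x‖ ^ 2 = ∑' k, x k ^ 2 := by
  have h := lp.norm_rpow_eq_tsum (p := 2) (by simp) x
  simpa using h

/-- Dominated coordinatewise convergence implies convergence in `ℓ²`. -/
lemma tendsto_lp_of_dominated {ι : Type*} {l : Filter ι} {F : ι → lp (fun _ : ℕ => ℝ) 2}
    {y : lp (fun _ : ℕ => ℝ) 2} {b : ℕ → ℝ} (hb : Summable b)
    (hF : ∀ᶠ i in l, ∀ k, F i k ^ 2 ≤ b k) (h : ∀ k, Tendsto (fun i => F i k) l (𝓝 (y k))) :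
    Tendsto F l (𝓝 y) := by
  have h1 : Tendsto (fun i => ∑' k, (F i k - y k) ^ 2) l (𝓝 (∑' _ : ℕ, (0 : ℝ))) := by
    refine tendsto_tsum_of_dominated_convergence
      (bound := fun k => 2 * b k + 2 * y k ^ 2)
      ((hb.mul_left 2).add ((summable_sq_lp y).mul_left 2)) (fun k => ?_) ?_
    · have := ((h k).sub_const (y k)).pow 2
      simpa using this
    · filter_upwards [hF] with i hi k
      rw [Real.norm_of_nonneg (sq_nonneg _)]
      nlinarith [hi k, sq_nonneg (F i k + y k)]
  rw [tsum_zero] at h1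
  rw [tendsto_iff_norm_sub_tendsto_zero]
  have h2 := h1.sqrt
  rw [Real.sqrt_zero] at h2
  refine h2.congr fun i => ?_
  have : ‖F i - y‖ ^ 2 = ∑' k, (F i k - y k) ^ 2 := by
    rw [norm_sq_lp]
    rfl
  rw [← this, Real.sqrt_sq (norm_nonneg _)]

/-- Every element of `ℓ²` is the limit of its finite truncations, so measurability can be checked
coordinatewise. -/
lemma aestronglyMeasurable_lp {X : Type*} [MeasurableSpace X] {ν : Measure X}
    {F : X → lp (fun _ : ℕ => ℝ) 2} (h : ∀ k, AEStronglyMeasurable (fun t => F t k) ν) :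
    AEStronglyMeasurable F ν := by
  refine aestronglyMeasurable_of_tendsto_ae (f := fun (n : ℕ) t =>
    ∑ k ∈ Finset.range n, lp.single 2 k (F t k)) atTop (fun n => ?_) ?_
  · refine Finset.aestronglyMeasurable_fun_sum _ fun k _ => ?_
    have he : ∀ t, lp.single (E := fun _ : ℕ => ℝ) 2 k (F t k) = F t k • lp.single 2 k (1 : ℝ) :=
      fun t => by rw [← lp.single_smul]; simp
    simp only [he]
    exact (h k).smul_const _
  · exact Eventually.of_forall fun t => (lp.hasSum_single (by simp) (F t)).tendsto_sum_nat

namespace DirichletEigenbasis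

variable {d : ℕ} {D : Set (EuclideanSpace ℝ (Fin d))} (E : DirichletEigenbasis D)

/-! ### Coordinates in the phase space -/

/-- The `k`-th Fourier coefficient as a continuous linear functional. -/
def coeffL (k : ℕ) : L2 D →L[ℝ] ℝ :=
  (lp.evalCLM ℝ (fun _ : ℕ => ℝ) 2 k).comp
    (E.e.repr.toContinuousLinearEquiv : L2 D →L[ℝ] lp (fun _ : ℕ => ℝ) 2)

lemma coeffL_apply (k : ℕ) (x : L2 D) : E.coeffL k x = E.coeff x k := rfl

lemma norm_sq_eq_tsum_coeff (x : L2 D) : ‖x‖ ^ 2 = ∑' k, E.coeff x k ^ 2 := by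
  rw [← E.e.repr.norm_map, norm_sq_lp]
  rfl

lemma ext_coeff {x y : L2 D} (h : ∀ k, E.coeff x k = E.coeff y k) : x = y :=
  E.e.repr.injective (lp.ext (funext h))

@[simp] lemma coeff_zero (k : ℕ) : E.coeff 0 k = 0 := map_zero (E.coeffL k)

lemma coeff_add (x y : L2 D) (k : ℕ) : E.coeff (x + y) k = E.coeff x k + E.coeff y k :=
  map_add (E.coeffL k) x y

lemma coeff_sub (x y : L2 D) (k : ℕ) : E.coeff (x - y) k = E.coeff x k - E.coeff y k :=
  map_sub (E.coeffL k) x y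

lemma coeff_smul (c : ℝ) (x : L2 D) (k : ℕ) : E.coeff (c • x) k = c * E.coeff x k :=
  map_smul (E.coeffL k) c x

lemma coeff_diagonal {Q : L2 D →L[ℝ] L2 D} {lam : ℕ → ℝ} (hQ : ∀ k, Q (E.e k) = lam k • E.e k)
    (x : L2 D) (k : ℕ) : E.coeff (Q x) k = lam k * E.coeff x k := by
  have h := ((E.e.hasSum_repr x).mapL Q).mapL (E.coeffL k)
  have h2 : ∀ j, E.coeffL k (Q (E.e.repr x j • E.e j)) = if j = k then lam k * E.coeff x k else 0 := by
    intro j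
    rw [map_smul, hQ, map_smul, map_smul, coeffL_apply, coeff, E.e.repr_self]
    split_ifs with hjk
    · subst hjk
      rw [lp.single_apply_self]
      simp [coeff, mul_comm]
    · rw [lp.single_apply_ne _ _ _ (Ne.symm hjk)]
      simp
  simp only [h2] at h
  exact h.unique (hasSum_ite_eq k _)

/-- The element of `L²(D)` with given square summable Fourier coefficients. -/
def ofCoeff (x : ℕ → ℝ) (hx : Summable fun k => x k ^ 2) : L2 D :=
  E.e.repr.symm ⟨x, memℓp_gen (by simpa using hx)⟩

lemma coeff_ofCoeff (x : ℕ → ℝ) (hx : Summable fun k => x k ^ 2) (k : ℕ) :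
    E.coeff (E.ofCoeff x hx) k = x k := by
  simp [coeff, ofCoeff]

lemma tendsto_L2_of_dominated {ι : Type*} {l : Filter ι} {F : ι → L2 D} {y : L2 D} {b : ℕ → ℝ}
    (hb : Summable b) (hF : ∀ᶠ i in l, ∀ k, E.coeff (F i) k ^ 2 ≤ b k)
    (h : ∀ k, Tendsto (fun i => E.coeff (F i) k) l (𝓝 (E.coeff y k))) :
    Tendsto F l (𝓝 y) := by
  have := (E.e.repr.symm.continuous.tendsto _).comp
    (tendsto_lp_of_dominated (F := fun i => E.e.repr (F i)) (y := E.e.repr y) hb hF h)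
  simpa [Function.comp_def] using this

lemma aestronglyMeasurable_L2 {X : Type*} [MeasurableSpace X] {ν : Measure X} {F : X → L2 D}
    (h : ∀ k, AEStronglyMeasurable (fun t => E.coeff (F t) k) ν) : AEStronglyMeasurable F ν := by
  have := E.e.repr.symm.continuous.comp_aestronglyMeasurable
    (aestronglyMeasurable_lp (F := fun t => E.e.repr (F t)) h)
  simpa using this

/-- The isometry of `H^δ` onto `ℓ²`. -/
def hsIsometry (δ : ℝ) : E.Hs δ ≃ₗᵢ[ℝ] lp (fun _ : ℕ => ℝ) 2 := ⟨E.toEll2 δ, E.norm_toEll2 δ⟩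

lemma hsIsometry_apply (δ : ℝ) (x : E.Hs δ) (k : ℕ) :
    E.hsIsometry δ x k = E.α k ^ (δ / 2) * x.1 k := rfl

/-- The `k`-th coordinate on `H^{-1}`. -/
def hsCoeff (k : ℕ) : E.Hs (-1) →L[ℝ] ℝ :=
  E.α k ^ (-((-1 : ℝ) / 2)) • ((lp.evalCLM ℝ (fun _ : ℕ => ℝ) 2 k).comp
    ((E.hsIsometry (-1)).toContinuousLinearEquiv : E.Hs (-1) →L[ℝ] lp (fun _ : ℕ => ℝ) 2))

lemma hsCoeff_apply (k : ℕ) (x : E.Hs (-1)) : E.hsCoeff k x = x.1 k := by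
  change E.α k ^ (-((-1 : ℝ) / 2)) * (E.α k ^ ((-1 : ℝ) / 2) * x.1 k) = x.1 k
  rw [← mul_assoc, ← Real.rpow_add (E.pos k)]
  simp

lemma hsIsometry_sq (x : E.Hs (-1)) (k : ℕ) :
    E.hsIsometry (-1) x k ^ 2 = (E.α k)⁻¹ * x.1 k ^ 2 := by
  rw [hsIsometry_apply, rpow_half_mul_sq, Real.rpow_neg_one]

lemma summable_hs_sq (x : E.Hs (-1)) : Summable fun k => (E.α k)⁻¹ * x.1 k ^ 2 := by
  simp only [← hsIsometry_sq]
  exact summable_sq_lp _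

lemma norm_sq_hs (x : E.Hs (-1)) : ‖x‖ ^ 2 = ∑' k, (E.α k)⁻¹ * x.1 k ^ 2 := by
  rw [← (E.hsIsometry (-1)).norm_map, norm_sq_lp]
  simp only [hsIsometry_sq]

/-- The `k`-th mode of a point of the phase space. -/
def mode (k : ℕ) : E.Phase →L[ℝ] ℝ × ℝ := (E.coeffL k).prodMap (E.hsCoeff k)

lemma mode_apply (k : ℕ) (p : E.Phase) : E.mode k p = (E.coeff p.1 k, p.2.1 k) :=
  Prod.ext (E.coeffL_apply k p.1) (E.hsCoeff_apply k p.2)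

lemma ext_mode {p q : E.Phase} (h : ∀ k, E.mode k p = E.mode k q) : p = q := by
  simp only [mode_apply, Prod.mk.injEq] at h
  exact Prod.ext (E.ext_coeff fun k => (h k).1) (Subtype.ext (funext fun k => (h k).2))

/-- Dominated modewise convergence implies convergence in the phase space. -/
lemma tendsto_phase_of_dominated {ι : Type*} {l : Filter ι} {F : ι → E.Phase} {y : E.Phase}
    {b : ℕ → ℝ} (hb : Summable b)
    (hF : ∀ᶠ i in l, ∀ k, (E.mode k (F i)).1 ^ 2 ≤ b k ∧
      (E.α k)⁻¹ * (E.mode k (F i)).2 ^ 2 ≤ b k)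
    (h : ∀ k, Tendsto (fun i => E.mode k (F i)) l (𝓝 (E.mode k y))) :
    Tendsto F l (𝓝 y) := by
  rw [Prod.tendsto_iff]
  constructor
  · refine E.tendsto_L2_of_dominated hb ?_ fun k => ?_
    · filter_upwards [hF] with i hi k
      simpa [mode_apply] using (hi k).1
    · simpa [mode_apply, Function.comp_def] using (continuous_fst.tendsto _).comp (h k)
  · have := ((E.hsIsometry (-1)).symm.continuous.tendsto _).comp
      (tendsto_lp_of_dominated (F := fun i => E.hsIsometry (-1) (F i).2)
        (y := E.hsIsometry (-1) y.2) (l := l) hb ?_ fun k => ?_)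
    · simpa [Function.comp_def] using this
    · filter_upwards [hF] with i hi k
      rw [hsIsometry_sq]
      simpa [mode_apply] using (hi k).2
    · have := (continuous_snd.tendsto _).comp (h k)
      simp only [Function.comp_def, mode_apply] at this
      simpa only [hsIsometry_apply] using this.const_mul (E.α k ^ ((-1 : ℝ) / 2))

lemma aestronglyMeasurable_phase {X : Type*} [MeasurableSpace X] {ν : Measure X} {F : X → E.Phase}
    (h : ∀ k, AEStronglyMeasurable (fun t => E.mode k (F t)) ν) : AEStronglyMeasurable F ν := by
  have h1 : AEStronglyMeasurable (fun t => (F t).1) ν := E.aestronglyMeasurable_L2 fun k => by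
    simpa [mode_apply] using (h k).fst
  have h2 : AEStronglyMeasurable (fun t => (F t).2) ν := by
    have := (E.hsIsometry (-1)).symm.continuous.comp_aestronglyMeasurable
      (aestronglyMeasurable_lp (F := fun t => E.hsIsometry (-1) (F t).2) (ν := ν) fun k => ?_)
    · simpa using this
    · simp only [hsIsometry_apply]
      refine AEStronglyMeasurable.const_mul ?_ _
      simpa [mode_apply] using (h k).snd
  exact h1.prodMk h2

/-! ### The wave semigroup and its convolution -/

lemma mode_waveSemigroup {μ : ℝ} (hμ : 0 < μ) (t : ℝ) (z : E.Phase) (k : ℕ) :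
    E.mode k (E.waveSemigroup μ hμ t z) = modeFlow μ (E.α k) t (E.mode k z) := by
  simp [mode_apply, waveSemigroup, waveMode, coeff]

lemma mode_force (μ : ℝ) (h : L2 D) (k : ℕ) :
    E.mode k (E.force μ h) = modeForce μ (E.coeff h k) := by
  have : (μ⁻¹ • E.incl h).1 k = μ⁻¹ * E.coeff h k := rfl
  simp [mode_apply, modeForce_apply, force, this]

/-- The energy `|u|² + μ |v|²_{H^{-1}}`. -/
lemma hasSum_energy (μ : ℝ) (p : E.Phase) :
    HasSum (fun k => (E.mode k p).1 ^ 2 + μ / E.α k * (E.mode k p).2 ^ 2)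
      (‖p.1‖ ^ 2 + μ * ‖p.2‖ ^ 2) := by
  simp only [mode_apply]
  rw [E.norm_sq_eq_tsum_coeff, norm_sq_hs]
  refine ((E.summable_coeff_sq p.1).hasSum.add ((E.summable_hs_sq p.2).hasSum.mul_left μ)).congr_fun
    fun k => ?_
  ring

lemma waveSemigroup_energy {μ : ℝ} (hμ : 0 < μ) (t : ℝ) (z : E.Phase) :
    ‖(E.waveSemigroup μ hμ t z).1‖ ^ 2 + μ * ‖(E.waveSemigroup μ hμ t z).2‖ ^ 2 ≤
      Real.exp (2 / μ * |t|) * (‖z.1‖ ^ 2 + μ * ‖z.2‖ ^ 2) := by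
  refine hasSum_le (fun k => ?_) (E.hasSum_energy μ (E.waveSemigroup μ hμ t z))
    ((E.hasSum_energy μ z).mul_left (Real.exp (2 / μ * |t|)))
  rw [mode_waveSemigroup]
  exact modeFlow_energy hμ (E.pos k) t _

end DirichletEigenbasis
-- Square integrable functions of time, and integrated forms of the mode estimate
lemma intervalIntegrable_of_integrable_Ioo {F : Type*} [NormedAddCommGroup F] {f : ℝ → F}
    {t₀ t₁ : ℝ} (h : t₀ ≤ t₁) (hf : Integrable f (volume.restrict (Ioo t₀ t₁))) :
    IntervalIntegrable f volume t₀ t₁ :=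
  (intervalIntegrable_iff_integrableOn_Ioo_of_le h).2 hf

lemma intervalIntegrable_of_memLp {F : Type*} [NormedAddCommGroup F] {f : ℝ → F}
    {t₀ t₁ : ℝ} (h : t₀ ≤ t₁) (hf : MemLp f 2 (volume.restrict (Ioo t₀ t₁))) :
    IntervalIntegrable f volume t₀ t₁ :=
  intervalIntegrable_of_integrable_Ioo h (hf.integrable (by norm_num))

lemma memLp_of_continuousOn {F : Type*} [NormedAddCommGroup F]
    {t₀ t₁ : ℝ} {f : ℝ → F} (hf : ContinuousOn f (Icc t₀ t₁)) :
    MemLp f 2 (volume.restrict (Ioo t₀ t₁)) := by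
  obtain ⟨C, hC⟩ := isCompact_Icc.exists_bound_of_continuousOn hf
  refine MemLp.of_bound ((hf.mono Ioo_subset_Icc_self).aestronglyMeasurable measurableSet_Ioo)
    C ?_
  rw [ae_restrict_iff' measurableSet_Ioo]
  exact Eventually.of_forall fun t ht => hC t (Ioo_subset_Icc_self ht)

lemma setLIntegral_ofReal_eq_integral {g : ℝ → ℝ} {T : ℝ} (hT : 0 ≤ T) (h0 : ∀ t, 0 ≤ g t)
    (hg : IntervalIntegrable g volume 0 T) :
    ∫⁻ t in Ioo 0 T, ENNReal.ofReal (g t) = ENNReal.ofReal (∫ t in (0 : ℝ)..T, g t) := by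
  rw [intervalIntegral.integral_of_le hT, integral_Ioc_eq_integral_Ioo,
    ofReal_integral_eq_lintegral_ofReal
      ((intervalIntegrable_iff_integrableOn_Ioo_of_le hT).1 hg) (Eventually.of_forall h0)]

lemma IsDuhamel.eq_modeSol {μ a T : ℝ} {f : ℝ → ℝ} {y : ℝ → ℝ × ℝ} (h : IsDuhamel μ a 0 T f y)
    (h0 : y 0 = 0) {t : ℝ} (ht : t ∈ Icc 0 T) : y t = modeSol μ a f t := by
  rw [h t ht, h0, map_zero, zero_add, modeSol]

lemma continuousOn_modeSol {μ a T : ℝ} {f : ℝ → ℝ} (hT : 0 ≤ T)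
    (hf : IntervalIntegrable f volume 0 T) : ContinuousOn (modeSol μ a f) (Icc 0 T) := by
  rw [← uIcc_of_le hT]
  exact (absolutelyContinuousOnInterval_modeSol hf (ContinuousLinearMap.fst ℝ ℝ ℝ)).continuousOn.prodMk
    (absolutelyContinuousOnInterval_modeSol hf (ContinuousLinearMap.snd ℝ ℝ ℝ)).continuousOn

lemma modeSol_energy_pointwise {μ a c T : ℝ} {f : ℝ → ℝ} (hμ : 0 < μ) (hc : 0 < c) (hca : c ≤ a)
    (hμc : 4 * μ * c ≤ 1) (hf : MemLp f 2 (volume.restrict (Ioo 0 T))) {t : ℝ}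
    (ht : t ∈ Icc 0 T) :
    1 / 2 * (μ * (modeSol μ a f t).2 ^ 2 + a * (modeSol μ a f t).1 ^ 2) ≤
      ∫ s in (0 : ℝ)..T, f s ^ 2 := by
  have hT := ht.1.trans ht.2
  have hf1 := intervalIntegrable_of_memLp hT hf
  have hf2 := intervalIntegrable_of_integrable_Ioo hT hf.integrable_sq
  have hs : uIcc 0 t ⊆ uIcc 0 T := by
    rw [uIcc_of_le ht.1, uIcc_of_le hT]; exact Icc_subset_Icc_right ht.2
  have h := modeSol_energy hμ hc hca hμc ht.1 (hf1.mono_set hs) (hf2.mono_set hs)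
  have h1 : 0 ≤ ∫ s in (0 : ℝ)..t, (modeSol μ a f s).1 ^ 2 :=
    intervalIntegral.integral_nonneg ht.1 fun _ _ => sq_nonneg _
  have h2 : 0 ≤ ∫ s in (0 : ℝ)..t, (modeSol μ a f s).2 ^ 2 :=
    intervalIntegral.integral_nonneg ht.1 fun _ _ => sq_nonneg _
  have h3 : ∫ s in (0 : ℝ)..t, f s ^ 2 ≤ ∫ s in (0 : ℝ)..T, f s ^ 2 :=
    intervalIntegral.integral_mono_interval le_rfl ht.1 ht.2
      (Eventually.of_forall fun _ => sq_nonneg _) hf2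
  have : 0 ≤ c * a := mul_nonneg hc.le (hc.le.trans hca)
  nlinarith [mul_nonneg this h1]

/-- Stated in `[0, ∞]` so that it can later be weighted by `α_k^δ` and summed over `k` before any
summability is known. -/
lemma modeSol_energy_lintegral {μ a c T : ℝ} {f : ℝ → ℝ} (hμ : 0 < μ) (hc : 0 < c) (hca : c ≤ a)
    (hμc : 4 * μ * c ≤ 1) (hT : 0 ≤ T) (hf : MemLp f 2 (volume.restrict (Ioo 0 T))) :
    ∫⁻ t in Ioo 0 T, ENNReal.ofReal (c * a * (modeSol μ a f t).1 ^ 2 +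
        1 / 2 * (modeSol μ a f t).2 ^ 2) ≤ ∫⁻ t in Ioo 0 T, ENNReal.ofReal (f t ^ 2) := by
  have hf1 := intervalIntegrable_of_memLp hT hf
  have hf2 := intervalIntegrable_of_integrable_Ioo hT hf.integrable_sq
  have hcont := continuousOn_modeSol (μ := μ) (a := a) hT hf1
  rw [← uIcc_of_le hT] at hcont
  have ha : 0 ≤ a := hc.le.trans hca
  have hu : IntervalIntegrable (fun t => (modeSol μ a f t).1 ^ 2) volume 0 T :=
    (hcont.fst.pow 2).intervalIntegrable
  have hv : IntervalIntegrable (fun t => (modeSol μ a f t).2 ^ 2) volume 0 T :=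
    (hcont.snd.pow 2).intervalIntegrable
  rw [setLIntegral_ofReal_eq_integral hT (fun t => by positivity)
      ((hu.const_mul _).add (hv.const_mul _)),
    setLIntegral_ofReal_eq_integral hT (fun t => sq_nonneg _) hf2]
  refine ENNReal.ofReal_le_ofReal ?_
  rw [intervalIntegral.integral_add (hu.const_mul _) (hv.const_mul _),
    intervalIntegral.integral_const_mul, intervalIntegral.integral_const_mul]
  have h := modeSol_energy hμ hc hca hμc hT hf1 hf2
  have : 0 ≤ 1 / 2 * (μ * (modeSol μ a f T).2 ^ 2 + a * (modeSol μ a f T).1 ^ 2) := by positivity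
  linarith

namespace DirichletEigenbasis

variable {d : ℕ} {D : Set (EuclideanSpace ℝ (Fin d))} (E : DirichletEigenbasis D)

lemma norm_incl_sq_le (h : L2 D) : ‖E.incl h‖ ^ 2 ≤ (E.α 0)⁻¹ * ‖h‖ ^ 2 := by
  rw [norm_sq_hs, E.norm_sq_eq_tsum_coeff, ← tsum_mul_left]
  refine Summable.tsum_le_tsum (fun k => ?_) (E.summable_hs_sq _)
    ((E.summable_coeff_sq h).mul_left _)
  have := inv_anti₀ E.α_pos (E.α_mono (Nat.zero_le k))
  exact mul_le_mul_of_nonneg_right this (sq_nonneg _)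

/-- Bounded times suffice here: the bound supplies the integrable majorant for the Bochner integrals
in the mild formulation. The estimates that must be uniform in time come from the mode energy
instead. -/
lemma norm_waveSemigroup_force_le {μ : ℝ} (hμ : 0 < μ) {t b : ℝ} (ht : |t| ≤ b) (h : L2 D) :
    ‖E.waveSemigroup μ hμ t (E.force μ h)‖ ≤
      √((1 + μ⁻¹) * (Real.exp (2 / μ * b) * (μ⁻¹ * (E.α 0)⁻¹))) * ‖h‖ := by
  set p := E.waveSemigroup μ hμ t (E.force μ h) with hp
  have h1 : ‖p.1‖ ^ 2 + μ * ‖p.2‖ ^ 2 ≤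
      Real.exp (2 / μ * b) * (μ⁻¹ * (E.α 0)⁻¹) * ‖h‖ ^ 2 := by
    refine (E.waveSemigroup_energy hμ t (E.force μ h)).trans ?_
    have e : ‖(E.force μ h).1‖ ^ 2 + μ * ‖(E.force μ h).2‖ ^ 2 = μ⁻¹ * ‖E.incl h‖ ^ 2 := by
      simp only [force, norm_zero, norm_smul, norm_inv, Real.norm_of_nonneg hμ.le]
      field_simp
      ring
    rw [e, mul_assoc, mul_assoc μ⁻¹]
    have := E.norm_incl_sq_le h
    gcongr
  have h2 : ‖p‖ ^ 2 ≤ (1 + μ⁻¹) * (‖p.1‖ ^ 2 + μ * ‖p.2‖ ^ 2) := by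
    have e : (1 + μ⁻¹) * (‖p.1‖ ^ 2 + μ * ‖p.2‖ ^ 2) =
        ‖p.1‖ ^ 2 + μ * ‖p.2‖ ^ 2 + μ⁻¹ * ‖p.1‖ ^ 2 + ‖p.2‖ ^ 2 := by field_simp; ring
    rw [e]
    have n1 : 0 ≤ μ * ‖p.2‖ ^ 2 := by positivity
    have n2 : 0 ≤ μ⁻¹ * ‖p.1‖ ^ 2 := by positivity
    rw [Prod.norm_def]
    rcases max_choice ‖p.1‖ ‖p.2‖ with h | h <;> rw [h] <;> nlinarith [sq_nonneg ‖p.1‖, sq_nonneg ‖p.2‖]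
  have h3 : ‖p‖ ^ 2 ≤ (1 + μ⁻¹) * (Real.exp (2 / μ * b) * (μ⁻¹ * (E.α 0)⁻¹)) * ‖h‖ ^ 2 := by
    refine h2.trans ?_
    rw [mul_assoc]
    gcongr
  calc ‖p‖ = √(‖p‖ ^ 2) := (Real.sqrt_sq (norm_nonneg _)).symm
    _ ≤ √((1 + μ⁻¹) * (Real.exp (2 / μ * b) * (μ⁻¹ * (E.α 0)⁻¹)) * ‖h‖ ^ 2) := Real.sqrt_le_sqrt h3
    _ = _ := by
      rw [Real.sqrt_mul, Real.sqrt_sq (norm_nonneg _)]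
      have := E.α_pos
      positivity

lemma intervalIntegrable_coeff {t₀ t₁ : ℝ} {f : ℝ → L2 D}
    (hf : IntervalIntegrable f volume t₀ t₁) (k : ℕ) :
    IntervalIntegrable (fun t => E.coeff (f t) k) volume t₀ t₁ :=
  ⟨(E.coeffL k).integrable_comp hf.1, (E.coeffL k).integrable_comp hf.2⟩

lemma memLp_coeff {X : Type*} [MeasurableSpace X] {ν : Measure X} {f : X → L2 D}
    (hf : MemLp f 2 ν) (k : ℕ) : MemLp (fun t => E.coeff (f t) k) 2 ν :=
  (E.coeffL k).comp_memLp' hf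

lemma intervalIntegrable_waveSemigroup_force {μ : ℝ} (hμ : 0 < μ) {t₀ t₁ : ℝ} {f : ℝ → L2 D}
    (hf : IntervalIntegrable f volume t₀ t₁) (t : ℝ) :
    IntervalIntegrable (fun s => E.waveSemigroup μ hμ (t - s) (E.force μ (f s)))
      volume t₀ t₁ := by
  rw [intervalIntegrable_iff] at hf ⊢
  refine Integrable.mono' (hf.norm.const_mul
    (√((1 + μ⁻¹) * (Real.exp (2 / μ * (|t| + (|t₀| + |t₁|))) * (μ⁻¹ * (E.α 0)⁻¹))))) ?_ ?_
  · refine E.aestronglyMeasurable_phase fun k => ?_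
    have := intervalIntegrable_modeFlow (μ := μ) (a := E.α k)
      (E.intervalIntegrable_coeff (intervalIntegrable_iff.2 hf) k) t
    rw [intervalIntegrable_iff] at this
    simpa only [mode_waveSemigroup, mode_force] using this.aestronglyMeasurable
  · rw [ae_restrict_iff' measurableSet_uIoc]
    refine Eventually.of_forall fun s hs => ?_
    refine E.norm_waveSemigroup_force_le hμ ?_ _
    have hs1 : |s| ≤ |t₀| + |t₁| := by
      rw [uIoc, mem_Ioc] at hs
      rw [abs_le]
      constructor
      · rcases min_choice t₀ t₁ with h | h <;> rw [h] at hs <;>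
          linarith [neg_abs_le t₀, neg_abs_le t₁, abs_nonneg t₀, abs_nonneg t₁]
      · rcases max_choice t₀ t₁ with h | h <;> rw [h] at hs <;>
          linarith [le_abs_self t₀, le_abs_self t₁, abs_nonneg t₀, abs_nonneg t₁]
    exact (abs_sub t s).trans (by linarith)

lemma mode_integral {μ : ℝ} (hμ : 0 < μ) {t₀ t₁ : ℝ} {f : ℝ → L2 D}
    (hf : IntervalIntegrable f volume t₀ t₁) (t : ℝ) (k : ℕ) :
    E.mode k (∫ s in t₀..t₁, E.waveSemigroup μ hμ (t - s) (E.force μ (f s))) =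
      ∫ s in t₀..t₁, modeFlow μ (E.α k) (t - s) (modeForce μ (E.coeff (f s) k)) := by
  rw [← ContinuousLinearMap.intervalIntegral_comp_comm _
    (E.intervalIntegrable_waveSemigroup_force hμ hf t)]
  simp only [mode_waveSemigroup, mode_force]

/-- A path is a mild solution of the skeleton equation iff each of its modes is. -/
lemma isMildSolution_iff {Q : L2 D →L[ℝ] L2 D} {B : L2 D → L2 D} (hB : Continuous B) {μ : ℝ}
    (hμ : 0 < μ) {t₀ t₁ : ℝ} (h01 : t₀ ≤ t₁) {ψ : ℝ → L2 D}
    (hψ : MemLp ψ 2 (volume.restrict (Ioo t₀ t₁))) {z : ℝ → E.Phase} :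
    E.IsMildSolution Q B μ hμ t₀ t₁ ψ z ↔ ContinuousOn z (Icc t₀ t₁) ∧
      ∀ k, IsDuhamel μ (E.α k) t₀ t₁ (fun t => E.coeff (B (z t).1 + Q (ψ t)) k)
        (fun t => E.mode k (z t)) := by
  refine and_congr_right fun hz => ?_
  have hBi : IntervalIntegrable (fun t => B (z t).1) volume t₀ t₁ := by
    refine ContinuousOn.intervalIntegrable ?_
    rw [uIcc_of_le h01]
    exact hB.comp_continuousOn hz.fst
  have hQi : IntervalIntegrable (fun t => Q (ψ t)) volume t₀ t₁ :=
    intervalIntegrable_of_memLp h01 (Q.comp_memLp' hψ)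
  have key : ∀ t ∈ Icc t₀ t₁, ∀ k, E.mode k (E.waveSemigroup μ hμ (t - t₀) (z t₀)
      + (∫ s in t₀..t, E.waveSemigroup μ hμ (t - s) (E.force μ (B (z s).1)))
      + ∫ s in t₀..t, E.waveSemigroup μ hμ (t - s) (E.force μ (Q (ψ s)))) =
      modeFlow μ (E.α k) (t - t₀) (E.mode k (z t₀)) +
      ∫ s in t₀..t, modeFlow μ (E.α k) (t - s) (modeForce μ
        (E.coeff (B (z s).1 + Q (ψ s)) k)) := by
    intro t ht k
    have hs : uIcc t₀ t ⊆ uIcc t₀ t₁ := by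
      rw [uIcc_of_le ht.1, uIcc_of_le h01]; exact Icc_subset_Icc_right ht.2
    have hBt := hBi.mono_set hs
    have hQt := hQi.mono_set hs
    rw [map_add, map_add, mode_waveSemigroup, E.mode_integral hμ hBt, E.mode_integral hμ hQt,
      add_assoc, ← intervalIntegral.integral_add
        (intervalIntegrable_modeFlow (E.intervalIntegrable_coeff hBt k) t)
        (intervalIntegrable_modeFlow (E.intervalIntegrable_coeff hQt k) t)]
    simp only [coeff_add, map_add]
  constructor
  · intro h k t ht
    simp only
    rw [← key t ht k, ← h t ht]
  · intro h t ht
    refine E.ext_mode fun k => ?_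
    rw [key t ht k]
    exact h k t ht

/-! ### Convolution with the semigroup -/

/-- The mild solution on `[0, ∞)` of the linear equation with forcing `f` and zero initial
condition. -/
def convolution (μ : ℝ) (hμ : 0 < μ) (f : ℝ → L2 D) (t : ℝ) : E.Phase :=
  ∫ s in (0 : ℝ)..t, E.waveSemigroup μ hμ (t - s) (E.force μ (f s))

lemma mode_convolution {μ : ℝ} (hμ : 0 < μ) {T : ℝ} {f : ℝ → L2 D}
    (hf : MemLp f 2 (volume.restrict (Ioo 0 T))) {t : ℝ} (ht : t ∈ Icc 0 T) (k : ℕ) :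
    E.mode k (E.convolution μ hμ f t) = modeSol μ (E.α k) (fun s => E.coeff (f s) k) t := by
  have hs : uIcc 0 t ⊆ uIcc 0 T := by
    rw [uIcc_of_le ht.1, uIcc_of_le (ht.1.trans ht.2)]; exact Icc_subset_Icc_right ht.2
  exact E.mode_integral hμ ((intervalIntegrable_of_memLp (ht.1.trans ht.2) hf).mono_set hs) t k

lemma convolution_sub {μ : ℝ} (hμ : 0 < μ) {T : ℝ} {f g : ℝ → L2 D}
    (hf : MemLp f 2 (volume.restrict (Ioo 0 T))) (hg : MemLp g 2 (volume.restrict (Ioo 0 T)))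
    {t : ℝ} (ht : t ∈ Icc 0 T) :
    E.convolution μ hμ (fun s => f s - g s) t =
      E.convolution μ hμ f t - E.convolution μ hμ g t := by
  have hT := ht.1.trans ht.2
  have hs : uIcc 0 t ⊆ uIcc 0 T := by
    rw [uIcc_of_le ht.1, uIcc_of_le hT]; exact Icc_subset_Icc_right ht.2
  refine E.ext_mode fun k => ?_
  have hfg : MemLp (fun s => f s - g s) 2 (volume.restrict (Ioo 0 T)) := hf.sub hg
  rw [map_sub, E.mode_convolution hμ hfg ht, E.mode_convolution hμ hf ht,
    E.mode_convolution hμ hg ht, modeSol, modeSol, modeSol, ← intervalIntegral.integral_sub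
      (intervalIntegrable_modeFlow (E.intervalIntegrable_coeff
        ((intervalIntegrable_of_memLp hT hf).mono_set hs) k) t)
      (intervalIntegrable_modeFlow (E.intervalIntegrable_coeff
        ((intervalIntegrable_of_memLp hT hg).mono_set hs) k) t)]
  simp only [coeff_sub, map_sub]

lemma lintegral_enorm_sq_eq {X : Type*} [MeasurableSpace X] {ν : Measure X} {f : X → L2 D}
    (hf : AEStronglyMeasurable f ν) :
    ∫⁻ t, ‖f t‖ₑ ^ 2 ∂ν = ∑' k, ∫⁻ t, ENNReal.ofReal (E.coeff (f t) k ^ 2) ∂ν := by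
  have hm : ∀ k, AEMeasurable (fun t => ENNReal.ofReal (E.coeff (f t) k ^ 2)) ν := fun k =>
    (((E.coeffL k).continuous.comp_aestronglyMeasurable hf).aemeasurable.pow_const 2).ennreal_ofReal
  rw [← lintegral_tsum hm]
  refine lintegral_congr fun t => ?_
  rw [← ENNReal.ofReal_tsum_of_nonneg (fun k => sq_nonneg _) (E.summable_coeff_sq _),
    ← E.norm_sq_eq_tsum_coeff, ENNReal.ofReal_pow (norm_nonneg _), ofReal_norm]

lemma lintegral_enorm_sq_lt_top {X F : Type*} [MeasurableSpace X] [NormedAddCommGroup F]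
    {ν : Measure X} {f : X → F} (hf : MemLp f 2 ν) : ∫⁻ t, ‖f t‖ₑ ^ 2 ∂ν < ⊤ := by
  have := lintegral_rpow_enorm_lt_top_of_eLpNorm_lt_top (by simp) (by simp) hf.2
  simpa using this

lemma summable_integral_coeff_sq {T : ℝ} (hT : 0 ≤ T) {f : ℝ → L2 D}
    (hf : MemLp f 2 (volume.restrict (Ioo 0 T))) :
    Summable fun k => ∫ t in (0 : ℝ)..T, E.coeff (f t) k ^ 2 := by
  have h1 := E.lintegral_enorm_sq_eq hf.1
  have h2 := lintegral_enorm_sq_lt_top hf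
  rw [h1] at h2
  refine (ENNReal.summable_toReal h2.ne).congr fun k => ?_
  rw [setLIntegral_ofReal_eq_integral hT (fun t => sq_nonneg _)
    (intervalIntegrable_of_integrable_Ioo hT (E.memLp_coeff hf k).integrable_sq),
    ENNReal.toReal_ofReal]
  exact intervalIntegral.integral_nonneg hT fun _ _ => sq_nonneg _

/-- Bounds, uniform in time, on the modes of the convolution. -/
lemma mode_convolution_sq_le {μ : ℝ} (hμ : 0 < μ) (hμc : 4 * μ * E.α 0 ≤ 1) {T : ℝ}
    {f : ℝ → L2 D} (hf : MemLp f 2 (volume.restrict (Ioo 0 T))) {t : ℝ} (ht : t ∈ Icc 0 T)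
    (k : ℕ) :
    (E.mode k (E.convolution μ hμ f t)).1 ^ 2 ≤
        (2 + 2 * μ⁻¹) * ((E.α k)⁻¹ * ∫ s in (0 : ℝ)..T, E.coeff (f s) k ^ 2) ∧
      (E.α k)⁻¹ * (E.mode k (E.convolution μ hμ f t)).2 ^ 2 ≤
        (2 + 2 * μ⁻¹) * ((E.α k)⁻¹ * ∫ s in (0 : ℝ)..T, E.coeff (f s) k ^ 2) := by
  rw [E.mode_convolution hμ hf ht]
  have h := modeSol_energy_pointwise hμ E.α_pos (E.α_mono (Nat.zero_le k)) hμc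
    (E.memLp_coeff hf k) ht
  have ha := E.pos k
  set I := ∫ s in (0 : ℝ)..T, E.coeff (f s) k ^ 2
  set p := modeSol μ (E.α k) (fun s => E.coeff (f s) k) t
  have hp1 : 0 ≤ E.α k * p.1 ^ 2 := by positivity
  have hp2 : 0 ≤ μ * p.2 ^ 2 := by positivity
  have hI : 0 ≤ I := by nlinarith
  have hμI : 0 ≤ μ⁻¹ * I := by positivity
  constructor
  · have e : p.1 ^ 2 = (E.α k)⁻¹ * (E.α k * p.1 ^ 2) := by field_simp
    rw [e, mul_left_comm (2 + 2 * μ⁻¹)]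
    refine mul_le_mul_of_nonneg_left ?_ (inv_nonneg.2 ha.le)
    nlinarith
  · rw [mul_left_comm (2 + 2 * μ⁻¹)]
    refine mul_le_mul_of_nonneg_left ?_ (inv_nonneg.2 ha.le)
    have e : p.2 ^ 2 = μ⁻¹ * (μ * p.2 ^ 2) := by field_simp
    rw [e]
    have : μ⁻¹ * (μ * p.2 ^ 2) ≤ μ⁻¹ * (2 * I) :=
      mul_le_mul_of_nonneg_left (by linarith) (inv_nonneg.2 hμ.le)
    linarith

lemma summable_inv_mul {G : ℕ → ℝ} (hG : Summable G) (h0 : ∀ k, 0 ≤ G k) :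
    Summable fun k => (E.α k)⁻¹ * G k :=
  Summable.of_nonneg_of_le (fun k => mul_nonneg (inv_nonneg.2 (E.pos k).le) (h0 k))
    (fun k => mul_le_mul_of_nonneg_right (inv_anti₀ E.α_pos (E.α_mono (Nat.zero_le k))) (h0 k))
    (hG.mul_left (E.α 0)⁻¹)

/-- Each mode is continuous in time, and `mode_convolution_sq_le` dominates all modes by a summable
sequence independent of `t`. -/
lemma continuousOn_convolution {μ : ℝ} (hμ : 0 < μ) (hμc : 4 * μ * E.α 0 ≤ 1) {T : ℝ}
    (hT : 0 ≤ T) {f : ℝ → L2 D} (hf : MemLp f 2 (volume.restrict (Ioo 0 T))) :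
    ContinuousOn (E.convolution μ hμ f) (Icc 0 T) := by
  intro t ht
  refine E.tendsto_phase_of_dominated ((E.summable_inv_mul (E.summable_integral_coeff_sq hT hf)
    fun k => intervalIntegral.integral_nonneg hT fun _ _ => sq_nonneg _).mul_left
      (2 + 2 * μ⁻¹)) ?_ fun k => ?_
  · filter_upwards [self_mem_nhdsWithin] with s hs k
    exact E.mode_convolution_sq_le hμ hμc hf hs k
  · have h := continuousOn_modeSol (μ := μ) (a := E.α k) hT
      (intervalIntegrable_of_memLp hT (E.memLp_coeff hf k)) t ht
    rw [ContinuousWithinAt, ← E.mode_convolution hμ hf ht] at h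
    refine h.congr' ?_
    filter_upwards [self_mem_nhdsWithin] with s hs
    rw [E.mode_convolution hμ hf hs]

lemma convolution_zero (μ : ℝ) (hμ : 0 < μ) (f : ℝ → L2 D) : E.convolution μ hμ f 0 = 0 := by
  simp [convolution]

lemma memLp_convolution_fst {μ : ℝ} (hμ : 0 < μ) (hμc : 4 * μ * E.α 0 ≤ 1) {T : ℝ}
    (hT : 0 ≤ T) {f : ℝ → L2 D} (hf : MemLp f 2 (volume.restrict (Ioo 0 T))) :
    MemLp (fun t => (E.convolution μ hμ f t).1) 2 (volume.restrict (Ioo 0 T)) :=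
  memLp_of_continuousOn (E.continuousOn_convolution hμ hμc hT hf).fst

end DirichletEigenbasis

/-! ### Sobolev scale, and energy estimates summed over the modes -/

namespace DirichletEigenbasis

variable {d : ℕ} {D : Set (EuclideanSpace ℝ (Fin d))} (E : DirichletEigenbasis D)

/-! ### Squared Sobolev norms with values in `[0, ∞]` -/

/-- `∑ α_k^δ x_k² ∈ [0, ∞]`. -/
def sob (δ : ℝ) (x : ℕ → ℝ) : ℝ≥0∞ := ∑' k, ENNReal.ofReal (E.α k ^ δ * x k ^ 2)

lemma rpow_mul_sq_nonneg (δ : ℝ) (x : ℕ → ℝ) (k : ℕ) : 0 ≤ E.α k ^ δ * x k ^ 2 :=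
  mul_nonneg (Real.rpow_nonneg (E.pos k).le _) (sq_nonneg _)

lemma memSobolev_iff (δ : ℝ) (x : ℕ → ℝ) : E.MemSobolev δ x ↔ E.sob δ x ≠ ⊤ := by
  constructor
  · intro h
    rw [sob, ← ENNReal.ofReal_tsum_of_nonneg (E.rpow_mul_sq_nonneg δ x) h]
    exact ENNReal.ofReal_ne_top
  · intro h
    refine (ENNReal.summable_toReal h).congr fun k => ?_
    rw [ENNReal.toReal_ofReal (E.rpow_mul_sq_nonneg δ x k)]

lemma sob_eq_ofReal {δ : ℝ} {x : ℕ → ℝ} (h : E.MemSobolev δ x) :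
    E.sob δ x = ENNReal.ofReal (E.sobolevNorm δ x ^ 2) := by
  rw [sobolevNorm, Real.sq_sqrt (tsum_nonneg (E.rpow_mul_sq_nonneg δ x)), sob,
    ENNReal.ofReal_tsum_of_nonneg (E.rpow_mul_sq_nonneg δ x) h]

lemma sob_zero_coeff (x : L2 D) : E.sob 0 (E.coeff x) = ‖x‖ₑ ^ 2 := by
  rw [sob]
  simp only [Real.rpow_zero, one_mul]
  rw [← ENNReal.ofReal_tsum_of_nonneg (fun k => sq_nonneg _) (E.summable_coeff_sq _),
    ← E.norm_sq_eq_tsum_coeff, ENNReal.ofReal_pow (norm_nonneg _), ofReal_norm]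

lemma rpow_le_mul_rpow {δ' δ : ℝ} (h : δ' ≤ δ) (k : ℕ) :
    E.α k ^ δ' ≤ E.α 0 ^ (δ' - δ) * E.α k ^ δ := by
  have h1 : E.α k ^ (δ' - δ) ≤ E.α 0 ^ (δ' - δ) :=
    Real.rpow_le_rpow_of_nonpos E.α_pos (E.α_mono (Nat.zero_le k)) (by linarith)
  calc E.α k ^ δ' = E.α k ^ (δ' - δ) * E.α k ^ δ := by rw [← Real.rpow_add (E.pos k)]; ring_nf
    _ ≤ _ := mul_le_mul_of_nonneg_right h1 (Real.rpow_nonneg (E.pos k).le _)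

lemma sob_le_of_le {C δ δ' : ℝ} {x y : ℕ → ℝ} (hC : 0 ≤ C)
    (h : ∀ k, E.α k ^ δ' * x k ^ 2 ≤ C * (E.α k ^ δ * y k ^ 2)) :
    E.sob δ' x ≤ ENNReal.ofReal C * E.sob δ y := by
  rw [sob, sob, ← ENNReal.tsum_mul_left]
  refine ENNReal.tsum_le_tsum fun k => ?_
  rw [← ENNReal.ofReal_mul hC]
  exact ENNReal.ofReal_le_ofReal (h k)

lemma sob_mono {δ' δ : ℝ} (h : δ' ≤ δ) (x : ℕ → ℝ) :
    E.sob δ' x ≤ ENNReal.ofReal (E.α 0 ^ (δ' - δ)) * E.sob δ x :=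
  E.sob_le_of_le (Real.rpow_nonneg E.α_pos.le _) fun k => by
    rw [← mul_assoc]
    exact mul_le_mul_of_nonneg_right (E.rpow_le_mul_rpow h k) (sq_nonneg _)

/-- Young's inequality with a free `ε`: the factor of the first term can be taken close to `1`, so
that the strict inequality between the Lipschitz constant of `B` and `α_1` survives. -/
lemma sob_add_le (δ : ℝ) (x y : ℕ → ℝ) {ε : ℝ} (hε : 0 < ε) :
    E.sob δ (fun k => x k + y k) ≤
      ENNReal.ofReal (1 + ε) * E.sob δ x + ENNReal.ofReal (1 + ε⁻¹) * E.sob δ y := by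
  rw [sob, sob, sob, ← ENNReal.tsum_mul_left, ← ENNReal.tsum_mul_left, ← ENNReal.tsum_add]
  refine ENNReal.tsum_le_tsum fun k => ?_
  rw [← ENNReal.ofReal_mul (by positivity), ← ENNReal.ofReal_mul (by positivity),
    ← ENNReal.ofReal_add (mul_nonneg (by positivity) (E.rpow_mul_sq_nonneg δ x k))
      (mul_nonneg (by positivity) (E.rpow_mul_sq_nonneg δ y k))]
  refine ENNReal.ofReal_le_ofReal ?_
  have ha := Real.rpow_nonneg (E.pos k).le δ
  have h : (x k + y k) ^ 2 ≤ (1 + ε) * x k ^ 2 + (1 + ε⁻¹) * y k ^ 2 := by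
    have : 0 ≤ ε⁻¹ * (ε * x k - y k) ^ 2 := by positivity
    have e : ε⁻¹ * (ε * x k - y k) ^ 2 = ε * x k ^ 2 - 2 * (x k * y k) + ε⁻¹ * y k ^ 2 := by
      field_simp
      ring
    nlinarith
  calc E.α k ^ δ * (x k + y k) ^ 2
      ≤ E.α k ^ δ * ((1 + ε) * x k ^ 2 + (1 + ε⁻¹) * y k ^ 2) := mul_le_mul_of_nonneg_left h ha
    _ = _ := by ring

/-! ### The nonlinearity and the covariance -/

/-- `B` maps `H^δ` into itself and is Lipschitz there with a constant `γ < α_1`. -/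
def LipschitzSobolev (B : L2 D → L2 D) (δ : ℝ) : Prop :=
  (∀ x, E.MemSobolev δ (E.coeff x) → E.MemSobolev δ (E.coeff (B x))) ∧
    ∃ γ : ℝ, γ < E.α 0 ∧ ∀ x y, E.MemSobolev δ (E.coeff x) → E.MemSobolev δ (E.coeff y) →
      E.sobolevNorm δ (E.coeff (B x - B y)) ≤ γ * E.sobolevNorm δ (E.coeff (x - y))

lemma coeff_sub_eq (x y : L2 D) : E.coeff (x - y) = E.coeff x - E.coeff y :=
  funext fun k => E.coeff_sub x y k

lemma memSobolev_sub {δ : ℝ} {x y : L2 D} (hx : E.MemSobolev δ (E.coeff x))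
    (hy : E.MemSobolev δ (E.coeff y)) : E.MemSobolev δ (E.coeff (x - y)) := by
  rw [coeff_sub_eq]
  exact (E.sobolevSubmodule δ).sub_mem hx hy

variable {E} in
lemma LipschitzSobolev.exists_sob_le {B : L2 D → L2 D} {δ : ℝ} (h : E.LipschitzSobolev B δ) :
    ∃ q : ℝ, 0 < q ∧ q < E.α 0 ∧ ∀ x y, E.MemSobolev δ (E.coeff x) →
      E.MemSobolev δ (E.coeff y) →
      E.sob δ (E.coeff (B x - B y)) ≤ ENNReal.ofReal (q ^ 2) * E.sob δ (E.coeff (x - y)) := by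
  obtain ⟨h1, γ, hγ, h2⟩ := h
  have h0 := E.α_pos
  -- Enlarging `γ` to at least `α_1 / 2` keeps it below `α_1` and makes it positive, so that it may
  -- be squared and divided by.
  refine ⟨max γ (E.α 0 / 2), lt_max_of_lt_right (by linarith), max_lt hγ (by linarith),
    fun x y hx hy => ?_⟩
  rw [E.sob_eq_ofReal (E.memSobolev_sub (h1 x hx) (h1 y hy)),
    E.sob_eq_ofReal (E.memSobolev_sub hx hy), ← ENNReal.ofReal_mul (sq_nonneg _), ← mul_pow]
  refine ENNReal.ofReal_le_ofReal (pow_le_pow_left₀ (Real.sqrt_nonneg _) ?_ 2)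
  exact (h2 x y hx hy).trans (mul_le_mul_of_nonneg_right (le_max_left _ _) (Real.sqrt_nonneg _))

lemma memSobolev_coeff_zero (δ : ℝ) : E.MemSobolev δ (E.coeff 0) := by
  have : E.coeff (0 : L2 D) = 0 := funext fun k => E.coeff_zero k
  rw [this]
  exact (E.sobolevSubmodule δ).zero_mem

lemma memSobolev_zero (x : L2 D) : E.MemSobolev 0 (E.coeff x) := by
  rw [memSobolev_iff, sob_zero_coeff]
  simp

variable {E} in
-- No regularity of `x` is required: if `x ∉ H^δ` the right side is `∞`, because `q` is strictly
-- positive.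
lemma LipschitzSobolev.exists_sob_le_self {B : L2 D → L2 D} {δ : ℝ}
    (h : E.LipschitzSobolev B δ) (hB0 : B 0 = 0) :
    ∃ q : ℝ, 0 < q ∧ q < E.α 0 ∧ ∀ x,
      E.sob δ (E.coeff (B x)) ≤ ENNReal.ofReal (q ^ 2) * E.sob δ (E.coeff x) := by
  obtain ⟨q, hq0, hq, hq2⟩ := h.exists_sob_le
  refine ⟨q, hq0, hq, fun x => ?_⟩
  by_cases hx : E.MemSobolev δ (E.coeff x)
  · simpa [hB0] using hq2 x 0 hx (E.memSobolev_coeff_zero δ)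
  · rw [memSobolev_iff, not_not] at hx
    rw [hx, ENNReal.mul_top]
    · exact le_top
    · rw [Ne, ENNReal.ofReal_eq_zero, not_le]
      positivity

variable {E} in
lemma LipschitzSobolev.exists_norm_le {B : L2 D → L2 D} (h : E.LipschitzSobolev B 0) :
    ∃ q : ℝ, 0 < q ∧ q < E.α 0 ∧ ∀ x y, ‖B x - B y‖ ≤ q * ‖x - y‖ := by
  obtain ⟨q, hq0, hq, hq2⟩ := h.exists_sob_le
  refine ⟨q, hq0, hq, fun x y => ?_⟩
  have := hq2 x y (E.memSobolev_zero x) (E.memSobolev_zero y)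
  rw [sob_zero_coeff, sob_zero_coeff, ← ofReal_norm, ← ofReal_norm,
    ← ENNReal.ofReal_pow (norm_nonneg _), ← ENNReal.ofReal_pow (norm_nonneg _),
    ← ENNReal.ofReal_mul (sq_nonneg _), ENNReal.ofReal_le_ofReal_iff (by positivity),
    ← mul_pow] at this
  exact (pow_le_pow_iff_left₀ (norm_nonneg _) (by positivity) two_ne_zero).1 this

variable {E} in
lemma LipschitzSobolev.continuous {B : L2 D → L2 D} (h : E.LipschitzSobolev B 0) :
    Continuous B := by
  obtain ⟨q, hq0, -, hq⟩ := h.exists_norm_le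
  have : LipschitzWith ⟨q, hq0.le⟩ B := LipschitzWith.of_dist_le_mul fun x y => by
    rw [dist_eq_norm, dist_eq_norm]
    exact hq x y
  exact this.continuous

/-- `Q` is diagonal with eigenvalues comparable to `α_k^{-β}`. -/
def DiagonalComparable (Q : L2 D →L[ℝ] L2 D) (lam : ℕ → ℝ) (β c : ℝ) : Prop :=
  (∀ k, Q (E.e k) = lam k • E.e k) ∧ 0 < c ∧
    ∀ k : ℕ, c⁻¹ * E.α k ^ (-β) ≤ lam k ∧ lam k ≤ c * E.α k ^ (-β)

section

variable {E}
variable {Q : L2 D →L[ℝ] L2 D} {lam : ℕ → ℝ} {β c : ℝ}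

lemma rpow_neg_sq (k : ℕ) : (E.α k ^ (-β)) ^ 2 = E.α k ^ (-(2 * β)) := by
  rw [← Real.rpow_natCast (E.α k ^ (-β)) 2, ← Real.rpow_mul (E.pos k).le]
  congr 1
  push_cast
  ring

lemma DiagonalComparable.lam_pos (h : E.DiagonalComparable Q lam β c) (k : ℕ) : 0 < lam k := by
  have h1 := (h.2.2 k).1
  have h2 := h.2.1
  have h3 := Real.rpow_pos_of_pos (E.pos k) (-β)
  exact lt_of_lt_of_le (by positivity) h1

lemma DiagonalComparable.lam_sq_le (h : E.DiagonalComparable Q lam β c) (k : ℕ) :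
    lam k ^ 2 ≤ c ^ 2 * E.α k ^ (-(2 * β)) := by
  rw [← rpow_neg_sq, ← mul_pow]
  exact pow_le_pow_left₀ (h.lam_pos k).le (h.2.2 k).2 2

lemma DiagonalComparable.inv_sq_le (h : E.DiagonalComparable Q lam β c) (k : ℕ) :
    (lam k)⁻¹ ^ 2 ≤ c ^ 2 * E.α k ^ (2 * β) := by
  have h3 := Real.rpow_pos_of_pos (E.pos k) (-β)
  have hc := h.2.1
  have h1 : (lam k)⁻¹ ≤ (c⁻¹ * E.α k ^ (-β))⁻¹ := inv_anti₀ (by positivity) (h.2.2 k).1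
  refine (pow_le_pow_left₀ (inv_nonneg.2 (h.lam_pos k).le) h1 2).trans (le_of_eq ?_)
  rw [mul_inv, inv_inv, mul_pow, inv_pow, rpow_neg_sq, Real.rpow_neg (E.pos k).le, inv_inv]

lemma DiagonalComparable.coeff (h : E.DiagonalComparable Q lam β c) (x : L2 D) (k : ℕ) :
    E.coeff (Q x) k = lam k * E.coeff x k :=
  E.coeff_diagonal h.1 x k

/-- The smoothing of `Q`: the decay `lam k ^ 2 ≤ c² α_k^{-2β}` pays for up to `2β` derivatives. -/
lemma DiagonalComparable.sob_le (h : E.DiagonalComparable Q lam β c) {δ : ℝ} (hδ : δ ≤ 2 * β)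
    (x : L2 D) : E.sob δ (E.coeff (Q x)) ≤
      ENNReal.ofReal (c ^ 2 * E.α 0 ^ (δ - 2 * β)) * ‖x‖ₑ ^ 2 := by
  rw [← E.sob_zero_coeff]
  have h0 := Real.rpow_nonneg E.α_pos.le (δ - 2 * β)
  refine E.sob_le_of_le (by positivity) fun k => ?_
  rw [h.coeff, Real.rpow_zero, one_mul, mul_pow, ← mul_assoc]
  refine mul_le_mul_of_nonneg_right ?_ (sq_nonneg _)
  calc E.α k ^ δ * lam k ^ 2 ≤
        (E.α 0 ^ (δ - 2 * β) * E.α k ^ (2 * β)) * (c ^ 2 * E.α k ^ (-(2 * β))) :=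
      mul_le_mul (E.rpow_le_mul_rpow hδ k) (h.lam_sq_le k) (sq_nonneg _)
        (mul_nonneg h0 (Real.rpow_nonneg (E.pos k).le _))
    _ = c ^ 2 * E.α 0 ^ (δ - 2 * β) * (E.α k ^ (2 * β) * E.α k ^ (-(2 * β))) := by ring
    _ = _ := by rw [← Real.rpow_add (E.pos k)]; simp

/-- Since `Q` is bounded, `β` cannot be negative. -/
lemma DiagonalComparable.nonneg (h : E.DiagonalComparable Q lam β c)
    (hα : Tendsto E.α atTop atTop) : 0 ≤ β := by
  by_contra! hβ
  have h1 : ∀ k, c⁻¹ * E.α k ^ (-β) ≤ ‖Q‖ := fun k => by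
    refine (h.2.2 k).1.trans ?_
    have h2 := Q.le_opNorm (E.e k)
    rw [h.1 k, norm_smul, E.e.orthonormal.1 k, mul_one, mul_one] at h2
    exact (le_abs_self _).trans h2
  have h2 : Tendsto (fun k => c⁻¹ * E.α k ^ (-β)) atTop atTop :=
    ((tendsto_rpow_atTop (by linarith : 0 < -β)).comp hα).const_mul_atTop (inv_pos.2 h.2.1)
  obtain ⟨k, hk⟩ := (h2.eventually_gt_atTop ‖Q‖).exists
  exact absurd (h1 k) (not_le.2 hk)

end

/-! ### Regularity of the solutions of the skeleton equation -/

section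

variable {E}
variable {μ T : ℝ} {f : ℝ → L2 D} {z : ℝ → E.Phase}

lemma aemeasurable_mode (hz : ContinuousOn z (Icc 0 T)) (k : ℕ) :
    AEMeasurable (fun t => E.mode k (z t)) (volume.restrict (Ioo 0 T)) :=
  (((E.mode k).continuous.comp_continuousOn (hz.mono Ioo_subset_Icc_self)).aestronglyMeasurable
    measurableSet_Ioo).aemeasurable

lemma aemeasurable_coeff {X : Type*} [MeasurableSpace X] {ν : Measure X} {f : X → L2 D}
    (hf : AEStronglyMeasurable f ν) (k : ℕ) : AEMeasurable (fun t => E.coeff (f t) k) ν :=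
  ((E.coeffL k).continuous.comp_aestronglyMeasurable hf).aemeasurable

lemma lintegral_sob_eq {X : Type*} [MeasurableSpace X] {ν : Measure X} {x : X → ℕ → ℝ}
    (hx : ∀ k, AEMeasurable (fun t => x t k) ν) (δ : ℝ) :
    ∫⁻ t, E.sob δ (x t) ∂ν =
      ∑' k, ENNReal.ofReal (E.α k ^ δ) * ∫⁻ t, ENNReal.ofReal (x t k ^ 2) ∂ν := by
  simp only [sob]
  rw [lintegral_tsum fun k => (((hx k).pow_const 2).const_mul _).ennreal_ofReal]
  refine tsum_congr fun k => ?_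
  have h0 := Real.rpow_nonneg (E.pos k).le δ
  simp only [ENNReal.ofReal_mul h0]
  rw [lintegral_const_mul' _ _ ENNReal.ofReal_ne_top]

/-- The modewise energy `α_k^δ (α_1 α_k u_k² + v_k² / 2)`, summed over the modes. -/
def dissipation (E : DirichletEigenbasis D) (δ : ℝ) (p : E.Phase) : ℝ≥0∞ :=
  ∑' k, ENNReal.ofReal (E.α k ^ δ) *
    ENNReal.ofReal (E.α 0 * E.α k * (E.mode k p).1 ^ 2 + 1 / 2 * (E.mode k p).2 ^ 2)

lemma aemeasurable_dissipation_term (hz : ContinuousOn z (Icc 0 T)) (δ : ℝ) (k : ℕ) :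
    AEMeasurable (fun t => ENNReal.ofReal (E.α k ^ δ) * ENNReal.ofReal
      (E.α 0 * E.α k * (E.mode k (z t)).1 ^ 2 + 1 / 2 * (E.mode k (z t)).2 ^ 2))
      (volume.restrict (Ioo 0 T)) :=
  ((((aemeasurable_mode hz k).fst.pow_const 2).const_mul _).add
    (((aemeasurable_mode hz k).snd.pow_const 2).const_mul _)).ennreal_ofReal.const_mul _

lemma aemeasurable_dissipation (hz : ContinuousOn z (Icc 0 T)) (δ : ℝ) :
    AEMeasurable (fun t => E.dissipation δ (z t)) (volume.restrict (Ioo 0 T)) :=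
  AEMeasurable.tsum fun k => aemeasurable_dissipation_term hz δ k

/-- The estimate for each mode is multiplied by `α_k^δ` and summed by Tonelli. Both sides may be
infinite, which is what makes the inequality usable for bootstrapping. -/
lemma lintegral_dissipation_le (hμ : 0 < μ) (hμc : 4 * μ * E.α 0 ≤ 1) (hT : 0 ≤ T)
    (hz : ContinuousOn z (Icc 0 T)) (hf : MemLp f 2 (volume.restrict (Ioo 0 T)))
    (hzf : ∀ k, IsDuhamel μ (E.α k) 0 T (fun t => E.coeff (f t) k) (fun t => E.mode k (z t)))
    (h0 : z 0 = 0) (δ : ℝ) :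
    ∫⁻ t in Ioo 0 T, E.dissipation δ (z t) ≤ ∫⁻ t in Ioo 0 T, E.sob δ (E.coeff (f t)) := by
  rw [lintegral_sob_eq (fun k => aemeasurable_coeff hf.1 k)]
  simp only [dissipation]
  rw [lintegral_tsum (aemeasurable_dissipation_term hz δ)]
  refine ENNReal.tsum_le_tsum fun k => ?_
  rw [lintegral_const_mul' _ _ ENNReal.ofReal_ne_top]
  refine mul_le_mul_right ?_ _
  refine le_trans (le_of_eq ?_) (modeSol_energy_lintegral hμ E.α_pos (E.α_mono (Nat.zero_le k))
    hμc hT (E.memLp_coeff hf k))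
  refine setLIntegral_congr_fun measurableSet_Ioo fun t ht => ?_
  rw [(hzf k).eq_modeSol (by simp [h0]) (Ioo_subset_Icc_self ht)]

lemma sob_add_one_le_dissipation (δ : ℝ) (p : E.Phase) :
    ENNReal.ofReal (E.α 0) * E.sob (δ + 1) (E.coeff p.1) ≤ E.dissipation δ p := by
  rw [sob, dissipation, ← ENNReal.tsum_mul_left]
  refine ENNReal.tsum_le_tsum fun k => ?_
  rw [← ENNReal.ofReal_mul E.α_pos.le, ← ENNReal.ofReal_mul (Real.rpow_nonneg (E.pos k).le _),
    mode_apply, Real.rpow_add_one (E.pos k).ne']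
  refine ENNReal.ofReal_le_ofReal ?_
  have h1 := Real.rpow_nonneg (E.pos k).le δ
  have : 0 ≤ E.α k ^ δ * (1 / 2 * p.2.1 k ^ 2) := by positivity
  simp only
  linarith

lemma lintegral_sob_add_one_le (hμ : 0 < μ) (hμc : 4 * μ * E.α 0 ≤ 1) (hT : 0 ≤ T)
    (hz : ContinuousOn z (Icc 0 T)) (hf : MemLp f 2 (volume.restrict (Ioo 0 T)))
    (hzf : ∀ k, IsDuhamel μ (E.α k) 0 T (fun t => E.coeff (f t) k) (fun t => E.mode k (z t)))
    (h0 : z 0 = 0) (δ : ℝ) :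
    ENNReal.ofReal (E.α 0) * ∫⁻ t in Ioo 0 T, E.sob (δ + 1) (E.coeff (z t).1) ≤
      ∫⁻ t in Ioo 0 T, E.sob δ (E.coeff (f t)) := by
  rw [← lintegral_const_mul' _ _ ENNReal.ofReal_ne_top]
  exact (lintegral_mono fun t => sob_add_one_le_dissipation δ (z t)).trans
    (lintegral_dissipation_le hμ hμc hT hz hf hzf h0 δ)

/-- The constant `α_1²` is what matters: it is compared with the squared Lipschitz constant `q² <
α_1²` when `B` is absorbed. -/
lemma lintegral_sob_le (hμ : 0 < μ) (hμc : 4 * μ * E.α 0 ≤ 1) (hT : 0 ≤ T)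
    (hz : ContinuousOn z (Icc 0 T)) (hf : MemLp f 2 (volume.restrict (Ioo 0 T)))
    (hzf : ∀ k, IsDuhamel μ (E.α k) 0 T (fun t => E.coeff (f t) k) (fun t => E.mode k (z t)))
    (h0 : z 0 = 0) (δ : ℝ) :
    ENNReal.ofReal (E.α 0 ^ 2) * ∫⁻ t in Ioo 0 T, E.sob δ (E.coeff (z t).1) ≤
      ∫⁻ t in Ioo 0 T, E.sob δ (E.coeff (f t)) := by
  refine le_trans ?_ (lintegral_sob_add_one_le hμ hμc hT hz hf hzf h0 δ)
  rw [sq, ENNReal.ofReal_mul E.α_pos.le, mul_assoc]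
  refine mul_le_mul_right ?_ _
  rw [← lintegral_const_mul' _ _ ENNReal.ofReal_ne_top]
  refine lintegral_mono fun t => ?_
  calc ENNReal.ofReal (E.α 0) * E.sob δ (E.coeff (z t).1)
      ≤ ENNReal.ofReal (E.α 0) * (ENNReal.ofReal (E.α 0 ^ (δ - (δ + 1))) *
          E.sob (δ + 1) (E.coeff (z t).1)) := mul_le_mul_right (E.sob_mono (by linarith) _) _
    _ = E.sob (δ + 1) (E.coeff (z t).1) := by
      rw [← mul_assoc, ← ENNReal.ofReal_mul E.α_pos.le, sub_add_cancel_left, Real.rpow_neg_one,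
        mul_inv_cancel₀ E.α_pos.ne', ENNReal.ofReal_one, one_mul]

/-- The energy at time `t` is controlled by the forcing up to time `T`. -/
lemma mode_energy_le (hμ : 0 < μ) (hμc : 4 * μ * E.α 0 ≤ 1)
    (hf : MemLp f 2 (volume.restrict (Ioo 0 T)))
    (hzf : ∀ k, IsDuhamel μ (E.α k) 0 T (fun t => E.coeff (f t) k) (fun t => E.mode k (z t)))
    (h0 : z 0 = 0) {t : ℝ} (ht : t ∈ Icc 0 T) (δ : ℝ) :
    ENNReal.ofReal (1 / 2) * E.sob (δ + 1) (E.coeff (z t).1) ≤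
      ∫⁻ t in Ioo 0 T, E.sob δ (E.coeff (f t)) := by
  rw [lintegral_sob_eq (fun k => aemeasurable_coeff hf.1 k), sob, ← ENNReal.tsum_mul_left]
  refine ENNReal.tsum_le_tsum fun k => ?_
  have h1 := modeSol_energy_pointwise hμ E.α_pos (E.α_mono (Nat.zero_le k)) hμc
    (E.memLp_coeff hf k) ht
  have hT := ht.1.trans ht.2
  rw [setLIntegral_ofReal_eq_integral hT (fun t => sq_nonneg _)
    (intervalIntegrable_of_integrable_Ioo hT (E.memLp_coeff hf k).integrable_sq)]
  have h2 := (hzf k).eq_modeSol (by simp [h0]) ht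
  rw [← h2, mode_apply] at h1
  have ha := Real.rpow_nonneg (E.pos k).le δ
  rw [← ENNReal.ofReal_mul (by norm_num), ← ENNReal.ofReal_mul ha,
    Real.rpow_add_one (E.pos k).ne']
  refine ENNReal.ofReal_le_ofReal ?_
  have : 0 ≤ μ * (z t).2.1 k ^ 2 := by positivity
  calc 1 / 2 * (E.α k ^ δ * E.α k * E.coeff (z t).1 k ^ 2)
      = E.α k ^ δ * (1 / 2 * (E.α k * E.coeff (z t).1 k ^ 2)) := by ring
    _ ≤ _ := mul_le_mul_of_nonneg_left (by simp only at h1; linarith) ha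

end

end DirichletEigenbasis

/-! ### Regularity of the forcing in terms of the control -/

namespace DirichletEigenbasis

variable {d : ℕ} {D : Set (EuclideanSpace ℝ (Fin d))} {E : DirichletEigenbasis D}

variable {Q : L2 D →L[ℝ] L2 D} {lam : ℕ → ℝ} {β c μ T : ℝ} {B : L2 D → L2 D}
  {ψ : ℝ → L2 D} {z : ℝ → E.Phase}

lemma memLp_forcing {t₀ t₁ : ℝ} (hB : Continuous B) (hz : ContinuousOn z (Icc t₀ t₁))
    (hψ : MemLp ψ 2 (volume.restrict (Ioo t₀ t₁))) :
    MemLp (fun t => B (z t).1 + Q (ψ t)) 2 (volume.restrict (Ioo t₀ t₁)) :=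
  MemLp.add (memLp_of_continuousOn (hB.comp_continuousOn hz.fst)) (Q.comp_memLp' hψ)

/-- Forcing bound in `L²(0, T; H^δ)` in terms of the solution and of the control. -/
lemma lintegral_sob_forcing_le (hQ : E.DiagonalComparable Q lam β c) {δ q ε : ℝ}
    (hδ : δ ≤ 2 * β) (hε : 0 < ε)
    (hq : ∀ x, E.sob δ (E.coeff (B x)) ≤ ENNReal.ofReal (q ^ 2) * E.sob δ (E.coeff x))
    (hψ : MemLp ψ 2 (volume.restrict (Ioo 0 T))) :
    ∫⁻ t in Ioo 0 T, E.sob δ (E.coeff (B (z t).1 + Q (ψ t))) ≤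
      ENNReal.ofReal ((1 + ε) * q ^ 2) * (∫⁻ t in Ioo 0 T, E.sob δ (E.coeff (z t).1)) +
      ENNReal.ofReal ((1 + ε⁻¹) * (c ^ 2 * E.α 0 ^ (δ - 2 * β))) *
        ∫⁻ t in Ioo 0 T, ‖ψ t‖ₑ ^ 2 := by
  have hm : AEMeasurable (fun t => ENNReal.ofReal ((1 + ε⁻¹) * (c ^ 2 * E.α 0 ^ (δ - 2 * β))) *
      ‖ψ t‖ₑ ^ 2) (volume.restrict (Ioo 0 T)) := (hψ.1.enorm.pow_const 2).const_mul _
  rw [← lintegral_const_mul' _ _ ENNReal.ofReal_ne_top,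
    ← lintegral_const_mul' _ _ ENNReal.ofReal_ne_top, ← lintegral_add_right' _ hm]
  refine lintegral_mono fun t => ?_
  have h1 := E.sob_add_le δ (E.coeff (B (z t).1)) (E.coeff (Q (ψ t))) hε
  have e : E.coeff (B (z t).1 + Q (ψ t)) =
      fun k => E.coeff (B (z t).1) k + E.coeff (Q (ψ t)) k := funext fun k => E.coeff_add _ _ k
  simp only [e]
  refine h1.trans (add_le_add ?_ ?_)
  · rw [ENNReal.ofReal_mul (by positivity), mul_assoc]
    exact mul_le_mul_right (hq _) _
  · rw [ENNReal.ofReal_mul (by positivity), mul_assoc]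
    exact mul_le_mul_right (hQ.sob_le hδ _) _

/-- Bootstrapping: a mild solution is square integrable in time with values in `H^{min(n, 2β)}`. -/
lemma lintegral_sob_min_lt_top (hQ : E.DiagonalComparable Q lam β c) (hβ : 0 ≤ β)
    (hB : ∀ δ ∈ Icc (0 : ℝ) (1 + 2 * β), E.LipschitzSobolev B δ) (hB0 : B 0 = 0)
    (hμ : 0 < μ) (hμc : 4 * μ * E.α 0 ≤ 1) (hT : 0 ≤ T)
    (hψ : MemLp ψ 2 (volume.restrict (Ioo 0 T))) (hz : E.IsMildSolution Q B μ hμ 0 T ψ z)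
    (h0 : z 0 = 0) (n : ℕ) :
    ∫⁻ t in Ioo 0 T, E.sob (min (n : ℝ) (2 * β)) (E.coeff (z t).1) < ⊤ := by
  have hBc : Continuous B := (hB 0 ⟨le_rfl, by linarith⟩).continuous
  rw [E.isMildSolution_iff hBc hμ hT hψ] at hz
  have hf := memLp_forcing (Q := Q) hBc hz.1 hψ
  induction n with
  | zero =>
    rw [Nat.cast_zero, min_eq_left (by linarith)]
    simp only [sob_zero_coeff]
    exact lintegral_enorm_sq_lt_top (memLp_of_continuousOn hz.1.fst)
  | succ n ih =>
    -- One round of the bootstrap: `u` in `L²(H^δ)` puts the forcing in `L²(H^δ)`, as `δ ≤ 2β`, and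
    -- the equation then gains one derivative. Capping at `2β` respects the smoothing limit of `Q`.
    set δ := min (n : ℝ) (2 * β) with hδ
    have hδ0 : 0 ≤ δ := le_min (Nat.cast_nonneg n) (by linarith)
    have hδ2 : δ ≤ 2 * β := min_le_right _ _
    obtain ⟨q, -, -, hq⟩ := (hB δ ⟨hδ0, by linarith⟩).exists_sob_le_self hB0
    have h1 := lintegral_sob_forcing_le (z := z) hQ hδ2 one_pos hq hψ
    have h2 := lintegral_sob_add_one_le hμ hμc hT hz.1 hf hz.2 h0 δ
    have h3 : ∫⁻ t in Ioo 0 T, E.sob δ (E.coeff (B (z t).1 + Q (ψ t))) < ⊤ :=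
      h1.trans_lt (ENNReal.add_lt_top.2 ⟨ENNReal.mul_lt_top ENNReal.ofReal_lt_top ih,
        ENNReal.mul_lt_top ENNReal.ofReal_lt_top (lintegral_enorm_sq_lt_top hψ)⟩)
    have h4 : ∫⁻ t in Ioo 0 T, E.sob (δ + 1) (E.coeff (z t).1) < ⊤ := by
      have h5 := h2.trans_lt h3
      by_contra h6
      rw [not_lt, top_le_iff] at h6
      rw [h6, ENNReal.mul_top (by simpa using E.α_pos)] at h5
      exact lt_irrefl _ h5
    have hle : min ((n + 1 : ℕ) : ℝ) (2 * β) ≤ δ + 1 := by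
      rw [hδ, ← min_add_add_right]
      exact min_le_min (by push_cast; exact le_rfl) (by linarith)
    refine (lintegral_mono fun t => E.sob_mono hle _).trans_lt ?_
    rw [lintegral_const_mul' _ _ ENNReal.ofReal_ne_top]
    exact ENNReal.mul_lt_top ENNReal.ofReal_lt_top h4

/-- The forcing of a mild solution starting from `0` is bounded in `L²(0, T; H^{2β})` by the
control, uniformly in `T`. -/
theorem exists_lintegral_sob_forcing_le (hQ : E.DiagonalComparable Q lam β c) (hβ : 0 ≤ β)
    (hB : ∀ δ ∈ Icc (0 : ℝ) (1 + 2 * β), E.LipschitzSobolev B δ) (hB0 : B 0 = 0)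
    (hμ : 0 < μ) (hμc : 4 * μ * E.α 0 ≤ 1) :
    ∃ C : ℝ, 0 < C ∧ ∀ (T : ℝ) (ψ : ℝ → L2 D) (z : ℝ → E.Phase), 0 ≤ T →
      MemLp ψ 2 (volume.restrict (Ioo 0 T)) → E.IsMildSolution Q B μ hμ 0 T ψ z → z 0 = 0 →
      ∫⁻ t in Ioo 0 T, E.sob (2 * β) (E.coeff (B (z t).1 + Q (ψ t))) ≤
        ENNReal.ofReal C * ∫⁻ t in Ioo 0 T, ‖ψ t‖ₑ ^ 2 := by
  obtain ⟨q, hq0, hqα, hq⟩ := (hB (2 * β) ⟨by linarith, by linarith⟩).exists_sob_le_self hB0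
  have hα := E.α_pos
  have hqα2 : q ^ 2 < E.α 0 ^ 2 := by nlinarith
  -- Chosen so that `(1 + ε) q²` is the midpoint of `q²` and `α_1²`.
  set ε := (E.α 0 ^ 2 - q ^ 2) / (2 * q ^ 2) with hε
  have hε0 : 0 < ε := div_pos (by linarith) (by positivity)
  have hεq : (1 + ε) * q ^ 2 = (E.α 0 ^ 2 + q ^ 2) / 2 := by
    rw [hε]; field_simp; ring
  set K := (1 + ε⁻¹) * (c ^ 2 * E.α 0 ^ (2 * β - 2 * β)) with hK
  have hc := hQ.2.1
  have hK0 : 0 < K := by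
    have := Real.rpow_pos_of_pos hα (2 * β - 2 * β)
    positivity
  refine ⟨2 * E.α 0 ^ 2 * K / (E.α 0 ^ 2 - q ^ 2), div_pos (by positivity) (by linarith),
    fun T ψ z hT hψ hz h0 => ?_⟩
  have hBc : Continuous B := (hB 0 ⟨le_rfl, by linarith⟩).continuous
  have hz' := (E.isMildSolution_iff hBc hμ hT hψ).1 hz
  have hf := memLp_forcing (Q := Q) hBc hz'.1 hψ
  -- Enough bootstrap rounds make the `H^{2β}` norm finite. Only finiteness is used: it legitimates
  -- the absorption below, and the constants of the bootstrap never enter `C`.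
  obtain ⟨n, hn⟩ := exists_nat_ge (2 * β)
  have hU := lintegral_sob_min_lt_top hQ hβ hB hB0 hμ hμc hT hψ hz h0 n
  rw [min_eq_right hn] at hU
  have hR := lintegral_enorm_sq_lt_top hψ
  have h1 := lintegral_sob_forcing_le (z := z) hQ le_rfl hε0 hq hψ
  have h2 := lintegral_sob_le hμ hμc hT hz'.1 hf hz'.2 h0 (2 * β)
  rw [hεq, ← hK] at h1
  set U := ∫⁻ t in Ioo 0 T, E.sob (2 * β) (E.coeff (z t).1)
  set F := ∫⁻ t in Ioo 0 T, E.sob (2 * β) (E.coeff (B (z t).1 + Q (ψ t)))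
  set R := ∫⁻ t in Ioo 0 T, ‖ψ t‖ₑ ^ 2
  have hF : F < ⊤ := h1.trans_lt (ENNReal.add_lt_top.2
    ⟨ENNReal.mul_lt_top ENNReal.ofReal_lt_top hU, ENNReal.mul_lt_top ENNReal.ofReal_lt_top hR⟩)
  clear_value U F R
  lift U to ℝ≥0 using hU.ne
  lift F to ℝ≥0 using hF.ne
  lift R to ℝ≥0 using hR.ne
  rw [← ENNReal.ofReal_coe_nnreal, ← ENNReal.ofReal_coe_nnreal, ← ENNReal.ofReal_coe_nnreal,
    ← ENNReal.ofReal_mul (by positivity), ← ENNReal.ofReal_mul hK0.le,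
    ← ENNReal.ofReal_add (by positivity) (by positivity),
    ENNReal.ofReal_le_ofReal_iff (by positivity)] at h1
  rw [← ENNReal.ofReal_coe_nnreal, ← ENNReal.ofReal_coe_nnreal,
    ← ENNReal.ofReal_mul (by positivity), ENNReal.ofReal_le_ofReal_iff (by positivity)] at h2
  have hd : 0 < E.α 0 ^ 2 - q ^ 2 := by linarith
  rw [← ENNReal.ofReal_coe_nnreal, ← ENNReal.ofReal_coe_nnreal,
    ← ENNReal.ofReal_mul (by positivity)]
  refine ENNReal.ofReal_le_ofReal ?_
  rw [div_mul_eq_mul_div, le_div_iff₀ hd]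
  -- With `m` the midpoint, `α_1² U ≤ F` and `F ≤ m U + K R` give `α_1² F ≤ m F + α_1² K R`, and
  -- `α_1² - m = (α_1² - q²) / 2`.
  have h3 := mul_le_mul_of_nonneg_left h2 (by positivity : (0 : ℝ) ≤ (E.α 0 ^ 2 + q ^ 2) / 2)
  have h4 := mul_le_mul_of_nonneg_left h1 (sq_nonneg (E.α 0))
  nlinarith

end DirichletEigenbasis
-- Cutoff function, reachable sets, and paths extended by rest at zero
lemma IsDuhamel.congr {μ a t₀ t₁ : ℝ} {f f' : ℝ → ℝ} {y y' : ℝ → ℝ × ℝ}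
    (h : IsDuhamel μ a t₀ t₁ f y) (hf : ∀ t ∈ Ioo t₀ t₁, f t = f' t)
    (hy : ∀ t ∈ Icc t₀ t₁, y t = y' t) : IsDuhamel μ a t₀ t₁ f' y' := by
  intro t ht
  rw [← hy t ht, ← hy t₀ ⟨le_rfl, ht.1.trans ht.2⟩, h t ht]
  congr 1
  refine intervalIntegral.integral_congr_ae ?_
  filter_upwards [Measure.ae_ne volume t₁] with s hs hs2
  rw [uIoc_of_le ht.1] at hs2
  rw [hf s ⟨hs2.1, lt_of_le_of_ne (hs2.2.trans ht.2) hs⟩]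

lemma eLpNorm_two_sq {X F : Type*} [MeasurableSpace X] [NormedAddCommGroup F] (ν : Measure X)
    (f : X → F) : eLpNorm f 2 ν ^ 2 = ∫⁻ t, ‖f t‖ₑ ^ 2 ∂ν := by
  rw [eLpNorm_eq_lintegral_rpow_enorm_toReal two_ne_zero ENNReal.ofNat_ne_top, ← ENNReal.rpow_two,
    ← ENNReal.rpow_mul]
  simp

/-- A smooth cutoff function. -/
lemma exists_cutoff : ∃ φ φ' φ'' : ℝ → ℝ, Continuous φ ∧ Continuous φ' ∧ Continuous φ'' ∧
    (∀ s, HasDerivAt φ (φ' s) s) ∧ (∀ s, HasDerivAt φ' (φ'' s) s) ∧ φ 0 = 1 ∧ φ' 0 = 0 ∧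
    (∀ s, 1 ≤ s → φ s = 0 ∧ φ' s = 0 ∧ φ'' s = 0) ∧
    ∃ M : ℝ, ∀ s ∈ Icc (0 : ℝ) 1, |φ s| ≤ M ∧ |φ' s| ≤ M ∧ |φ'' s| ≤ M := by
  -- This function equals `1` for `s ≤ 1/3` and `0` for `s ≥ 2/3`, so it is locally constant near
  -- `0` and on `[1, ∞)`, where its derivatives vanish.
  set φ : ℝ → ℝ := fun s => Real.smoothTransition (2 - 3 * s) with hφ
  have hc : ContDiff ℝ ((2 : ℕ) : ℕ∞) φ :=
    Real.smoothTransition.contDiff.comp (by fun_prop)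
  have hc1 : ContDiff ℝ 1 (deriv φ) := by
    have : ContDiff ℝ (1 + 1) φ := by simpa [one_add_one_eq_two] using hc
    exact (contDiff_succ_iff_deriv.1 this).2.2
  have hd : Differentiable ℝ φ := hc.differentiable (by simp)
  have hd1 : Differentiable ℝ (deriv φ) := hc1.differentiable (by simp)
  have hcc : Continuous (deriv (deriv φ)) := hc1.continuous_deriv le_rfl
  have hzero : ∀ s : ℝ, 1 ≤ s → φ =ᶠ[𝓝 s] fun _ => 0 := fun s hs => by
    filter_upwards [lt_mem_nhds (show (2 / 3 : ℝ) < s by linarith)] with t ht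
    exact Real.smoothTransition.zero_of_nonpos (by linarith)
  have hone : φ =ᶠ[𝓝 0] fun _ => 1 := by
    filter_upwards [gt_mem_nhds (show (0 : ℝ) < 1 / 3 by norm_num)] with t ht
    exact Real.smoothTransition.one_of_one_le (by linarith)
  refine ⟨φ, deriv φ, deriv (deriv φ), hd.continuous, hd1.continuous, hcc,
    fun s => (hd s).hasDerivAt, fun s => (hd1 s).hasDerivAt, hone.eq_of_nhds, ?_, ?_, ?_⟩
  · rw [hone.deriv_eq, deriv_const]
  · intro s hs
    refine ⟨(hzero s hs).eq_of_nhds, ?_, ?_⟩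
    · rw [(hzero s hs).deriv_eq, deriv_const]
    · rw [(hzero s hs).deriv.deriv_eq]
      simp
  · obtain ⟨M₁, h1⟩ := (isCompact_Icc (a := (0 : ℝ)) (b := 1)).exists_bound_of_continuousOn
      hd.continuous.continuousOn
    obtain ⟨M₂, h2⟩ := (isCompact_Icc (a := (0 : ℝ)) (b := 1)).exists_bound_of_continuousOn
      hd1.continuous.continuousOn
    obtain ⟨M₃, h3⟩ := (isCompact_Icc (a := (0 : ℝ)) (b := 1)).exists_bound_of_continuousOn
      hcc.continuousOn
    exact ⟨max M₁ (max M₂ M₃), fun s hs => ⟨(h1 s hs).trans (le_max_left _ _),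
      (h2 s hs).trans ((le_max_left _ _).trans (le_max_right _ _)),
      (h3 s hs).trans ((le_max_right _ _).trans (le_max_right _ _))⟩⟩

namespace DirichletEigenbasis

variable {d : ℕ} {D : Set (EuclideanSpace ℝ (Fin d))} (E : DirichletEigenbasis D)

/-- The points that can be reached from `0` at time `T` with a control of `L²` norm at most `ρ`. -/
def reach (Q : L2 D →L[ℝ] L2 D) (B : L2 D → L2 D) (μ : ℝ) (hμ : 0 < μ) (T ρ : ℝ) :
    Set E.Phase :=
  {p | ∃ ψ : ℝ → L2 D, MemLp ψ 2 (volume.restrict (Ioo 0 T)) ∧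
    eLpNorm ψ 2 (volume.restrict (Ioo 0 T)) ≤ ENNReal.ofReal ρ ∧
    ∃ z : ℝ → E.Phase, E.IsMildSolution Q B μ hμ 0 T ψ z ∧ z 0 = 0 ∧ z T = p}

lemma incl_sub (x y : L2 D) : E.incl (x - y) = E.incl x - E.incl y :=
  Subtype.ext (funext fun k => E.coeff_sub x y k)

lemma continuous_incl : Continuous E.incl := by
  refine (LipschitzWith.of_dist_le_mul (K := Real.toNNReal (√(E.α 0)⁻¹)) fun x y => ?_).continuous
  rw [dist_eq_norm, dist_eq_norm, ← incl_sub, Real.coe_toNNReal _ (Real.sqrt_nonneg _)]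
  have h := E.norm_incl_sq_le (x - y)
  calc ‖E.incl (x - y)‖ = √(‖E.incl (x - y)‖ ^ 2) := (Real.sqrt_sq (norm_nonneg _)).symm
    _ ≤ √((E.α 0)⁻¹ * ‖x - y‖ ^ 2) := Real.sqrt_le_sqrt h
    _ = _ := by rw [Real.sqrt_mul (inv_nonneg.2 E.α_pos.le), Real.sqrt_sq (norm_nonneg _)]

variable {E}
variable {Q : L2 D →L[ℝ] L2 D} {lam : ℕ → ℝ} {β c μ T : ℝ} {B : L2 D → L2 D}
  {ψ : ℝ → L2 D} {z : ℝ → E.Phase}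

/-- A path starting from `0` at time `t'` can be extended by `0` to earlier times and shifted. -/
lemma mem_reach_of_le (hB : Continuous B) (hB0 : B 0 = 0) (hμ : 0 < μ) {t' T N ρ : ℝ}
    (hT : t' ≤ T) (hN : T - t' ≤ N) (hψ : MemLp ψ 2 (volume.restrict (Ioo t' T)))
    (hρ : eLpNorm ψ 2 (volume.restrict (Ioo t' T)) ≤ ENNReal.ofReal ρ)
    (hz : E.IsMildSolution Q B μ hμ t' T ψ z) (h0 : z t' = 0) :
    z T ∈ E.reach Q B μ hμ N ρ := by
  rw [E.isMildSolution_iff hB hμ hT hψ] at hz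
  -- The new clock starts at `τ ≤ t'`, so that `T` becomes `N`. On `[τ, t']` the path rests at `0`
  -- with zero control, which is a solution because `B 0 = 0`.
  set τ := T - N with hτ
  have hτt : τ ≤ t' := by linarith
  set ψ₁ : ℝ → L2 D := (Ioo t' T).indicator ψ with hψ₁
  set z₁ : ℝ → E.Phase := fun t => z (max t t') with hz₁
  have hψ₁L : MemLp ψ₁ 2 volume := (memLp_indicator_iff_restrict measurableSet_Ioo).2 hψ
  have hψ₁n : eLpNorm ψ₁ 2 volume ≤ ENNReal.ofReal ρ := by
    rwa [hψ₁, eLpNorm_indicator_eq_eLpNorm_restrict measurableSet_Ioo]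
  have hz₁c : ContinuousOn z₁ (Iic T) :=
    hz.1.comp (by fun_prop) fun t ht => ⟨le_max_right _ _, max_le ht hT⟩
  have hz₁0 : ∀ s ≤ t', z₁ s = 0 := fun s hs => by rw [hz₁]; simp only [max_eq_right hs, h0]
  have hz₁e : ∀ s, t' ≤ s → z₁ s = z s := fun s hs => by rw [hz₁]; simp only [max_eq_left hs]
  have hmp : MeasurePreserving (fun t : ℝ => t + τ) volume volume :=
    measurePreserving_add_right volume τ
  have hψ₂ : MemLp (fun t => ψ₁ (t + τ)) 2 (volume.restrict (Ioo 0 N)) :=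
    (hψ₁L.comp_measurePreserving hmp).restrict _
  refine ⟨fun t => ψ₁ (t + τ), hψ₂, ?_,
    fun t => z₁ (t + τ), ?_, ?_, ?_⟩
  · refine (eLpNorm_mono_measure _ Measure.restrict_le_self).trans ?_
    exact (eLpNorm_comp_measurePreserving (p := 2) hψ₁L.1 hmp).trans_le hψ₁n
  · rw [E.isMildSolution_iff hB hμ (by linarith) hψ₂]
    refine ⟨hz₁c.comp (by fun_prop) fun t ht => ?_, fun k => ?_⟩
    · simp only [mem_Iic]
      linarith [ht.2]
    · have h1 : IsDuhamel μ (E.α k) t' T (fun t => E.coeff (B (z₁ t).1 + Q (ψ₁ t)) k)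
          (fun t => E.mode k (z₁ t)) := by
        refine (hz.2 k).congr (fun t ht => ?_) fun t ht => ?_
        · rw [hz₁e t ht.1.le, hψ₁, indicator_of_mem ht]
        · rw [hz₁e t ht.1]
      have hf := memLp_forcing (Q := Q) hB (hz₁c.mono Icc_subset_Iic_self)
        (hψ₁L.restrict (Ioo t' T))
      have h2 := h1.extend_zero (E.intervalIntegrable_coeff (intervalIntegrable_of_memLp hT hf) k)
        hτt (fun s hs => ?_) fun s hs => ?_
      · have h3 := h2.comp_add τ
        rwa [sub_self, hτ, sub_sub_cancel] at h3
      · rw [hz₁0 s hs.le, hψ₁, indicator_of_notMem (fun h => (not_lt.2 hs.le) h.1)]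
        simp [hB0]
      · rw [hz₁0 s hs, map_zero]
  · simp only [zero_add, hz₁0 τ hτt]
  · simp only [hτ, add_sub_cancel, hz₁e T hT]

/-! ### Steering to `0` a regular initial datum -/

lemma continuousOn_waveSemigroup (hμ : 0 < μ) (p : E.Phase) :
    Continuous fun t => E.waveSemigroup μ hμ t p := by
  refine continuous_iff_continuousAt.2 fun t => ?_
  have hs := ((E.hasSum_energy μ p).summable.mul_left
    ((1 + μ⁻¹) * Real.exp (2 / μ * (|t| + 1))))
  refine E.tendsto_phase_of_dominated hs ?_ fun k => ?_
  · have hlt : ∀ᶠ s in 𝓝 t, |s| < |t| + 1 :=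
      continuous_abs.continuousAt.eventually_lt continuousAt_const (by linarith)
    filter_upwards [hlt] with s hs k
    have h := modeFlow_energy hμ (E.pos k) s (E.mode k p)
    rw [mode_waveSemigroup]
    have ha := E.pos k
    have he : Real.exp (2 / μ * |s|) ≤ Real.exp (2 / μ * (|t| + 1)) := by gcongr
    set x := modeFlow μ (E.α k) s (E.mode k p)
    set G := (E.mode k p).1 ^ 2 + μ / E.α k * (E.mode k p).2 ^ 2
    have hG : 0 ≤ G := by positivity
    have hb := h.trans (mul_le_mul_of_nonneg_right he hG)
    have hx1 := sq_nonneg x.1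
    have hx2 : 0 ≤ μ / E.α k * x.2 ^ 2 := by positivity
    set W := Real.exp (2 / μ * (|t| + 1)) * G
    have hW : 0 ≤ W := by positivity
    have hW' : 0 ≤ μ⁻¹ * W := by positivity
    have e : (1 + μ⁻¹) * Real.exp (2 / μ * (|t| + 1)) * G = W + μ⁻¹ * W := by ring
    rw [e]
    constructor
    · linarith
    · have e2 : (E.α k)⁻¹ * x.2 ^ 2 = μ⁻¹ * (μ / E.α k * x.2 ^ 2) := by field_simp
      have : μ⁻¹ * (μ / E.α k * x.2 ^ 2) ≤ μ⁻¹ * W :=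
        mul_le_mul_of_nonneg_left (by linarith) (inv_nonneg.2 hμ.le)
      linarith
  · simp only [mode_waveSemigroup]
    exact (((continuous_modeFlow μ (E.α k)).clm_apply continuous_const).tendsto t)

/-- Truncating the free position `u` to `φ u` forces the velocity to be `φ' u + φ v`. The forcing
needed is the commutator of the oscillator with multiplication by `φ`; it involves no power of `a`,
so steering loses no derivatives. -/
lemma hasDerivAt_cutoff_mul {φ φ' φ'' : ℝ → ℝ} (hφ : ∀ s, HasDerivAt φ (φ' s) s)
    (hφ' : ∀ s, HasDerivAt φ' (φ'' s) s) (hμ : 0 < μ) (a : ℝ) (p : ℝ × ℝ) (t : ℝ) :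
    HasDerivAt (fun s => (φ s * (modeFlow μ a s p).1,
        φ' s * (modeFlow μ a s p).1 + φ s * (modeFlow μ a s p).2))
      (modeGen μ a (φ t * (modeFlow μ a t p).1,
        φ' t * (modeFlow μ a t p).1 + φ t * (modeFlow μ a t p).2) +
        modeForce μ (μ * φ'' t * (modeFlow μ a t p).1 + 2 * μ * φ' t * (modeFlow μ a t p).2 +
          φ' t * (modeFlow μ a t p).1)) t := by
  have h := hasDerivAt_modeFlow μ a t p
  have h1 : HasDerivAt (fun s => (modeFlow μ a s p).1) (modeFlow μ a t p).2 t :=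
    ((ContinuousLinearMap.fst ℝ ℝ ℝ).hasFDerivAt.comp_hasDerivAt t h).congr_deriv
      (by simp [modeGen])
  have h2 : HasDerivAt (fun s => (modeFlow μ a s p).2)
      (μ⁻¹ * (-(a * (modeFlow μ a t p).1) - (modeFlow μ a t p).2)) t :=
    ((ContinuousLinearMap.snd ℝ ℝ ℝ).hasFDerivAt.comp_hasDerivAt t h).congr_deriv
      (by simp [modeGen])
  refine (((hφ t).mul h1).prodMk (((hφ' t).mul h1).add ((hφ t).mul h2))).congr_deriv ?_
  ext
  · simp [modeGen, modeForce]
  · simp [modeGen, modeForce]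
    field_simp
    ring

end DirichletEigenbasis
/-- Bounds for the flow on the time interval `[0, 1]` in terms of the initial datum. -/
lemma modeFlow_sq_le {μ a α₀ s : ℝ} (hμ : 0 < μ) (hα₀ : 0 < α₀) (ha : α₀ ≤ a)
    (hs : s ∈ Icc (0 : ℝ) 1) (p : ℝ × ℝ) :
    α₀ * (modeFlow μ a s p).1 ^ 2 + μ * (modeFlow μ a s p).2 ^ 2 ≤
      Real.exp (2 / μ) * (α₀⁻¹ + 2 * μ) * (α₀ * a * p.1 ^ 2 + 1 / 2 * p.2 ^ 2) := by
  have ha0 : 0 < a := hα₀.trans_le ha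
  have h := modeFlow_energy hμ ha0 s p
  have he : Real.exp (2 / μ * |s|) ≤ Real.exp (2 / μ) := by
    rw [abs_of_nonneg hs.1]
    refine Real.exp_le_exp.2 (mul_le_of_le_one_right (by positivity) hs.2)
  set x := modeFlow μ a s p
  have h1 := h.trans (mul_le_mul_of_nonneg_right he
    (by positivity : 0 ≤ p.1 ^ 2 + μ / a * p.2 ^ 2))
  have h2 := mul_le_mul_of_nonneg_left h1 ha0.le
  have e1 : a * (x.1 ^ 2 + μ / a * x.2 ^ 2) = a * x.1 ^ 2 + μ * x.2 ^ 2 := by field_simp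
  have e2 : a * (Real.exp (2 / μ) * (p.1 ^ 2 + μ / a * p.2 ^ 2)) =
      Real.exp (2 / μ) * (a * p.1 ^ 2 + μ * p.2 ^ 2) := by field_simp
  rw [e1, e2] at h2
  have h3 : a * p.1 ^ 2 + μ * p.2 ^ 2 ≤
      (α₀⁻¹ + 2 * μ) * (α₀ * a * p.1 ^ 2 + 1 / 2 * p.2 ^ 2) := by
    have e : (α₀⁻¹ + 2 * μ) * (α₀ * a * p.1 ^ 2 + 1 / 2 * p.2 ^ 2) = a * p.1 ^ 2 + μ * p.2 ^ 2 +
        (α₀⁻¹ * (1 / 2 * p.2 ^ 2) + 2 * μ * (α₀ * a * p.1 ^ 2)) := by field_simp; ring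
    rw [e]
    have : 0 ≤ α₀⁻¹ * (1 / 2 * p.2 ^ 2) + 2 * μ * (α₀ * a * p.1 ^ 2) := by positivity
    linarith
  have h4 := mul_le_mul_of_nonneg_left h3 (Real.exp_nonneg (2 / μ))
  have h5 := mul_le_mul_of_nonneg_right ha (sq_nonneg x.1)
  linarith

namespace DirichletEigenbasis

variable {d : ℕ} {D : Set (EuclideanSpace ℝ (Fin d))} {E : DirichletEigenbasis D}

/-- A modewise comparison with a constant independent of `k` holds in all Sobolev norms at once, so
the steering bound needs no choice of `δ`. -/
lemma sob_le_dissipation {C δ : ℝ} (hC : 0 ≤ C) {x : ℕ → ℝ} {p : E.Phase}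
    (h : ∀ k, x k ^ 2 ≤ C * (E.α 0 * E.α k * (E.mode k p).1 ^ 2 + 1 / 2 * (E.mode k p).2 ^ 2)) :
    E.sob δ x ≤ ENNReal.ofReal C * E.dissipation δ p := by
  rw [sob, dissipation, ← ENNReal.tsum_mul_left]
  refine ENNReal.tsum_le_tsum fun k => ?_
  have ha := Real.rpow_nonneg (E.pos k).le δ
  rw [← ENNReal.ofReal_mul ha, ← ENNReal.ofReal_mul hC]
  refine ENNReal.ofReal_le_ofReal ?_
  rw [mul_left_comm]
  exact mul_le_mul_of_nonneg_left (h k) ha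

/-- Null controllability of the linear equation in unit time, with a control that is bounded by the
initial datum. -/
lemma exists_steering (E : DirichletEigenbasis D) {μ : ℝ} (hμ : 0 < μ) :
    ∃ C : ℝ, 0 < C ∧ ∀ p : E.Phase, ∃ (w : ℝ → E.Phase) (g : ℕ → ℝ → ℝ),
      Continuous w ∧ w 0 = p ∧ (∀ s, 1 ≤ s → w s = 0 ∧ ∀ k, g k s = 0) ∧
      (∀ k, Continuous (g k)) ∧
      (∀ k t₀ t₁, IsDuhamel μ (E.α k) t₀ t₁ (g k) (fun s => E.mode k (w s))) ∧
      ∀ s ∈ Icc (0 : ℝ) 1, ∀ δ, E.sob δ (E.coeff (w s).1) ≤ ENNReal.ofReal C * E.dissipation δ p ∧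
        E.sob δ (fun k => g k s) ≤ ENNReal.ofReal C * E.dissipation δ p := by
  obtain ⟨φ, φ', φ'', hc, hc', hc'', hd, hd', h0, h0', hz, M, hM⟩ := exists_cutoff
  have hα := E.α_pos
  have hM1 : 1 ≤ M := by
    have := (hM 0 ⟨le_rfl, zero_le_one⟩).1
    rwa [h0, abs_one] at this
  set K := Real.exp (2 / μ) * ((E.α 0)⁻¹ + 2 * μ) with hK
  have hK0 : 0 < K := by positivity
  set C₁ := M ^ 2 * (E.α 0)⁻¹ * K with hC₁
  set C₂ := 3 * M ^ 2 * (μ ^ 2 * (E.α 0)⁻¹ + 4 * μ + (E.α 0)⁻¹) * K with hC₂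
  have hC₁0 : 0 < C₁ := by positivity
  have hC₂0 : 0 < C₂ := by positivity
  refine ⟨C₁ + C₂, by positivity, fun p => ?_⟩
  -- The path is the free evolution of `p` with its position multiplied by the cutoff and its
  -- velocity adjusted accordingly.
  refine ⟨fun s => (φ s • (E.waveSemigroup μ hμ s p).1,
      φ' s • E.incl (E.waveSemigroup μ hμ s p).1 + φ s • (E.waveSemigroup μ hμ s p).2),
    fun k s => μ * φ'' s * (modeFlow μ (E.α k) s (E.mode k p)).1 +
      2 * μ * φ' s * (modeFlow μ (E.α k) s (E.mode k p)).2 +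
      φ' s * (modeFlow μ (E.α k) s (E.mode k p)).1, ?_, ?_, ?_, ?_, ?_, ?_⟩
  · have hS := continuousOn_waveSemigroup hμ p
    exact (hc.smul hS.fst).prodMk ((hc'.smul (E.continuous_incl.comp hS.fst)).add (hc.smul hS.snd))
  · have : E.waveSemigroup μ hμ 0 p = p := E.ext_mode fun k => by
      rw [mode_waveSemigroup, modeFlow_zero]; rfl
    simp [this, h0, h0']
  · intro s hs
    obtain ⟨z1, z2, z3⟩ := hz s hs
    simp [z1, z2, z3]
  · intro k
    have hx : Continuous fun s => modeFlow μ (E.α k) s (E.mode k p) :=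
      (continuous_modeFlow μ (E.α k)).clm_apply continuous_const
    fun_prop
  · intro k t₀ t₁
    have hx : Continuous fun s => modeFlow μ (E.α k) s (E.mode k p) :=
      (continuous_modeFlow μ (E.α k)).clm_apply continuous_const
    have hmode : ∀ s, E.mode k (φ s • (E.waveSemigroup μ hμ s p).1,
        φ' s • E.incl (E.waveSemigroup μ hμ s p).1 + φ s • (E.waveSemigroup μ hμ s p).2) =
        (φ s * (modeFlow μ (E.α k) s (E.mode k p)).1,
          φ' s * (modeFlow μ (E.α k) s (E.mode k p)).1 +
            φ s * (modeFlow μ (E.α k) s (E.mode k p)).2) := by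
      intro s
      rw [← mode_waveSemigroup (hμ := hμ), mode_apply, mode_apply]
      ext
      · exact E.coeff_smul _ _ _
      · rfl
    simp only [hmode]
    refine isDuhamel_of_hasDerivAt (by fun_prop) fun t => ?_
    exact hasDerivAt_cutoff_mul hd hd' hμ (E.α k) (E.mode k p) t
  · intro s hs δ
    obtain ⟨m1, m2, m3⟩ := hM s hs
    have q1 : φ s ^ 2 ≤ M ^ 2 := sq_le_sq' (abs_le.1 m1).1 (abs_le.1 m1).2
    have q2 : φ' s ^ 2 ≤ M ^ 2 := sq_le_sq' (abs_le.1 m2).1 (abs_le.1 m2).2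
    have q3 : φ'' s ^ 2 ≤ M ^ 2 := sq_le_sq' (abs_le.1 m3).1 (abs_le.1 m3).2
    have key : ∀ k, ((modeFlow μ (E.α k) s (E.mode k p)).1 ^ 2 ≤ (E.α 0)⁻¹ * (K *
        (E.α 0 * E.α k * (E.mode k p).1 ^ 2 + 1 / 2 * (E.mode k p).2 ^ 2))) ∧
        (μ * (modeFlow μ (E.α k) s (E.mode k p)).2 ^ 2 ≤ K *
        (E.α 0 * E.α k * (E.mode k p).1 ^ 2 + 1 / 2 * (E.mode k p).2 ^ 2)) := by
      intro k
      have h := modeFlow_sq_le hμ hα (E.α_mono (Nat.zero_le k)) hs (E.mode k p)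
      rw [← hK] at h
      have n1 : 0 ≤ E.α 0 * (modeFlow μ (E.α k) s (E.mode k p)).1 ^ 2 := by positivity
      have n2 : 0 ≤ μ * (modeFlow μ (E.α k) s (E.mode k p)).2 ^ 2 := by positivity
      refine ⟨?_, by linarith⟩
      rw [le_inv_mul_iff₀ hα]
      linarith
    have hdn : ∀ k, 0 ≤ E.α 0 * E.α k * (E.mode k p).1 ^ 2 + 1 / 2 * (E.mode k p).2 ^ 2 :=
      fun k => by
        have := E.pos k
        positivity
    constructor
    · refine sob_le_dissipation (by positivity) fun k => ?_
      have e : E.coeff (φ s • (E.waveSemigroup μ hμ s p).1) k =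
          φ s * (modeFlow μ (E.α k) s (E.mode k p)).1 := by
        rw [coeff_smul, ← mode_waveSemigroup (hμ := hμ), mode_apply]
      simp only
      rw [e]
      have hk := (key k).1
      have hdk := hdn k
      set dk := E.α 0 * E.α k * (E.mode k p).1 ^ 2 + 1 / 2 * (E.mode k p).2 ^ 2
      set x := modeFlow μ (E.α k) s (E.mode k p)
      calc (φ s * x.1) ^ 2 = φ s ^ 2 * x.1 ^ 2 := mul_pow _ _ _
        _ ≤ M ^ 2 * ((E.α 0)⁻¹ * (K * dk)) :=
          mul_le_mul q1 hk (sq_nonneg _) (sq_nonneg _)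
        _ = C₁ * dk := by rw [hC₁]; ring
        _ ≤ (C₁ + C₂) * dk := mul_le_mul_of_nonneg_right (by linarith) hdk
    · refine sob_le_dissipation (by positivity) fun k => ?_
      have hk := (key k).1
      have hk2 := (key k).2
      have hdk := hdn k
      simp only
      set dk := E.α 0 * E.α k * (E.mode k p).1 ^ 2 + 1 / 2 * (E.mode k p).2 ^ 2
      set x := modeFlow μ (E.α k) s (E.mode k p)
      have b1 : φ'' s ^ 2 * x.1 ^ 2 ≤ M ^ 2 * ((E.α 0)⁻¹ * (K * dk)) :=
        mul_le_mul q3 hk (sq_nonneg _) (sq_nonneg _)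
      have b2 : φ' s ^ 2 * x.1 ^ 2 ≤ M ^ 2 * ((E.α 0)⁻¹ * (K * dk)) :=
        mul_le_mul q2 hk (sq_nonneg _) (sq_nonneg _)
      have b3 : φ' s ^ 2 * (μ * x.2 ^ 2) ≤ M ^ 2 * (K * dk) :=
        mul_le_mul q2 hk2 (by positivity) (sq_nonneg _)
      have b1' := mul_le_mul_of_nonneg_left b1 (sq_nonneg μ)
      have b3' := mul_le_mul_of_nonneg_left b3 (by positivity : 0 ≤ 4 * μ)
      have hthree : ∀ A B C : ℝ, (A + B + C) ^ 2 ≤ 3 * (A ^ 2 + B ^ 2 + C ^ 2) := fun A B C => by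
        nlinarith [sq_nonneg (A - B), sq_nonneg (B - C), sq_nonneg (A - C)]
      calc _ ≤ 3 * ((μ * φ'' s * x.1) ^ 2 + (2 * μ * φ' s * x.2) ^ 2 + (φ' s * x.1) ^ 2) :=
            hthree _ _ _
        _ = 3 * (μ ^ 2 * (φ'' s ^ 2 * x.1 ^ 2) + 4 * μ * (φ' s ^ 2 * (μ * x.2 ^ 2)) +
            φ' s ^ 2 * x.1 ^ 2) := by ring
        _ ≤ 3 * (μ ^ 2 * (M ^ 2 * ((E.α 0)⁻¹ * (K * dk))) + 4 * μ * (M ^ 2 * (K * dk)) +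
            M ^ 2 * ((E.α 0)⁻¹ * (K * dk))) := by linarith
        _ = C₂ * dk := by rw [hC₂]; ring
        _ ≤ (C₁ + C₂) * dk := mul_le_mul_of_nonneg_right (by linarith) hdk

end DirichletEigenbasis

/-! ### Restarting a path from zero, and reachability at a prescribed large time -/

namespace DirichletEigenbasis

variable {d : ℕ} {D : Set (EuclideanSpace ℝ (Fin d))} {E : DirichletEigenbasis D}

variable {Q : L2 D →L[ℝ] L2 D} {lam : ℕ → ℝ} {β c μ : ℝ} {B : L2 D → L2 D}

lemma summable_of_sob_zero {x : ℕ → ℝ} (h : E.sob 0 x ≠ ⊤) : Summable fun k => x k ^ 2 := by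
  have := (E.memSobolev_iff 0 x).2 h
  simpa [MemSobolev] using this

open Classical in
/-- The element of `L²(D)` with the given Fourier coefficients if they are square summable, and `0`
otherwise. -/
def ofCoeffOrZero (E : DirichletEigenbasis D) (x : ℕ → ℝ) : L2 D :=
  if h : Summable fun k => x k ^ 2 then E.ofCoeff x h else 0

lemma coeff_ofCoeffOrZero {x : ℕ → ℝ} (h : Summable fun k => x k ^ 2) :
    E.coeff (E.ofCoeffOrZero x) = x := by
  rw [ofCoeffOrZero, dif_pos h]
  exact funext fun k => E.coeff_ofCoeff x h k

/-- Inverting `Q` costs `2β` derivatives. -/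
lemma DiagonalComparable.sob_inv_le (hQ : E.DiagonalComparable Q lam β c) (x : ℕ → ℝ) :
    E.sob 0 (fun k => (lam k)⁻¹ * x k) ≤ ENNReal.ofReal (c ^ 2) * E.sob (2 * β) x :=
  E.sob_le_of_le (sq_nonneg c) fun k => by
    rw [Real.rpow_zero, one_mul, mul_pow, ← mul_assoc]
    exact mul_le_mul_of_nonneg_right (hQ.inv_sq_le k) (sq_nonneg _)

lemma ne_top_of_ofReal_mul_ne_top {a : ℝ} (ha : 0 < a) {x : ℝ≥0∞}
    (h : ENNReal.ofReal a * x ≠ ⊤) : x ≠ ⊤ := by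
  rintro rfl
  rw [ENNReal.mul_top (by simpa using ha)] at h
  exact h rfl

/-- The correcting control acts only during a unit of time, so a pointwise bound becomes an `L²`
bound independent of the length of the interval. -/
lemma eLpNorm_le_of_enorm_sq_le {F : Type*} [NormedAddCommGroup F] {η : ℝ → F} {t₀ t₁ b : ℝ}
    (hη : ∀ t ∈ Ioo t₀ t₁, ‖η t‖ₑ ^ 2 ≤
      (Ioo t₀ (t₀ + 1)).indicator (fun _ => ENNReal.ofReal b) t) :
    eLpNorm η 2 (volume.restrict (Ioo t₀ t₁)) ≤ ENNReal.ofReal (√b) := by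
  have h1 : eLpNorm η 2 (volume.restrict (Ioo t₀ t₁)) ^ 2 ≤ ENNReal.ofReal b := by
    rw [eLpNorm_two_sq]
    calc ∫⁻ t in Ioo t₀ t₁, ‖η t‖ₑ ^ 2
        ≤ ∫⁻ t in Ioo t₀ t₁, (Ioo t₀ (t₀ + 1)).indicator (fun _ => ENNReal.ofReal b) t :=
          setLIntegral_mono' measurableSet_Ioo hη
      _ ≤ ∫⁻ t, (Ioo t₀ (t₀ + 1)).indicator (fun _ => ENNReal.ofReal b) t :=
          setLIntegral_le_lintegral _ _
      _ = ENNReal.ofReal b := by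
          rw [lintegral_indicator_const measurableSet_Ioo, Real.volume_Ioo]
          simp
  have h2 : ENNReal.ofReal b = ENNReal.ofReal (√b) ^ 2 := by
    rw [← ENNReal.ofReal_pow (Real.sqrt_nonneg _)]
    rcases le_total 0 b with hb | hb
    · rw [Real.sq_sqrt hb]
    · rw [Real.sqrt_eq_zero_of_nonpos hb, ENNReal.ofReal_of_nonpos hb]
      simp
  rw [h2] at h1
  exact (ENNReal.pow_le_pow_left_iff two_ne_zero).1 h1

/-- A path can be replaced, from a time `t'` at which its energy is small, by a path starting from
`0` at time `t'`, at a small cost. -/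
theorem exists_restart (hQ : E.DiagonalComparable Q lam β c) (hβ : 0 ≤ β)
    (hB : ∀ δ ∈ Icc (0 : ℝ) (1 + 2 * β), E.LipschitzSobolev B δ) (hB0 : B 0 = 0)
    (hμ : 0 < μ) (hμc : 4 * μ * E.α 0 ≤ 1) :
    ∃ C : ℝ, 0 < C ∧ ∀ (T t' N ρ b : ℝ) (ψ : ℝ → L2 D) (z : ℝ → E.Phase), 0 ≤ t' → t' + 1 ≤ T →
      T - t' ≤ N → 0 ≤ ρ → 0 ≤ b → MemLp ψ 2 (volume.restrict (Ioo 0 T)) →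
      E.IsMildSolution Q B μ hμ 0 T ψ z → z 0 = 0 →
      eLpNorm ψ 2 (volume.restrict (Ioo 0 T)) ≤ ENNReal.ofReal ρ →
      E.dissipation (2 * β) (z t') ≤ ENNReal.ofReal b →
      z T ∈ E.reach Q B μ hμ N (ρ + C * √b) := by
  obtain ⟨C₀, hC₀, hsteer⟩ := exists_steering E hμ
  obtain ⟨CF, -, hCF⟩ := exists_lintegral_sob_forcing_le hQ hβ hB hB0 hμ hμc
  have h2β : 2 * β ∈ Icc (0 : ℝ) (1 + 2 * β) := ⟨by linarith, by linarith⟩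
  obtain ⟨q, hq0, hqα, hq⟩ := (hB (2 * β) h2β).exists_sob_le
  have hBc : Continuous B := (hB 0 ⟨le_rfl, by linarith⟩).continuous
  have hc := hQ.2.1
  -- Here `c²` comes from inverting `Q`, the factors `2` from Young's inequality with `ε = 1`, `q²
  -- C₀` from the increment `B(z) - B(y)`, and `C₀` from the steering forcing.
  set C₁ := c ^ 2 * (2 * (q ^ 2 * C₀) + 2 * C₀) with hC₁
  have hC₁0 : 0 < C₁ := by positivity
  refine ⟨√C₁, Real.sqrt_pos.2 hC₁0, fun T t' N ρ b ψ z ht' htT hN hρ hb hψ hz hz0 hψρ hbd => ?_⟩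
  obtain ⟨w, g, hw, hw0, hw1, hg, hwg, hbound⟩ := hsteer (z t')
  have hT : 0 ≤ T := by linarith
  have htT' : t' ≤ T := by linarith
  have hz' := (E.isMildSolution_iff hBc hμ hT hψ).1 hz
  have hf := memLp_forcing (Q := Q) hBc hz'.1 hψ
  have hsub : Icc t' T ⊆ Icc 0 T := Icc_subset_Icc_left ht'
  have hψ' : MemLp ψ 2 (volume.restrict (Ioo t' T)) :=
    hψ.mono_measure (Measure.restrict_mono (Ioo_subset_Ioo_left ht') le_rfl)
  have hf' := memLp_forcing (Q := Q) hBc (hz'.1.mono hsub) hψ'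
  -- The Lipschitz bound in `H^{2β}` applies only to arguments known to lie there, so regularity is
  -- needed at every time, not just in the mean. The pointwise energy gives even `H^{1+2β}`.
  have hzreg : ∀ t ∈ Icc 0 T, E.MemSobolev (2 * β) (E.coeff (z t).1) := by
    intro t ht
    have h1 := mode_energy_le hμ hμc hf hz'.2 hz0 ht (2 * β)
    have h2 : ENNReal.ofReal (1 / 2) * E.sob (2 * β + 1) (E.coeff (z t).1) ≠ ⊤ :=
      ((h1.trans (hCF T ψ z hT hψ hz hz0)).trans_lt (ENNReal.mul_lt_top ENNReal.ofReal_lt_top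
        (lintegral_enorm_sq_lt_top hψ))).ne
    rw [memSobolev_iff]
    exact ((E.sob_mono (by linarith) _).trans_lt (ENNReal.mul_lt_top ENNReal.ofReal_lt_top
      (ne_top_of_ofReal_mul_ne_top (by norm_num) h2).lt_top)).ne
  have hbound' : ∀ s, 0 ≤ s → E.sob (2 * β) (E.coeff (w s).1) ≤ ENNReal.ofReal (C₀ * b) ∧
      E.sob (2 * β) (fun k => g k s) ≤ ENNReal.ofReal (C₀ * b) := by
    intro s hs
    rcases le_total s 1 with h1 | h1
    · obtain ⟨e1, e2⟩ := hbound s ⟨hs, h1⟩ (2 * β)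
      rw [ENNReal.ofReal_mul hC₀.le]
      exact ⟨e1.trans (mul_le_mul_right hbd _), e2.trans (mul_le_mul_right hbd _)⟩
    · obtain ⟨e1, e2⟩ := hw1 s h1
      simp [e1, e2, sob]
  -- Since `w 0 = z t'` and `w` vanishes after unit time, `y` starts from `0` at `t'` and ends where
  -- `z` does. For it to solve the skeleton equation with control `ψ + η`, one needs `Q η = B(z) -
  -- B(y) - g`; `r` is that right side and `x` its preimage under `Q`.
  set y : ℝ → E.Phase := fun t => z t - w (t - t') with hy
  set r : ℝ → ℕ → ℝ := fun t k =>
    E.coeff (B (z t).1 - B (y t).1) k + -g k (t - t') with hr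
  set x : ℝ → ℕ → ℝ := fun t k => (lam k)⁻¹ * r t k with hx
  have hyc : ContinuousOn y (Icc t' T) :=
    (hz'.1.mono hsub).sub (hw.comp (by fun_prop)).continuousOn
  have hxsob : ∀ t ∈ Icc t' T, E.sob 0 (x t) ≤ ENNReal.ofReal (C₁ * b) := by
    intro t ht
    obtain ⟨e1, e2⟩ := hbound' (t - t') (by linarith [ht.1])
    have hwm : E.MemSobolev (2 * β) (E.coeff (w (t - t')).1) := by
      rw [memSobolev_iff]
      exact (e1.trans_lt ENNReal.ofReal_lt_top).ne
    have hzm := hzreg t (hsub ht)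
    have hym : E.MemSobolev (2 * β) (E.coeff (y t).1) := E.memSobolev_sub hzm hwm
    have hdiff : E.sob (2 * β) (E.coeff (B (z t).1 - B (y t).1)) ≤
        ENNReal.ofReal (q ^ 2) * ENNReal.ofReal (C₀ * b) := by
      refine (hq _ _ hzm hym).trans (mul_le_mul_right ?_ _)
      have e : (z t).1 - (y t).1 = (w (t - t')).1 := by simp [hy]
      rw [e]
      exact e1
    have hgneg : E.sob (2 * β) (fun k => -g k (t - t')) ≤ ENNReal.ofReal (C₀ * b) := by
      simpa [sob] using e2
    refine (hQ.sob_inv_le (r t)).trans ?_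
    have hsum := E.sob_add_le (2 * β) (E.coeff (B (z t).1 - B (y t).1))
      (fun k => -g k (t - t')) one_pos
    calc ENNReal.ofReal (c ^ 2) * E.sob (2 * β) (r t)
        ≤ ENNReal.ofReal (c ^ 2) * (ENNReal.ofReal (1 + 1) * (ENNReal.ofReal (q ^ 2) *
          ENNReal.ofReal (C₀ * b)) + ENNReal.ofReal (1 + 1⁻¹) * ENNReal.ofReal (C₀ * b)) :=
          mul_le_mul_right (hsum.trans (add_le_add (mul_le_mul_right hdiff _)
            (mul_le_mul_right hgneg _))) _
      _ = ENNReal.ofReal (C₁ * b) := by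
          rw [← ENNReal.ofReal_mul (by positivity), ← ENNReal.ofReal_mul (by positivity),
            ← ENNReal.ofReal_mul (by positivity), ← ENNReal.ofReal_add (by positivity)
            (by positivity), ← ENNReal.ofReal_mul (by positivity), hC₁]
          congr 1
          ring
  have hx0 : ∀ t, t' + 1 ≤ t → x t = 0 := by
    intro t ht
    obtain ⟨e1, e2⟩ := hw1 (t - t') (by linarith)
    ext k
    simp [hx, hr, hy, e1, e2]
  set η : ℝ → L2 D := fun t => E.ofCoeffOrZero (x t) with hη
  have hηc : ∀ t ∈ Icc t' T, E.coeff (η t) = x t := fun t ht =>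
    coeff_ofCoeffOrZero (summable_of_sob_zero ((hxsob t ht).trans_lt ENNReal.ofReal_lt_top).ne)
  have hηm : AEStronglyMeasurable η (volume.restrict (Ioo t' T)) := by
    refine E.aestronglyMeasurable_L2 fun k => ?_
    -- Measurability of `η` is reduced to continuity of each coefficient, where dividing by `lam k`
    -- is harmless.
    have hcont : ContinuousOn (fun t => E.coeff (η t) k) (Icc t' T) := by
      have : ContinuousOn (fun t => x t k) (Icc t' T) := by
        have h1 : ContinuousOn (fun t => E.coeffL k (B (z t).1 - B (y t).1)) (Icc t' T) :=
          (E.coeffL k).continuous.comp_continuousOn ((hBc.comp_continuousOn (hz'.1.mono hsub).fst).sub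
            (hBc.comp_continuousOn hyc.fst))
        have h2 : Continuous fun t => g k (t - t') := (hg k).comp (by fun_prop)
        exact (h1.add h2.neg.continuousOn).const_smul (lam k)⁻¹
      exact this.congr fun t ht => by simp only [hηc t ht]
    exact (hcont.mono Ioo_subset_Icc_self).aestronglyMeasurable measurableSet_Ioo
  have hηn : eLpNorm η 2 (volume.restrict (Ioo t' T)) ≤ ENNReal.ofReal (√(C₁ * b)) := by
    refine eLpNorm_le_of_enorm_sq_le fun t ht => ?_
    rw [← E.sob_zero_coeff, hηc t (Ioo_subset_Icc_self ht)]
    rcases lt_or_ge t (t' + 1) with h1 | h1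
    · rw [indicator_of_mem (show t ∈ Ioo t' (t' + 1) from ⟨ht.1, h1⟩)]
      exact hxsob t (Ioo_subset_Icc_self ht)
    · rw [hx0 t h1]
      simp [sob]
  have hηL : MemLp η 2 (volume.restrict (Ioo t' T)) := ⟨hηm, hηn.trans_lt ENNReal.ofReal_lt_top⟩
  have hyT : y T = z T := by simp [hy, (hw1 (T - t') (by linarith)).1]
  have hψη : MemLp (fun t => ψ t + η t) 2 (volume.restrict (Ioo t' T)) := hψ'.add hηL
  rw [← hyT]
  refine mem_reach_of_le hBc hB0 hμ htT' hN hψη ?_ ?_ ?_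
  · have h1 : eLpNorm ψ 2 (volume.restrict (Ioo t' T)) ≤ ENNReal.ofReal ρ :=
      (eLpNorm_mono_measure _
        (Measure.restrict_mono (Ioo_subset_Ioo_left ht') le_rfl)).trans hψρ
    rw [← Real.sqrt_mul hC₁0.le, ENNReal.ofReal_add hρ (Real.sqrt_nonneg _)]
    exact (eLpNorm_add_le hψ'.1 hηm one_le_two).trans (add_le_add h1 hηn)
  · rw [E.isMildSolution_iff hBc hμ htT' hψη]
    refine ⟨hyc, fun k => ?_⟩
    have hfk := intervalIntegrable_of_memLp hT (E.memLp_coeff hf k)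
    have h1 := (hz'.2 k).restart hfk ⟨ht', htT'⟩
    have h2 := (hwg k 0 (T - t')).comp_add (-t')
    simp only [sub_neg_eq_add, zero_add, sub_add_cancel, ← sub_eq_add_neg] at h2
    refine (h1.sub h2 (intervalIntegrable_of_memLp htT' (E.memLp_coeff hf' k))
      (((hg k).comp (by fun_prop : Continuous fun t => t - t')).intervalIntegrable _ _)).congr
      (fun t ht => ?_) fun t ht => (map_sub _ _ _).symm
    have e : E.coeff (Q (η t)) k = x t k * lam k := by
      rw [hQ.coeff, hηc t (Ioo_subset_Icc_self ht), mul_comm]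
    have hl := (hQ.lam_pos k).ne'
    simp only [coeff_add, map_add, e, hx, hr, coeff_sub]
    field_simp
    ring
  · simp [hy, hw0]

/-- A point that can be reached at some time can be reached at a large time `N`, up to a small
additional cost. -/
theorem exists_reach_subset (hQ : E.DiagonalComparable Q lam β c) (hβ : 0 ≤ β)
    (hB : ∀ δ ∈ Icc (0 : ℝ) (1 + 2 * β), E.LipschitzSobolev B δ) (hB0 : B 0 = 0)
    (hμ : 0 < μ) (hμc : 4 * μ * E.α 0 ≤ 1) :
    ∃ C : ℝ, 0 < C ∧ ∀ T N ρ : ℝ, 0 ≤ T → 2 ≤ N → 0 ≤ ρ →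
      E.reach Q B μ hμ T ρ ⊆ E.reach Q B μ hμ N (ρ + C * ρ / √N) := by
  obtain ⟨C, hC, hrestart⟩ := exists_restart hQ hβ hB hB0 hμ hμc
  obtain ⟨CF, hCF0, hCF⟩ := exists_lintegral_sob_forcing_le hQ hβ hB hB0 hμ hμc
  have hBc : Continuous B := (hB 0 ⟨le_rfl, by linarith⟩).continuous
  refine ⟨C * √(2 * CF), by positivity, fun T N ρ hT hN hρ p hp => ?_⟩
  obtain ⟨ψ, hψ, hψρ, z, hz, hz0, rfl⟩ := hp
  have hN0 : 0 < N := by linarith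
  rcases le_total T N with hTN | hTN
  · refine mem_reach_of_le hBc hB0 hμ hT (by linarith) hψ (hψρ.trans ?_) hz hz0
    refine ENNReal.ofReal_le_ofReal (le_add_of_nonneg_right ?_)
    positivity
  · have hz' := (E.isMildSolution_iff hBc hμ hT hψ).1 hz
    have hf := memLp_forcing (Q := Q) hBc hz'.1 hψ
    -- A time `t'` in this window satisfies `0 ≤ t'`, `T - t' ≤ N` and, because `N ≥ 2`, leaves at
    -- least the unit of time needed for steering. Its length `N/2` makes the average dissipation
    -- `O(ρ²/N)`.
    set J := Ioo (T - N) (T - N / 2) with hJ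
    have hJs : J ⊆ Ioo 0 T := Ioo_subset_Ioo (by linarith) (by linarith)
    have hJv : volume J = ENNReal.ofReal (N / 2) := by
      rw [hJ, Real.volume_Ioo]
      congr 1
      ring
    have hJ0 : volume J ≠ 0 := by
      rw [hJv, Ne, ENNReal.ofReal_eq_zero, not_le]
      linarith
    obtain ⟨t', ht', hle⟩ := exists_le_setLAverage hJ0 (by rw [hJv]; exact ENNReal.ofReal_ne_top)
      ((aemeasurable_dissipation hz'.1 (2 * β)).mono_measure (Measure.restrict_mono hJs le_rfl))
    have hint : ∫⁻ t in J, E.dissipation (2 * β) (z t) ≤ ENNReal.ofReal (CF * ρ ^ 2) := by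
      calc ∫⁻ t in J, E.dissipation (2 * β) (z t)
          ≤ ∫⁻ t in Ioo 0 T, E.dissipation (2 * β) (z t) :=
            lintegral_mono' (Measure.restrict_mono hJs le_rfl) le_rfl
        _ ≤ ∫⁻ t in Ioo 0 T, E.sob (2 * β) (E.coeff (B (z t).1 + Q (ψ t))) :=
            lintegral_dissipation_le hμ hμc hT hz'.1 hf hz'.2 hz0 _
        _ ≤ ENNReal.ofReal CF * ∫⁻ t in Ioo 0 T, ‖ψ t‖ₑ ^ 2 := hCF T ψ z hT hψ hz hz0
        _ ≤ ENNReal.ofReal CF * ENNReal.ofReal ρ ^ 2 := by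
            rw [← eLpNorm_two_sq]
            gcongr
        _ = ENNReal.ofReal (CF * ρ ^ 2) := by
            rw [ENNReal.ofReal_mul hCF0.le, ENNReal.ofReal_pow hρ]
    have hd : E.dissipation (2 * β) (z t') ≤ ENNReal.ofReal (2 * CF * ρ ^ 2 / N) := by
      refine hle.trans ?_
      rw [setLAverage_eq, hJv]
      refine (ENNReal.div_le_div_right hint _).trans (le_of_eq ?_)
      rw [← ENNReal.ofReal_div_of_pos (by linarith)]
      congr 1
      field_simp
    have := hrestart T t' N ρ _ ψ z (by linarith [ht'.1]) (by linarith [ht'.2])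
      (by linarith [ht'.1]) hρ (by positivity) hψ hz hz0 hψρ hd
    have e : C * √(2 * CF * ρ ^ 2 / N) = C * √(2 * CF) * ρ / √N := by
      rw [Real.sqrt_div (by positivity), Real.sqrt_mul (by positivity), Real.sqrt_sq hρ]
      ring
    rwa [e] at this

end DirichletEigenbasis
/-- Bounded sequences in a separable Hilbert space have weakly convergent subsequences. -/
lemma exists_subseq_tendsto_inner {X : Type*} [NormedAddCommGroup X] [InnerProductSpace ℝ X]
    [CompleteSpace X] [TopologicalSpace.SeparableSpace X] {u : ℕ → X} {r : ℝ}
    (hu : ∀ n, ‖u n‖ ≤ r) :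
    ∃ x : X, ‖x‖ ≤ r ∧ ∃ σ : ℕ → ℕ, StrictMono σ ∧
      ∀ y : X, Tendsto (fun n => inner ℝ (u (σ n)) y) atTop (𝓝 (inner ℝ x y)) := by
  obtain ⟨φ, hφ, σ, hσ, hlim⟩ := WeakDual.isSeqCompact_closedBall ℝ X 0 r
    (x := fun n => StrongDual.toWeakDual (InnerProductSpace.toDual ℝ X (u n))) (fun n => by
      rw [mem_preimage, mem_closedBall_zero_iff]
      exact ((InnerProductSpace.toDual ℝ X).norm_map (u n)).trans_le (hu n))
  refine ⟨(InnerProductSpace.toDual ℝ X).symm (WeakDual.toStrongDual φ), ?_, σ, hσ, fun y => ?_⟩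
  · rw [LinearIsometryEquiv.norm_map]
    rwa [mem_preimage, mem_closedBall_zero_iff] at hφ
  · rw [InnerProductSpace.toDual_symm_apply]
    exact ((WeakDual.eval_continuous y).tendsto φ).comp hlim

/-! ### Mild solutions starting from zero, written with the convolution -/

namespace DirichletEigenbasis

variable {d : ℕ} {D : Set (EuclideanSpace ℝ (Fin d))} {E : DirichletEigenbasis D}

variable {Q : L2 D →L[ℝ] L2 D} {lam : ℕ → ℝ} {β c μ T : ℝ} {B : L2 D → L2 D}

lemma waveSemigroup_zero_right (hμ : 0 < μ) (t : ℝ) : E.waveSemigroup μ hμ t 0 = 0 :=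
  E.ext_mode fun k => by rw [mode_waveSemigroup, map_zero, map_zero]

lemma isMildSolution_iff_convolution (hμ : 0 < μ) {ψ : ℝ → L2 D} {z : ℝ → E.Phase}
    (h0 : z 0 = 0) : E.IsMildSolution Q B μ hμ 0 T ψ z ↔ ContinuousOn z (Icc 0 T) ∧
      ∀ t ∈ Icc 0 T, z t = E.convolution μ hμ (fun s => B (z s).1) t +
        E.convolution μ hμ (fun s => Q (ψ s)) t := by
  simp only [IsMildSolution, h0, waveSemigroup_zero_right, zero_add, convolution]

/-- Weak limits and fixed points live in `L²(0,T;H)` and are only classes of functions; the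
convolution does not see the representative. -/
lemma convolution_congr (hμ : 0 < μ) {f g : ℝ → L2 D}
    (h : f =ᵐ[volume.restrict (Ioo 0 T)] g) {t : ℝ} (ht : t ∈ Icc 0 T) :
    E.convolution μ hμ f t = E.convolution μ hμ g t := by
  refine intervalIntegral.integral_congr_ae ?_
  rw [EventuallyEq, ae_restrict_iff' measurableSet_Ioo] at h
  filter_upwards [h, Measure.ae_ne volume T] with s hs hsT hs2
  rw [uIoc_of_le ht.1] at hs2
  rw [hs ⟨hs2.1, lt_of_le_of_ne (hs2.2.trans ht.2) hsT⟩]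

lemma isDuhamel_convolution (hμ : 0 < μ) {f : ℝ → L2 D}
    (hf : MemLp f 2 (volume.restrict (Ioo 0 T))) (k : ℕ) :
    IsDuhamel μ (E.α k) 0 T (fun t => E.coeff (f t) k)
      (fun t => E.mode k (E.convolution μ hμ f t)) := by
  intro t ht
  simp only
  rw [E.mode_convolution hμ hf ht, convolution_zero, map_zero, map_zero, zero_add, modeSol]

/-- The convolution with the semigroup has norm at most `1 / α_1` in `L²(0, T; H)`. -/
lemma eLpNorm_convolution_fst_le (hμ : 0 < μ) (hμc : 4 * μ * E.α 0 ≤ 1) (hT : 0 ≤ T)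
    {f : ℝ → L2 D} (hf : MemLp f 2 (volume.restrict (Ioo 0 T))) :
    eLpNorm (fun t => (E.convolution μ hμ f t).1) 2 (volume.restrict (Ioo 0 T)) ≤
      ENNReal.ofReal (E.α 0)⁻¹ * eLpNorm f 2 (volume.restrict (Ioo 0 T)) := by
  have h := lintegral_sob_le hμ hμc hT (E.continuousOn_convolution hμ hμc hT hf) hf
    (isDuhamel_convolution hμ hf) (E.convolution_zero μ hμ f) 0
  simp only [sob_zero_coeff] at h
  rw [← eLpNorm_two_sq, ← eLpNorm_two_sq, ENNReal.ofReal_pow E.α_pos.le, ← mul_pow,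
    ENNReal.pow_le_pow_left_iff two_ne_zero] at h
  have h2 := mul_le_mul_right h (ENNReal.ofReal (E.α 0)⁻¹)
  rwa [← mul_assoc, ← ENNReal.ofReal_mul (inv_nonneg.2 E.α_pos.le), inv_mul_cancel₀ E.α_pos.ne',
    ENNReal.ofReal_one, one_mul] at h2

/-- The convolution is bounded from `L²(0, T; H)` to the phase space, uniformly in time. -/
lemma norm_convolution_le (hμ : 0 < μ) (hμc : 4 * μ * E.α 0 ≤ 1)
    {f : ℝ → L2 D} (hf : MemLp f 2 (volume.restrict (Ioo 0 T))) {t : ℝ} (ht : t ∈ Icc 0 T) :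
    ‖E.convolution μ hμ f t‖ ≤ √((2 + 2 * μ⁻¹) * (E.α 0)⁻¹) *
      (eLpNorm f 2 (volume.restrict (Ioo 0 T))).toReal := by
  have hT := ht.1.trans ht.2
  have hI0 : ∀ k, 0 ≤ ∫ s in (0 : ℝ)..T, E.coeff (f s) k ^ 2 := fun k =>
    intervalIntegral.integral_nonneg hT fun _ _ => sq_nonneg _
  have hI := E.summable_integral_coeff_sq hT hf
  have hsum : ∑' k, ∫ s in (0 : ℝ)..T, E.coeff (f s) k ^ 2 =
      (eLpNorm f 2 (volume.restrict (Ioo 0 T))).toReal ^ 2 := by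
    rw [← ENNReal.toReal_pow, eLpNorm_two_sq, E.lintegral_enorm_sq_eq hf.1]
    have e : ∀ k, ∫⁻ t in Ioo 0 T, ENNReal.ofReal (E.coeff (f t) k ^ 2) =
        ENNReal.ofReal (∫ s in (0 : ℝ)..T, E.coeff (f s) k ^ 2) := fun k =>
      setLIntegral_ofReal_eq_integral hT (fun t => sq_nonneg _)
        (intervalIntegrable_of_integrable_Ioo hT (E.memLp_coeff hf k).integrable_sq)
    simp only [e]
    rw [← ENNReal.ofReal_tsum_of_nonneg hI0 hI, ENNReal.toReal_ofReal (tsum_nonneg hI0)]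
  have hb : ∀ k, (2 + 2 * μ⁻¹) * ((E.α k)⁻¹ * ∫ s in (0 : ℝ)..T, E.coeff (f s) k ^ 2) ≤
      (2 + 2 * μ⁻¹) * (E.α 0)⁻¹ * ∫ s in (0 : ℝ)..T, E.coeff (f s) k ^ 2 := fun k => by
    rw [mul_assoc]
    refine mul_le_mul_of_nonneg_left (mul_le_mul_of_nonneg_right ?_ (hI0 k)) (by positivity)
    exact inv_anti₀ E.α_pos (E.α_mono (Nat.zero_le k))
  have hmain : ∀ v : ℝ, 0 ≤ v → v ^ 2 ≤ (2 + 2 * μ⁻¹) * (E.α 0)⁻¹ *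
      (eLpNorm f 2 (volume.restrict (Ioo 0 T))).toReal ^ 2 →
      v ≤ √((2 + 2 * μ⁻¹) * (E.α 0)⁻¹) *
        (eLpNorm f 2 (volume.restrict (Ioo 0 T))).toReal := fun v hv h => by
    have hα := E.α_pos
    have := Real.sqrt_le_sqrt h
    rwa [Real.sqrt_sq hv, Real.sqrt_mul (by positivity),
      Real.sqrt_sq ENNReal.toReal_nonneg] at this
  rw [Prod.norm_def]
  refine max_le (hmain _ (norm_nonneg _) ?_) (hmain _ (norm_nonneg _) ?_)
  · rw [E.norm_sq_eq_tsum_coeff, ← hsum, ← tsum_mul_left]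
    refine (E.summable_coeff_sq _).tsum_le_tsum (fun k => ?_) (hI.mul_left _)
    have := (E.mode_convolution_sq_le hμ hμc hf ht k).1
    rw [mode_apply] at this
    exact this.trans (hb k)
  · rw [norm_sq_hs, ← hsum, ← tsum_mul_left]
    refine (E.summable_hs_sq _).tsum_le_tsum (fun k => ?_) (hI.mul_left _)
    have := (E.mode_convolution_sq_le hμ hμc hf ht k).2
    rw [mode_apply] at this
    exact this.trans (hb k)

/-! ### Solving the skeleton equation -/

section

variable {q : ℝ}

lemma lipschitzWith_of_norm_le (hq0 : 0 ≤ q) (hB : ∀ x y, ‖B x - B y‖ ≤ q * ‖x - y‖) :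
    LipschitzWith ⟨q, hq0⟩ B := LipschitzWith.of_dist_le_mul fun x y => by
  rw [dist_eq_norm, dist_eq_norm]
  exact hB x y

lemma eLpNorm_comp_sub_le (hB : ∀ x y, ‖B x - B y‖ ≤ q * ‖x - y‖)
    {X : Type*} [MeasurableSpace X] (ν : Measure X) (u v : X → L2 D) :
    eLpNorm (fun t => B (u t) - B (v t)) 2 ν ≤
      ENNReal.ofReal q * eLpNorm (fun t => u t - v t) 2 ν :=
  eLpNorm_le_mul_eLpNorm_of_ae_le_mul (Eventually.of_forall fun t => hB (u t) (v t)) 2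

/-- The factor `q / α_1 < 1` is independent of `T`, so the fixed point argument works on the whole
interval in one step. -/
lemma eLpNorm_convolution_sub_le (hμ : 0 < μ) (hμc : 4 * μ * E.α 0 ≤ 1) (hT : 0 ≤ T)
    (hq0 : 0 ≤ q) (hB : ∀ x y, ‖B x - B y‖ ≤ q * ‖x - y‖) (hB0 : B 0 = 0) {u v : ℝ → L2 D}
    (hu : MemLp u 2 (volume.restrict (Ioo 0 T))) (hv : MemLp v 2 (volume.restrict (Ioo 0 T))) :
    eLpNorm (fun t => (E.convolution μ hμ (fun s => B (u s)) t).1 -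
        (E.convolution μ hμ (fun s => B (v s)) t).1) 2 (volume.restrict (Ioo 0 T)) ≤
      ENNReal.ofReal (q / E.α 0) * eLpNorm (fun t => u t - v t) 2 (volume.restrict (Ioo 0 T)) := by
  have hL := lipschitzWith_of_norm_le hq0 hB
  have hBu : MemLp (fun s => B (u s)) 2 (volume.restrict (Ioo 0 T)) := hL.comp_memLp hB0 hu
  have hBv : MemLp (fun s => B (v s)) 2 (volume.restrict (Ioo 0 T)) := hL.comp_memLp hB0 hv
  have h := eLpNorm_convolution_fst_le (E := E) hμ hμc hT
    (f := fun s => B (u s) - B (v s)) (hBu.sub hBv)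
  have e : eLpNorm (fun t => (E.convolution μ hμ (fun s => B (u s)) t).1 -
        (E.convolution μ hμ (fun s => B (v s)) t).1) 2 (volume.restrict (Ioo 0 T)) =
      eLpNorm (fun t => (E.convolution μ hμ (fun s => B (u s) - B (v s)) t).1) 2
        (volume.restrict (Ioo 0 T)) := by
    refine eLpNorm_congr_ae ?_
    rw [EventuallyEq, ae_restrict_iff' measurableSet_Ioo]
    refine Eventually.of_forall fun t ht => ?_
    rw [E.convolution_sub hμ hBu hBv (Ioo_subset_Icc_self ht)]
    rfl
  rw [e]
  refine h.trans ((mul_le_mul_right (eLpNorm_comp_sub_le hB _ u v) _).trans (le_of_eq ?_))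
  rw [← mul_assoc, ← ENNReal.ofReal_mul (inv_nonneg.2 E.α_pos.le), div_eq_inv_mul]

/-- Existence of solutions of the skeleton equation. -/
lemma exists_isMildSolution (hμ : 0 < μ) (hμc : 4 * μ * E.α 0 ≤ 1) (hT : 0 ≤ T)
    (hq0 : 0 ≤ q) (hq : q < E.α 0) (hB : ∀ x y, ‖B x - B y‖ ≤ q * ‖x - y‖) (hB0 : B 0 = 0)
    {ψ : ℝ → L2 D} (hψ : MemLp ψ 2 (volume.restrict (Ioo 0 T))) :
    ∃ z : ℝ → E.Phase, z 0 = 0 ∧ E.IsMildSolution Q B μ hμ 0 T ψ z := by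
  have hL := lipschitzWith_of_norm_le hq0 hB
  have hQψ : MemLp (fun s => Q (ψ s)) 2 (volume.restrict (Ioo 0 T)) := Q.comp_memLp' hψ
  have hBu : ∀ u : Lp (L2 D) 2 (volume.restrict (Ioo (0 : ℝ) T)),
      MemLp (fun s => B (u s)) 2 (volume.restrict (Ioo 0 T)) :=
    fun u => hL.comp_memLp hB0 (Lp.memLp u)
  have hΓm : ∀ u : Lp (L2 D) 2 (volume.restrict (Ioo (0 : ℝ) T)),
      MemLp (fun t => (E.convolution μ hμ (fun s => B (u s)) t).1 +
        (E.convolution μ hμ (fun s => Q (ψ s)) t).1) 2 (volume.restrict (Ioo 0 T)) := fun u =>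
    (E.memLp_convolution_fst hμ hμc hT (hBu u)).add (E.memLp_convolution_fst hμ hμc hT hQψ)
  have hcontr : ContractingWith (Real.toNNReal (q / E.α 0)) fun u => (hΓm u).toLp := by
    refine ⟨?_, fun u v => ?_⟩
    · exact Real.toNNReal_lt_one.2 ((div_lt_one E.α_pos).2 hq)
    · rw [Lp.edist_toLp_toLp, Lp.edist_def]
      have e : ((fun t => (E.convolution μ hμ (fun s => B (u s)) t).1 +
            (E.convolution μ hμ (fun s => Q (ψ s)) t).1) -
          fun t => (E.convolution μ hμ (fun s => B (v s)) t).1 +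
            (E.convolution μ hμ (fun s => Q (ψ s)) t).1) =
          fun t => (E.convolution μ hμ (fun s => B (u s)) t).1 -
            (E.convolution μ hμ (fun s => B (v s)) t).1 := by
        ext1 t
        simp
      rw [e]
      have h := eLpNorm_convolution_sub_le (E := E) hμ hμc hT hq0 hB hB0 (Lp.memLp u) (Lp.memLp v)
      exact h
  set u := hcontr.fixedPoint with hu
  have hfix : (hΓm u).toLp = u := hcontr.fixedPoint_isFixedPt
  have hae : (fun t => (E.convolution μ hμ (fun s => B (u s)) t).1 +
      (E.convolution μ hμ (fun s => Q (ψ s)) t).1) =ᵐ[volume.restrict (Ioo 0 T)] u := by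
    have := (hΓm u).coeFn_toLp
    rw [hfix] at this
    exact this.symm
  -- The fixed point `u` is only an almost everywhere class. The path is defined by the convolution
  -- formula, which is continuous in time and whose position agrees with `u` almost everywhere.
  refine ⟨fun t => E.convolution μ hμ (fun s => B (u s)) t +
    E.convolution μ hμ (fun s => Q (ψ s)) t, ?_, ?_⟩
  · simp [convolution_zero]
  · rw [isMildSolution_iff_convolution hμ (by simp [convolution_zero])]
    refine ⟨(E.continuousOn_convolution hμ hμc hT (hBu u)).add
      (E.continuousOn_convolution hμ hμc hT hQψ), fun t ht => ?_⟩
    congr 1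
    refine convolution_congr hμ ?_ ht
    filter_upwards [hae] with s hs
    rw [Prod.fst_add, hs]

/-- The solution depends continuously on the convolution of the control. -/
lemma eLpNorm_sub_le_of_isMildSolution (hμ : 0 < μ) (hμc : 4 * μ * E.α 0 ≤ 1) (hT : 0 ≤ T)
    (hq0 : 0 ≤ q) (hq : q < E.α 0) (hB : ∀ x y, ‖B x - B y‖ ≤ q * ‖x - y‖) (hB0 : B 0 = 0)
    {ψ₁ ψ₂ : ℝ → L2 D} {z₁ z₂ : ℝ → E.Phase} (h₁ : E.IsMildSolution Q B μ hμ 0 T ψ₁ z₁)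
    (h₂ : E.IsMildSolution Q B μ hμ 0 T ψ₂ z₂) (h₁0 : z₁ 0 = 0) (h₂0 : z₂ 0 = 0)
    (hψ₁ : MemLp ψ₁ 2 (volume.restrict (Ioo 0 T)))
    (hψ₂ : MemLp ψ₂ 2 (volume.restrict (Ioo 0 T))) :
    eLpNorm (fun t => (z₁ t).1 - (z₂ t).1) 2 (volume.restrict (Ioo 0 T)) ≤
      ENNReal.ofReal (E.α 0 / (E.α 0 - q)) *
        eLpNorm (fun t => (E.convolution μ hμ (fun s => Q (ψ₁ s)) t).1 -
          (E.convolution μ hμ (fun s => Q (ψ₂ s)) t).1) 2 (volume.restrict (Ioo 0 T)) := by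
  rw [isMildSolution_iff_convolution hμ h₁0] at h₁
  rw [isMildSolution_iff_convolution hμ h₂0] at h₂
  have hL := lipschitzWith_of_norm_le hq0 hB
  have hu := memLp_of_continuousOn h₁.1.fst
  have hv := memLp_of_continuousOn h₂.1.fst
  have hQ₁ : MemLp (fun s => Q (ψ₁ s)) 2 (volume.restrict (Ioo 0 T)) := Q.comp_memLp' hψ₁
  have hQ₂ : MemLp (fun s => Q (ψ₂ s)) 2 (volume.restrict (Ioo 0 T)) := Q.comp_memLp' hψ₂
  have hBu : MemLp (fun s => B (z₁ s).1) 2 (volume.restrict (Ioo 0 T)) := hL.comp_memLp hB0 hu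
  have hBv : MemLp (fun s => B (z₂ s).1) 2 (volume.restrict (Ioo 0 T)) := hL.comp_memLp hB0 hv
  have hm1 := (E.memLp_convolution_fst hμ hμc hT hBu).sub (E.memLp_convolution_fst hμ hμc hT hBv)
  have hm2 := (E.memLp_convolution_fst hμ hμc hT hQ₁).sub (E.memLp_convolution_fst hμ hμc hT hQ₂)
  have h := eLpNorm_convolution_sub_le (E := E) hμ hμc hT hq0 hB hB0 hu hv
  have hd := (hu.sub hv).2
  have hle : eLpNorm (fun t => (z₁ t).1 - (z₂ t).1) 2 (volume.restrict (Ioo 0 T)) ≤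
      ENNReal.ofReal (q / E.α 0) *
        eLpNorm (fun t => (z₁ t).1 - (z₂ t).1) 2 (volume.restrict (Ioo 0 T)) +
      eLpNorm (fun t => (E.convolution μ hμ (fun s => Q (ψ₁ s)) t).1 -
          (E.convolution μ hμ (fun s => Q (ψ₂ s)) t).1) 2 (volume.restrict (Ioo 0 T)) := by
    refine le_trans (le_of_eq ?_) ((eLpNorm_add_le hm1.1 hm2.1 one_le_two).trans
      (add_le_add h le_rfl))
    refine eLpNorm_congr_ae ?_
    rw [EventuallyEq, ae_restrict_iff' measurableSet_Ioo]
    refine Eventually.of_forall fun t ht => ?_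
    rw [h₁.2 t (Ioo_subset_Icc_self ht), h₂.2 t (Ioo_subset_Icc_self ht)]
    simp only [Prod.fst_add, Pi.add_apply, Pi.sub_apply]
    abel
  -- Both norms are finite, so the `q / α_1` term can be moved to the left.
  have hd' : eLpNorm (fun t => (z₁ t).1 - (z₂ t).1) 2 (volume.restrict (Ioo 0 T)) < ⊤ := hd
  have he' : eLpNorm (fun t => (E.convolution μ hμ (fun s => Q (ψ₁ s)) t).1 -
          (E.convolution μ hμ (fun s => Q (ψ₂ s)) t).1) 2 (volume.restrict (Ioo 0 T)) < ⊤ := hm2.2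
  generalize eLpNorm (fun t => (z₁ t).1 - (z₂ t).1) 2 (volume.restrict (Ioo 0 T)) = x at *
  generalize eLpNorm (fun t => (E.convolution μ hμ (fun s => Q (ψ₁ s)) t).1 -
    (E.convolution μ hμ (fun s => Q (ψ₂ s)) t).1) 2 (volume.restrict (Ioo 0 T)) = y at *
  lift x to ℝ≥0 using hd'.ne
  lift y to ℝ≥0 using he'.ne
  have hα := E.α_pos
  have hαq : 0 < E.α 0 - q := by linarith
  have hκ : 0 ≤ q / E.α 0 := div_nonneg hq0 hα.le
  rw [← ENNReal.ofReal_coe_nnreal, ← ENNReal.ofReal_coe_nnreal, ← ENNReal.ofReal_mul hκ,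
    ← ENNReal.ofReal_add (by positivity) (by positivity),
    ENNReal.ofReal_le_ofReal_iff (by positivity)] at hle
  rw [← ENNReal.ofReal_coe_nnreal, ← ENNReal.ofReal_coe_nnreal,
    ← ENNReal.ofReal_mul (by positivity)]
  refine ENNReal.ofReal_le_ofReal ?_
  rw [div_mul_eq_mul_div, le_div_iff₀ hαq]
  have := mul_le_mul_of_nonneg_left hle hα.le
  have e : E.α 0 * (q / E.α 0 * (x : ℝ) + y) = q * x + E.α 0 * y := by field_simp
  rw [e] at this
  linarith

end

end DirichletEigenbasis

namespace DirichletEigenbasis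

variable {d : ℕ} {D : Set (EuclideanSpace ℝ (Fin d))} {E : DirichletEigenbasis D}

variable {Q : L2 D →L[ℝ] L2 D} {lam : ℕ → ℝ} {β c μ T : ℝ} {B : L2 D → L2 D}

/-! ### Compactness of the reachable sets -/

/-- Each mode of the convolution is a continuous linear functional of the control. -/
lemma exists_inner_eq_mode_convolution (hQ : E.DiagonalComparable Q lam β c) (hμ : 0 < μ) (k : ℕ)
    {t : ℝ} (ht : t ∈ Icc 0 T) (l : ℝ × ℝ →L[ℝ] ℝ) :
    ∃ y : Lp (L2 D) 2 (volume.restrict (Ioo 0 T)),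
      ∀ f : Lp (L2 D) 2 (volume.restrict (Ioo 0 T)),
        l (E.mode k (E.convolution μ hμ (fun s => Q (f s)) t)) = inner ℝ f y := by
  -- Up to time `t` the functional integrates `κ(s)` against the `k`-th coefficient of the control,
  -- so its Riesz representer is `κ(s) e_k` cut off to `(0, t]`.
  set κ : ℝ → ℝ := fun s => l (modeFlow μ (E.α k) (t - s) (modeForce μ 1)) * lam k with hκ
  have hκc : Continuous κ := by
    refine (l.continuous.comp ?_).mul continuous_const
    exact ((continuous_modeFlow μ (E.α k)).comp (continuous_const.sub continuous_id)).clm_apply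
      continuous_const
  have hm : MemLp (fun s => (Ioc 0 t).indicator (fun s => κ s • E.e k) s) 2
      (volume.restrict (Ioo 0 T)) :=
    (memLp_of_continuousOn (hκc.smul continuous_const).continuousOn).indicator measurableSet_Ioc
  refine ⟨hm.toLp, fun f => ?_⟩
  have hf := Lp.memLp f
  have hQf : MemLp (fun s => Q (f s)) 2 (volume.restrict (Ioo 0 T)) := Q.comp_memLp' hf
  have hs : uIcc 0 t ⊆ uIcc 0 T := by
    rw [uIcc_of_le ht.1, uIcc_of_le (ht.1.trans ht.2)]; exact Icc_subset_Icc_right ht.2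
  have hint := E.intervalIntegrable_coeff
    ((intervalIntegrable_of_memLp (ht.1.trans ht.2) hQf).mono_set hs) k
  rw [E.mode_convolution hμ hQf ht, modeSol,
    ← ContinuousLinearMap.intervalIntegral_comp_comm _ (intervalIntegrable_modeFlow hint t),
    L2.inner_def]
  have e : ∀ᵐ s ∂(volume.restrict (Ioo 0 T)), inner ℝ (f s) (hm.toLp _ s) =
      (Ioc 0 t).indicator (fun s => κ s * E.coeff (f s) k) s := by
    filter_upwards [hm.coeFn_toLp] with s hs
    rw [hs]
    by_cases h : s ∈ Ioc 0 t
    · rw [indicator_of_mem h, indicator_of_mem h, inner_smul_right, real_inner_comm, coeff,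
        HilbertBasis.repr_apply_apply]
    · rw [indicator_of_notMem h, indicator_of_notMem h, inner_zero_right]
  rw [integral_congr_ae e, setIntegral_indicator measurableSet_Ioc,
    intervalIntegral.integral_of_le ht.1]
  have hset : (Ioo 0 T ∩ Ioc 0 t : Set ℝ) =ᵐ[volume] Ioc 0 t := by
    filter_upwards [Measure.ae_ne volume T] with s hs
    refine propext ⟨fun h => h.2, fun h => ⟨⟨h.1, ?_⟩, h⟩⟩
    exact lt_of_le_of_ne (h.2.trans ht.2) hs
  rw [setIntegral_congr_set hset]
  refine integral_congr_ae (Eventually.of_forall fun s => ?_)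
  have e1 : modeForce μ (E.coeff (Q (f s)) k) = (lam k * E.coeff (f s) k) • modeForce μ 1 := by
    rw [← map_smul, smul_eq_mul, mul_one, hQ.coeff]
  simp only [hκ, e1, map_smul, smul_eq_mul]
  ring

lemma tendsto_mode_convolution (hQ : E.DiagonalComparable Q lam β c) (hμ : 0 < μ)
    {u : ℕ → Lp (L2 D) 2 (volume.restrict (Ioo 0 T))}
    {x : Lp (L2 D) 2 (volume.restrict (Ioo 0 T))}
    (h : ∀ y, Tendsto (fun n => inner ℝ (u n) y) atTop (𝓝 (inner ℝ x y))) (k : ℕ)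
    {t : ℝ} (ht : t ∈ Icc 0 T) :
    Tendsto (fun n => E.mode k (E.convolution μ hμ (fun s => Q (u n s)) t)) atTop
      (𝓝 (E.mode k (E.convolution μ hμ (fun s => Q (x s)) t))) := by
  rw [Prod.tendsto_iff]
  constructor
  · obtain ⟨y, hy⟩ := exists_inner_eq_mode_convolution hQ hμ k ht (ContinuousLinearMap.fst ℝ ℝ ℝ)
    have := h y
    simp only [← hy] at this
    exact this
  · obtain ⟨y, hy⟩ := exists_inner_eq_mode_convolution hQ hμ k ht (ContinuousLinearMap.snd ℝ ℝ ℝ)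
    have := h y
    simp only [← hy] at this
    exact this

/-- Bounds on the modes of the convolution of a control, uniform on bounded sets of controls. -/
lemma mode_convolution_control_sq_le (hQ : E.DiagonalComparable Q lam β c) (hμ : 0 < μ)
    (hμc : 4 * μ * E.α 0 ≤ 1) {f : ℝ → L2 D} (hf : MemLp f 2 (volume.restrict (Ioo 0 T)))
    {ρ : ℝ} (hρ : eLpNorm f 2 (volume.restrict (Ioo 0 T)) ≤ ENNReal.ofReal ρ)
    {t : ℝ} (ht : t ∈ Icc 0 T) (k : ℕ) :
    (E.mode k (E.convolution μ hμ (fun s => Q (f s)) t)).1 ^ 2 ≤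
        (2 + 2 * μ⁻¹) * c ^ 2 * ρ ^ 2 * E.α k ^ (-(1 + 2 * β)) ∧
      (E.α k)⁻¹ * (E.mode k (E.convolution μ hμ (fun s => Q (f s)) t)).2 ^ 2 ≤
        (2 + 2 * μ⁻¹) * c ^ 2 * ρ ^ 2 * E.α k ^ (-(1 + 2 * β)) := by
  have hT := ht.1.trans ht.2
  have hQf : MemLp (fun s => Q (f s)) 2 (volume.restrict (Ioo 0 T)) := Q.comp_memLp' hf
  have h := E.mode_convolution_sq_le hμ hμc hQf ht k
  have hα := E.pos k
  have hint := intervalIntegrable_of_integrable_Ioo hT (E.memLp_coeff hf k).integrable_sq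
  have hI0 : 0 ≤ ∫ s in (0 : ℝ)..T, E.coeff (f s) k ^ 2 :=
    intervalIntegral.integral_nonneg hT fun _ _ => sq_nonneg _
  have hI : ∫ s in (0 : ℝ)..T, E.coeff (f s) k ^ 2 ≤ ρ ^ 2 := by
    have h1 : ENNReal.ofReal (∫ s in (0 : ℝ)..T, E.coeff (f s) k ^ 2) ≤
        ENNReal.ofReal ρ ^ 2 := by
      rw [← setLIntegral_ofReal_eq_integral hT (fun t => sq_nonneg _) hint]
      refine le_trans ?_ (pow_le_pow_left' hρ 2)
      rw [eLpNorm_two_sq, E.lintegral_enorm_sq_eq hf.1]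
      exact ENNReal.le_tsum k
    rcases le_total 0 ρ with h0 | h0
    · rwa [← ENNReal.ofReal_pow h0, ENNReal.ofReal_le_ofReal_iff (sq_nonneg ρ)] at h1
    · rw [ENNReal.ofReal_of_nonpos h0, zero_pow two_ne_zero, nonpos_iff_eq_zero,
        ENNReal.ofReal_eq_zero] at h1
      exact h1.trans (sq_nonneg ρ)
  have key : (2 + 2 * μ⁻¹) * ((E.α k)⁻¹ * ∫ s in (0 : ℝ)..T, E.coeff (Q (f s)) k ^ 2) ≤
      (2 + 2 * μ⁻¹) * c ^ 2 * ρ ^ 2 * E.α k ^ (-(1 + 2 * β)) := by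
    have e : ∀ s, E.coeff (Q (f s)) k ^ 2 = lam k ^ 2 * E.coeff (f s) k ^ 2 := fun s => by
      rw [hQ.coeff, mul_pow]
    simp only [e, intervalIntegral.integral_const_mul]
    have e2 : E.α k ^ (-(1 + 2 * β)) = (E.α k)⁻¹ * E.α k ^ (-(2 * β)) := by
      rw [← Real.rpow_neg_one, ← Real.rpow_add hα]
      congr 1
      ring
    rw [e2]
    have := mul_le_mul (hQ.lam_sq_le k) hI hI0 (by positivity)
    calc _ ≤ (2 + 2 * μ⁻¹) * ((E.α k)⁻¹ * (c ^ 2 * E.α k ^ (-(2 * β)) * ρ ^ 2)) := by gcongr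
      _ = _ := by ring
  exact ⟨h.1.trans key, h.2.trans key⟩

/-- This is the source of compactness: weak convergence gives convergence of each mode, and the
summable bound on the modes, uniform over the ball of controls, upgrades it to norm convergence in
the phase space. -/
lemma tendsto_convolution (hQ : E.DiagonalComparable Q lam β c) (hμ : 0 < μ)
    (hμc : 4 * μ * E.α 0 ≤ 1) (hs : Summable fun k => E.α k ^ (-(1 + 2 * β))) {ρ : ℝ}
    {u : ℕ → Lp (L2 D) 2 (volume.restrict (Ioo 0 T))}
    {x : Lp (L2 D) 2 (volume.restrict (Ioo 0 T))}
    (hu : ∀ n, eLpNorm (u n) 2 (volume.restrict (Ioo 0 T)) ≤ ENNReal.ofReal ρ)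
    (h : ∀ y, Tendsto (fun n => inner ℝ (u n) y) atTop (𝓝 (inner ℝ x y)))
    {t : ℝ} (ht : t ∈ Icc 0 T) :
    Tendsto (fun n => E.convolution μ hμ (fun s => Q (u n s)) t) atTop
      (𝓝 (E.convolution μ hμ (fun s => Q (x s)) t)) :=
  E.tendsto_phase_of_dominated (hs.mul_left _) (Eventually.of_forall fun n k =>
    mode_convolution_control_sq_le hQ hμ hμc (Lp.memLp (u n)) (hu n) ht k)
    fun k => tendsto_mode_convolution hQ hμ h k ht

/-- Dominated convergence in time: the positions converge at each `t` and are bounded by the same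
constant for all controls of norm at most `ρ`. -/
lemma tendsto_eLpNorm_convolution_fst (hQ : E.DiagonalComparable Q lam β c) (hμ : 0 < μ)
    (hμc : 4 * μ * E.α 0 ≤ 1) (hT : 0 ≤ T) (hs : Summable fun k => E.α k ^ (-(1 + 2 * β))) {ρ : ℝ}
    {u : ℕ → Lp (L2 D) 2 (volume.restrict (Ioo 0 T))}
    {x : Lp (L2 D) 2 (volume.restrict (Ioo 0 T))}
    (hu : ∀ n, eLpNorm (u n) 2 (volume.restrict (Ioo 0 T)) ≤ ENNReal.ofReal ρ)
    (hx : eLpNorm x 2 (volume.restrict (Ioo 0 T)) ≤ ENNReal.ofReal ρ)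
    (h : ∀ y, Tendsto (fun n => inner ℝ (u n) y) atTop (𝓝 (inner ℝ x y))) :
    Tendsto (fun n => eLpNorm (fun t => (E.convolution μ hμ (fun s => Q (u n s)) t).1 -
        (E.convolution μ hμ (fun s => Q (x s)) t).1) 2 (volume.restrict (Ioo 0 T))) atTop
      (𝓝 0) := by
  have hQf : ∀ f : Lp (L2 D) 2 (volume.restrict (Ioo 0 T)),
      MemLp (fun t => (E.convolution μ hμ (fun s => Q (f s)) t).1) 2
        (volume.restrict (Ioo 0 T)) := fun f =>
    E.memLp_convolution_fst hμ hμc hT (Q.comp_memLp' (Lp.memLp f))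
  set K : ℝ := √((2 + 2 * μ⁻¹) * c ^ 2 * ρ ^ 2 * ∑' k, E.α k ^ (-(1 + 2 * β)))
  have hK : ∀ f : Lp (L2 D) 2 (volume.restrict (Ioo 0 T)),
      eLpNorm f 2 (volume.restrict (Ioo 0 T)) ≤ ENNReal.ofReal ρ → ∀ t ∈ Icc 0 T,
      ‖(E.convolution μ hμ (fun s => Q (f s)) t).1‖ ≤ K := fun f hf t ht => by
    refine Real.le_sqrt_of_sq_le ?_
    rw [E.norm_sq_eq_tsum_coeff, ← tsum_mul_left]
    refine (E.summable_coeff_sq _).tsum_le_tsum (fun k => ?_) (hs.mul_left _)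
    have := (mode_convolution_control_sq_le hQ hμ hμc (Lp.memLp f) hf ht k).1
    rwa [mode_apply] at this
  have hsq : Tendsto (fun n => eLpNorm (fun t => (E.convolution μ hμ (fun s => Q (u n s)) t).1 -
      (E.convolution μ hμ (fun s => Q (x s)) t).1) 2 (volume.restrict (Ioo 0 T)) ^ 2) atTop
      (𝓝 0) := by
    simp only [eLpNorm_two_sq]
    rw [← lintegral_zero (μ := volume.restrict (Ioo 0 T))]
    refine tendsto_lintegral_of_dominated_convergence'
      (fun _ => ENNReal.ofReal (K + K) ^ 2) (fun n => ?_) (fun n => ?_) ?_ ?_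
    · exact ((hQf (u n)).1.sub (hQf x).1).enorm.pow_const 2
    · refine (ae_restrict_iff' measurableSet_Ioo).2
        (Eventually.of_forall fun t ht => pow_le_pow_left' ?_ 2)
      rw [← ofReal_norm]
      exact ENNReal.ofReal_le_ofReal ((norm_sub_le _ _).trans (add_le_add
        (hK _ (hu n) t (Ioo_subset_Icc_self ht)) (hK _ hx t (Ioo_subset_Icc_self ht))))
    · rw [lintegral_const]
      finiteness
    · rw [ae_restrict_iff' measurableSet_Ioo]
      refine Eventually.of_forall fun t ht => ?_
      have h1 := (continuous_fst.tendsto _).comp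
        (tendsto_convolution hQ hμ hμc hs hu h (Ioo_subset_Icc_self ht))
      have h2 := ENNReal.Tendsto.pow (n := 2)
        (h1.sub_const (E.convolution μ hμ (fun s => Q (x s)) t).1).enorm
      simpa using h2
  have := hsq.ennrpow_const ((2 : ℕ) : ℝ)⁻¹
  rw [ENNReal.zero_rpow_of_pos (by norm_num)] at this
  refine this.congr fun n => ?_
  rw [ENNReal.pow_rpow_inv_natCast two_ne_zero]

/-- The states reachable at time `T` with controls in a ball form a compact set. -/
lemma isCompact_reach (hQ : E.DiagonalComparable Q lam β c) (hμ : 0 < μ)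
    (hμc : 4 * μ * E.α 0 ≤ 1) (hT : 0 ≤ T) (hs : Summable fun k => E.α k ^ (-(1 + 2 * β)))
    {q : ℝ} (hq0 : 0 ≤ q) (hq : q < E.α 0) (hB : ∀ x y, ‖B x - B y‖ ≤ q * ‖x - y‖) (hB0 : B 0 = 0)
    {ρ : ℝ} (hρ : 0 ≤ ρ) : IsCompact (E.reach Q B μ hμ T ρ) := by
  -- Needed for the separability of `L²(0,T;H)`, on which the extraction of a weakly convergent
  -- subsequence relies.
  have : Fact ((2 : ℝ≥0∞) ≠ ⊤) := ⟨by simp⟩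
  have hL := lipschitzWith_of_norm_le hq0 hB
  refine IsSeqCompact.isCompact fun p hp => ?_
  choose ψ hψ hψρ z hz hz0 hzT using hp
  have hnorm : ∀ n, ‖(hψ n).toLp‖ ≤ ρ := fun n => by
    rw [Lp.norm_toLp]
    exact ENNReal.toReal_le_of_le_ofReal hρ (hψρ n)
  obtain ⟨x, hx, σ, hσ, hlim⟩ := exists_subseq_tendsto_inner hnorm
  have hxρ : eLpNorm x 2 (volume.restrict (Ioo 0 T)) ≤ ENNReal.ofReal ρ := by
    rw [Lp.norm_def] at hx
    exact (ENNReal.le_ofReal_iff_toReal_le (Lp.eLpNorm_ne_top x) hρ).2 hx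
  have huρ : ∀ n, eLpNorm (hψ (σ n)).toLp 2 (volume.restrict (Ioo 0 T)) ≤ ENNReal.ofReal ρ :=
    fun n => by
      rw [eLpNorm_congr_ae (hψ (σ n)).coeFn_toLp]
      exact hψρ (σ n)
  -- The candidate limit is the solution driven by the weak limit of the controls. Weak lower
  -- semicontinuity of the norm keeps that control in the ball.
  obtain ⟨w, hw0, hw⟩ := exists_isMildSolution (Q := Q) hμ hμc hT hq0 hq hB hB0 (Lp.memLp x)
  refine ⟨w T, ⟨x, Lp.memLp x, hxρ, w, hw, hw0, rfl⟩, σ, hσ, ?_⟩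
  have hconv : ∀ n, ∀ t ∈ Icc 0 T, E.convolution μ hμ (fun s => Q ((hψ (σ n)).toLp _ s)) t =
      E.convolution μ hμ (fun s => Q (ψ (σ n) s)) t := fun n t ht => by
    refine convolution_congr hμ ?_ ht
    filter_upwards [(hψ (σ n)).coeFn_toLp] with s hs
    rw [hs]
  have h1 := tendsto_eLpNorm_convolution_fst hQ hμ hμc hT hs huρ hxρ hlim
  have h2 : Tendsto (fun n => eLpNorm (fun t => (z (σ n) t).1 - (w t).1) 2
      (volume.restrict (Ioo 0 T))) atTop (𝓝 0) := by
    have h3 := ENNReal.Tendsto.const_mul h1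
      (Or.inr (ENNReal.ofReal_ne_top (r := E.α 0 / (E.α 0 - q))))
    rw [mul_zero] at h3
    refine tendsto_of_tendsto_of_tendsto_of_le_of_le tendsto_const_nhds h3 (fun _ => zero_le)
      fun n => ?_
    refine (eLpNorm_sub_le_of_isMildSolution hμ hμc hT hq0 hq hB hB0 (hz (σ n)) hw
      (hz0 (σ n)) hw0 (hψ (σ n)) (Lp.memLp x)).trans (le_of_eq ?_)
    congr 1
    refine eLpNorm_congr_ae ?_
    rw [EventuallyEq, ae_restrict_iff' measurableSet_Ioo]
    refine Eventually.of_forall fun t ht => ?_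
    rw [hconv n t (Ioo_subset_Icc_self ht)]
  have hTT : T ∈ Icc 0 T := right_mem_Icc.2 hT
  rw [isMildSolution_iff_convolution hμ hw0] at hw
  have hwm := memLp_of_continuousOn hw.1.fst
  have hBw : MemLp (fun s => B (w s).1) 2 (volume.restrict (Ioo 0 T)) := hL.comp_memLp hB0 hwm
  -- Positions converge only in `L²(0,T;H)`; the convolution maps this to convergence in the phase
  -- space at the single time `T`.
  have h4 : Tendsto (fun n => E.convolution μ hμ (fun s => B (z (σ n) s).1) T) atTop
      (𝓝 (E.convolution μ hμ (fun s => B (w s).1) T)) := by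
    rw [tendsto_iff_norm_sub_tendsto_zero]
    have h5 := ENNReal.Tendsto.const_mul h2 (Or.inr (ENNReal.ofReal_ne_top (r := q)))
    rw [mul_zero] at h5
    have h6 := ((ENNReal.tendsto_toReal ENNReal.zero_ne_top).comp h5).const_mul
      √((2 + 2 * μ⁻¹) * (E.α 0)⁻¹)
    simp only [ENNReal.toReal_zero, mul_zero] at h6
    refine squeeze_zero (fun _ => norm_nonneg _) (fun n => ?_) h6
    have hzn := (isMildSolution_iff_convolution hμ (hz0 (σ n))).1 (hz (σ n))
    have hzm := memLp_of_continuousOn hzn.1.fst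
    have hBz : MemLp (fun s => B (z (σ n) s).1) 2 (volume.restrict (Ioo 0 T)) :=
      hL.comp_memLp hB0 hzm
    rw [← E.convolution_sub hμ hBz hBw hTT]
    refine (norm_convolution_le hμ hμc (hBz.sub hBw) hTT).trans ?_
    refine mul_le_mul_of_nonneg_left ?_ (Real.sqrt_nonneg _)
    refine ENNReal.toReal_mono (ENNReal.mul_ne_top ENNReal.ofReal_ne_top (hzm.sub hwm).2.ne) ?_
    exact eLpNorm_comp_sub_le hB _ _ _
  rw [hw.2 T hTT]
  refine (h4.add (tendsto_convolution hQ hμ hμc hs huρ hlim hTT)).congr fun n => ?_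
  rw [Function.comp_apply, ← hzT (σ n), hconv n T hTT,
    ((isMildSolution_iff_convolution hμ (hz0 (σ n))).1 (hz (σ n))).2 T hTT]

end DirichletEigenbasis
/-- A `[0, ∞]`-valued function with compact sublevel sets is lower semicontinuous. -/
lemma lowerSemicontinuous_of_isCompact {X : Type*} [TopologicalSpace X] [T2Space X]
    {f : X → ℝ≥0∞} (h : ∀ r : ℝ, 0 ≤ r → IsCompact {x | f x ≤ ENNReal.ofReal r}) :
    LowerSemicontinuous f := by
  rw [lowerSemicontinuous_iff_isClosed_preimage]
  intro y
  rcases eq_or_ne y ⊤ with rfl | hy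
  · simp
  · rw [← ENNReal.ofReal_toReal hy]
    exact (h y.toReal ENNReal.toReal_nonneg).isClosed

namespace DirichletEigenbasis

variable {d : ℕ} {D : Set (EuclideanSpace ℝ (Fin d))} {E : DirichletEigenbasis D}

variable {Q : L2 D →L[ℝ] L2 D} {lam : ℕ → ℝ} {β c μ T : ℝ} {B : L2 D → L2 D}

/-! ### Growth of the eigenvalues -/

lemma tendsto_eigenvalues (hd : 1 ≤ d) {a : ℝ} (ha : 0 < a)
    (h : ∀ k : ℕ, a⁻¹ * ((k : ℝ) + 1) ^ (2 / (d : ℝ)) ≤ E.α k) : Tendsto E.α atTop atTop := by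
  have hd' : (0 : ℝ) < d := by exact_mod_cast hd
  refine tendsto_atTop_mono h (Tendsto.const_mul_atTop (inv_pos.2 ha) ?_)
  exact (tendsto_rpow_atTop (by positivity)).comp
    (tendsto_natCast_atTop_atTop.atTop_add tendsto_const_nhds)

lemma summable_eigenvalues_rpow (hd : 1 ≤ d) {a : ℝ} (ha : 0 < a)
    (h : ∀ k : ℕ, a⁻¹ * ((k : ℝ) + 1) ^ (2 / (d : ℝ)) ≤ E.α k) (hβ : ((d : ℝ) - 2) / 4 < β)
    (hβ0 : 0 ≤ β) : Summable fun k => E.α k ^ (-(1 + 2 * β)) := by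
  have hd' : (0 : ℝ) < d := by exact_mod_cast hd
  -- This is `β > (d-2)/4` rewritten: it says that `∑ k^{-(2/d)(1+2β)}` converges.
  have hp : 1 < 2 / (d : ℝ) * (1 + 2 * β) := by
    rw [div_mul_eq_mul_div, one_lt_div hd']
    linarith
  have hs : Summable fun k : ℕ => (a⁻¹) ^ (-(1 + 2 * β)) *
      (((k + 1 : ℕ) : ℝ) ^ (2 / (d : ℝ) * (1 + 2 * β)))⁻¹ :=
    ((summable_nat_add_iff 1).2 (Real.summable_nat_rpow_inv.2 hp)).mul_left _
  refine hs.of_nonneg_of_le (fun k => Real.rpow_nonneg (E.pos k).le _) fun k => ?_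
  have hk : (0 : ℝ) < (k : ℝ) + 1 := by positivity
  refine (Real.rpow_le_rpow_of_nonpos (by positivity) (h k) (by linarith)).trans (le_of_eq ?_)
  rw [Real.mul_rpow (by positivity) (by positivity), ← Real.rpow_mul hk.le, mul_neg,
    Real.rpow_neg hk.le]
  push_cast
  rfl

/-! ### Sublevel sets of the quasi-potential -/

lemma quasiPotential_le_of_mem_reach (hμ : 0 < μ) (hT : 0 < T) {ρ : ℝ} {p : E.Phase}
    (hp : p ∈ E.reach Q B μ hμ T ρ) :
    E.quasiPotential Q B μ hμ p ≤ 1 / 2 * ENNReal.ofReal ρ ^ 2 := by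
  obtain ⟨ψ, hψ, hρ, z, hz, hz0, hzT⟩ := hp
  refine (iInf₂_le_of_le T hT (iInf₂_le_of_le z hz.1 (iInf₂_le_of_le hz0 hzT le_rfl))).trans ?_
  refine mul_le_mul_right ?_ _
  refine iInf₂_le_of_le ψ hψ (iInf_le_of_le hz ?_)
  rw [← eLpNorm_two_sq]
  exact pow_le_pow_left' hρ 2

lemma exists_mem_reach_of_quasiPotential_lt (hμ : 0 < μ) {ρ : ℝ} {p : E.Phase}
    (hp : E.quasiPotential Q B μ hμ p < 1 / 2 * ENNReal.ofReal ρ ^ 2) :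
    ∃ T, 0 < T ∧ p ∈ E.reach Q B μ hμ T ρ := by
  simp only [quasiPotential, iInf_lt_iff] at hp
  obtain ⟨T, hT, z, -, hz0, hzT, h⟩ := hp
  have h2 := lt_of_mul_lt_mul_left' h
  simp only [iInf_lt_iff] at h2
  obtain ⟨ψ, hψ, hz, h3⟩ := h2
  rw [← eLpNorm_two_sq] at h3
  exact ⟨T, hT, ψ, hψ, (ENNReal.pow_le_pow_left_iff two_ne_zero).1 h3.le, z, hz, hz0, hzT⟩

/-- The infimum need not be attained, hence the slack `1/(n+1)`. A point of the level set is reached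
at some time with norm `ε n`, hence at time `n + 2` with norm `ρ n`. Conversely, lying in all these
reachable sets bounds the quasi-potential by `ρ n ^ 2 / 2`, which tends to `r`. -/
lemma isCompact_quasiPotential_le (hQ : E.DiagonalComparable Q lam β c) (hβ : 0 ≤ β)
    (hB : ∀ δ ∈ Icc 0 (1 + 2 * β), E.LipschitzSobolev B δ) (hB0 : B 0 = 0) (hμ : 0 < μ)
    (hμc : 4 * μ * E.α 0 ≤ 1) (hs : Summable fun k => E.α k ^ (-(1 + 2 * β))) {r : ℝ}
    (hr : 0 ≤ r) : IsCompact {p | E.quasiPotential Q B μ hμ p ≤ ENNReal.ofReal r} := by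
  obtain ⟨q, hq0, hq, hqB⟩ := (hB 0 ⟨le_rfl, by linarith⟩).exists_norm_le
  obtain ⟨C, hC, hCr⟩ := exists_reach_subset hQ hβ hB hB0 hμ hμc
  set ε : ℕ → ℝ := fun n => √(2 * (r + 1 / ((n : ℝ) + 1))) with hε
  -- The reaching time is `n + 2` because the restart argument needs `N ≥ 2`; the correction
  -- vanishes as `n → ∞`.
  set ρ : ℕ → ℝ := fun n => ε n + C * ε n / √((n : ℝ) + 2) with hρ
  have hε0 : ∀ n, 0 ≤ ε n := fun n => Real.sqrt_nonneg _
  have hρ0 : ∀ n, 0 ≤ ρ n := fun n => by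
    have := hε0 n
    positivity
  have hεlim : Tendsto ε atTop (𝓝 √(2 * r)) := by
    have h := ((tendsto_one_div_add_atTop_nhds_zero_nat (𝕜 := ℝ)).const_add r).const_mul 2
    rw [add_zero] at h
    exact h.sqrt
  have hρlim : Tendsto (fun n => 1 / 2 * ENNReal.ofReal (ρ n) ^ 2) atTop
      (𝓝 (ENNReal.ofReal r)) := by
    have h1 : Tendsto (fun n : ℕ => √((n : ℝ) + 2)) atTop atTop :=
      Real.tendsto_sqrt_atTop.comp (tendsto_natCast_atTop_atTop.atTop_add tendsto_const_nhds)
    have h2 := hεlim.add ((hεlim.const_mul C).div_atTop h1)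
    rw [add_zero] at h2
    have h3 := ENNReal.tendsto_ofReal ((h2.pow 2).const_mul (1 / 2))
    have e : 1 / 2 * √(2 * r) ^ 2 = r := by
      rw [Real.sq_sqrt (by positivity)]
      ring
    rw [e] at h3
    refine h3.congr fun n => ?_
    rw [ENNReal.ofReal_mul (by norm_num), ENNReal.ofReal_pow (hρ0 n)]
    congr 1
    rw [ENNReal.ofReal_div_of_pos two_pos]
    simp
  have heq : {p | E.quasiPotential Q B μ hμ p ≤ ENNReal.ofReal r} =
      ⋂ n : ℕ, E.reach Q B μ hμ ((n : ℝ) + 2) (ρ n) := by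
    ext p
    rw [mem_ofPred_eq, mem_iInter]
    constructor
    · intro hp n
      have hlt : E.quasiPotential Q B μ hμ p < 1 / 2 * ENNReal.ofReal (ε n) ^ 2 := by
        refine hp.trans_lt ?_
        have hn : 0 < 1 / ((n : ℝ) + 1) := by positivity
        have e : 1 / 2 * ENNReal.ofReal (ε n) ^ 2 = ENNReal.ofReal (r + 1 / ((n : ℝ) + 1)) := by
          rw [← ENNReal.ofReal_pow (hε0 n), Real.sq_sqrt (by positivity),
            ENNReal.ofReal_mul two_pos.le, ← mul_assoc]
          simp [ENNReal.inv_mul_cancel]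
        rw [e, ENNReal.ofReal_lt_ofReal_iff (by positivity)]
        linarith
      obtain ⟨T, hT, hpT⟩ := exists_mem_reach_of_quasiPotential_lt hμ hlt
      exact hCr T _ _ hT.le (by linarith [(Nat.cast_nonneg n : (0 : ℝ) ≤ n)]) (hε0 n) hpT
    · intro hp
      exact ge_of_tendsto' hρlim fun n =>
        quasiPotential_le_of_mem_reach hμ (by positivity) (hp n)
  have hc : ∀ n : ℕ, IsCompact (E.reach Q B μ hμ ((n : ℝ) + 2) (ρ n)) := fun n =>
    isCompact_reach hQ hμ hμc (by positivity) hs hq0.le hq hqB hB0 (hρ0 n)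
  rw [heq]
  exact (hc 0).of_isClosed_subset (isClosed_iInter fun n => (hc n).isClosed)
    (iInter_subset _ 0)

/-- With slack `1/(n+1)` a suitable velocity `y` always exists, so the level set is the intersection
of projections of compact level sets, with no need for the infimum over `y` to be attained. -/
lemma isCompact_quasiPotentialFst_le (hμ : 0 < μ)
    (h : ∀ r, 0 ≤ r → IsCompact {p | E.quasiPotential Q B μ hμ p ≤ ENNReal.ofReal r}) {r : ℝ}
    (hr : 0 ≤ r) : IsCompact {x | E.quasiPotentialFst Q B μ hμ x ≤ ENNReal.ofReal r} := by
  have hc : ∀ n : ℕ, IsCompact (Prod.fst '' {p : E.Phase |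
      E.quasiPotential Q B μ hμ p ≤ ENNReal.ofReal (r + 1 / ((n : ℝ) + 1))}) := fun n =>
    (h _ (by positivity)).image continuous_fst
  have heq : {x | E.quasiPotentialFst Q B μ hμ x ≤ ENNReal.ofReal r} =
      ⋂ n : ℕ, Prod.fst '' {p : E.Phase |
        E.quasiPotential Q B μ hμ p ≤ ENNReal.ofReal (r + 1 / ((n : ℝ) + 1))} := by
    ext x
    rw [mem_ofPred_eq, mem_iInter]
    constructor
    · intro hx n
      have hn : 0 < 1 / ((n : ℝ) + 1) := by positivity
      have hlt : E.quasiPotentialFst Q B μ hμ x < ENNReal.ofReal (r + 1 / ((n : ℝ) + 1)) :=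
        hx.trans_lt ((ENNReal.ofReal_lt_ofReal_iff (by positivity)).2 (by linarith))
      obtain ⟨y, hy⟩ := iInf_lt_iff.1 hlt
      exact ⟨(x, y), hy.le, rfl⟩
    · intro hx
      have hlim := ENNReal.tendsto_ofReal
        ((tendsto_one_div_add_atTop_nhds_zero_nat (𝕜 := ℝ)).const_add r)
      rw [add_zero] at hlim
      refine ge_of_tendsto' hlim fun n => ?_
      obtain ⟨⟨x', y⟩, hy, rfl⟩ := hx n
      exact iInf_le_of_le y hy
  rw [heq]
  exact (hc 0).of_isClosed_subset (isClosed_iInter fun n => (hc n).isClosed)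
    (iInter_subset _ 0)

end DirichletEigenbasis

end DampedWave

end

/-! ### The main theorem -/

theorem mainTheorem7 {d : ℕ} (hd : 1 ≤ d) (D : Set (EuclideanSpace ℝ (Fin d)))
    (hDopen : IsOpen D) (hDbdd : Bornology.IsBounded D)
    (E : DampedWave.DirichletEigenbasis D)
    -- `α_k ∼ k^{2/d}`
    (hα : ∃ c : ℝ, 0 < c ∧ ∀ k : ℕ, c⁻¹ * ((k : ℝ) + 1) ^ (2 / (d : ℝ)) ≤ E.α k ∧
      E.α k ≤ c * ((k : ℝ) + 1) ^ (2 / (d : ℝ)))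
    -- `Q` is bounded and diagonal, with eigenvalues comparable to `α_k^{-β}`
    (Q : DampedWave.L2 D →L[ℝ] DampedWave.L2 D) (lam : ℕ → ℝ) (β : ℝ)
    (hQ : ∀ k, Q (E.e k) = lam k • E.e k)
    (hlam : ∃ c : ℝ, 0 < c ∧ ∀ k : ℕ, c⁻¹ * E.α k ^ (-β) ≤ lam k ∧ lam k ≤ c * E.α k ^ (-β))
    (hβ : ((d : ℝ) - 2) / 4 < β)
    -- `B : H^δ → H^δ` is Lipschitz with constant `γ_δ < α_1`, for every `δ ∈ [0, 1 + 2β]`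
    (B : DampedWave.L2 D → DampedWave.L2 D)
    (hB : ∀ δ ∈ Set.Icc (0 : ℝ) (1 + 2 * β),
      (∀ x, E.MemSobolev δ (E.coeff x) → E.MemSobolev δ (E.coeff (B x))) ∧
      ∃ γ : ℝ, γ < E.α 0 ∧ ∀ x y, E.MemSobolev δ (E.coeff x) → E.MemSobolev δ (E.coeff y) →
        E.sobolevNorm δ (E.coeff (B x - B y)) ≤ γ * E.sobolevNorm δ (E.coeff (x - y)))
    (hB0 : B 0 = 0) :
    ∃ μ₀ : ℝ, 0 < μ₀ ∧ ∀ (μ : ℝ) (hμ : 0 < μ), μ ≤ μ₀ →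
      (∀ r : ℝ, 0 ≤ r →
        IsCompact {p : E.Phase | E.quasiPotential Q B μ hμ p ≤ ENNReal.ofReal r} ∧
        IsCompact {x : DampedWave.L2 D | E.quasiPotentialFst Q B μ hμ x ≤ ENNReal.ofReal r}) ∧
      LowerSemicontinuous (E.quasiPotential Q B μ hμ) ∧
      LowerSemicontinuous (E.quasiPotentialFst Q B μ hμ) := by
  obtain ⟨a, ha, hα⟩ := hα
  obtain ⟨c, hc, hlam⟩ := hlam
  have hQ' : E.DiagonalComparable Q lam β c := ⟨hQ, hc, hlam⟩
  have hα' : ∀ k : ℕ, a⁻¹ * ((k : ℝ) + 1) ^ (2 / (d : ℝ)) ≤ E.α k := fun k => (hα k).1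
  have hβ0 := hQ'.nonneg (DampedWave.DirichletEigenbasis.tendsto_eigenvalues hd ha hα')
  have hs := DampedWave.DirichletEigenbasis.summable_eigenvalues_rpow hd ha hα' hβ hβ0
  have h4 : 0 < 4 * E.α 0 := mul_pos four_pos E.α_pos
  -- The threshold is exactly the condition `4 μ α_1 ≤ 1` of the energy estimate.
  refine ⟨(4 * E.α 0)⁻¹, inv_pos.2 h4, fun μ hμ hμ₀ => ?_⟩
  have hμc : 4 * μ * E.α 0 ≤ 1 := by
    have := mul_le_mul_of_nonneg_right hμ₀ h4.le
    rw [inv_mul_cancel₀ h4.ne'] at this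
    linarith
  have hV : ∀ r, 0 ≤ r → IsCompact {p | E.quasiPotential Q B μ hμ p ≤ ENNReal.ofReal r} :=
    fun r hr => DampedWave.DirichletEigenbasis.isCompact_quasiPotential_le hQ' hβ0 hB hB0 hμ hμc
      hs hr
  have hV₁ : ∀ r, 0 ≤ r → IsCompact {x | E.quasiPotentialFst Q B μ hμ x ≤ ENNReal.ofReal r} :=
    fun r hr => DampedWave.DirichletEigenbasis.isCompact_quasiPotentialFst_le hμ hV hr
  exact ⟨fun r hr => ⟨hV r hr, hV₁ r hr⟩, DampedWave.lowerSemicontinuous_of_isCompact hV,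
    DampedWave.lowerSemicontinuous_of_isCompact hV₁⟩
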